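/- Let $T=(V,E)$ be a finite tree with at least one edge, rooted at a node $r$, with edges $(u,v)\in E$ directed away from $r$; a node of degree one is a leaf, every other node is an inner node. Let $\Theta_T=[0,1]^{2|E|+1}$ be the set of parameters $\theta=(\theta^{(r)}_1,(\theta^{(v)}_{1|0},\theta^{(v)}_{1|1})_{(u,v)\in E})$, with $\theta^{(r)}_0=1-\theta^{(r)}_1$ and $\theta^{(v)}_{0|i}=1-\theta^{(v)}_{1|i}$. Under $\theta$ the binary variables $(Y_v)_{v\in V}$ have the law $p_\alpha(\theta)=\theta^{(r)}_{\alpha_r}\prod_{(u,v)\in E}\theta^{(v)}_{\alpha_v|\alpha_u}$, $\alpha\in\{0,1\}^V$. Let $f_T(\theta)$ be the induced law of $(Y_i)_{i\text{ a leaf}}$ and $\mathcal M_T=f_T(\Theta_T)$. Put $\eta_{u,v}=\theta^{(v)}_{1|1}-\theta^{(v)}_{1|0}$ for $(u,v)\in E$ and $\bar\mu_v=1-2\,\mathbb E Y_v$ for $v\in V$; let $\Omega_T\subset\mathbb R^{|V|+|E|}$ be the image of $\Theta_T$ under $\theta\mapsto((\bar\mu_v),(\eta_{u,v}))$. Let $\hat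 p\in\mathcal M_T$ be such that no leaf variable is degenerate, that is, $\hat\lambda_i(1-\hat\lambda_i)\neq0$ for every leaf $i$, where $\hat\lambda_i$ is the mean of the variable at $i$ under $\hat p$. The $\hat p$-fiber $\widehat\Omega_T\subseteq\Omega_T$ is the image of $f_T^{-1}(\hat p)\subseteq\Theta_T$ in $\Omega_T$. Let $\widehat E\subseteq E$ be the set of isolated edges: those $e$ such that the covariance of the variables at $i$ and $j$ under $\hat p$ vanishes for all leaves $i,j$ whose connecting path contains $e$. An inner node is degenerate with respect to $\hat p$ if its degree in the forest $T\setminus\widehat E$ is less than two; let $\widehat V$ be the set of degenerate nodes. Let $$\widehat\Omega_{\mathrm{deep}}=\{\omega\in\widehat\Omega_T:\ \eta_{u,v}=0\text{ for all }(u,v)\in\widehat E,\ \bar\mu_v^2=1\text{ for all }v\in\widehat V\}$$ be the deepest singularity. Theorem. Suppose that $\widehat V\neq\emptyset$. Then there are finitely many real algebraic sets $M_1,\dots,M_k\subseteq\mathbb R^{|V|+|E|}$, each of which is a smooth embedded (not necessarily connected) submanifold of $\mathbb R^{|V|+|E|}$ of some dimension, such that 1. $\widehat\Omega_T=(M_1\cup\dots\cup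 M_k)\cap\Omega_T$; 2. $M_1\cap\dots\cap M_k\cap\Omega_T=\widehat\Omega_{\mathrm{deep}}$; 3. $M_1\cup\dots\cup M_k$ is singular at every point of $\widehat\Omega_{\mathrm{deep}}$: near such a point it is not a smooth embedded submanifold of any dimension. Moreover, $\widehat\Omega_{\mathrm{deep}}$ is non-empty, it lies on the (topological) boundary of $\Omega_T$, and the $\hat p$-fiber $\widehat\Omega_T$ is itself singular at every point of $\widehat\Omega_{\mathrm{deep}}$: near such a point it is not a smooth embedded submanifold with corners of $\mathbb R^{|V|+|E|}$. -/

import Mathlib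

/-- A tree on the node set `V` together with a distinguished root; it carries the Markov model of
binary random variables that is defined below. -/
structure BinaryTreeModel (V : Type*) where
  graph : SimpleGraph V
  isTree : graph.IsTree
  root : V

/-- The random variables are binary; `bit` is the numerical value of an outcome. -/
def bit (b : Bool) : ℝ := if b then 1 else 0

/-- The probability of the outcome `b` for a binary variable equal to `1` with probability `t`. -/
def bernoulliWeight (t : ℝ) (b : Bool) : ℝ := if b then t else 1 - t

namespace BinaryTreeModel

variable {V : Type*} (T : BinaryTreeModel V)

/-- The directed edges `(u, v)` of the rooted tree, pointing away from the root. -/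
def Edge : Type _ :=
  {e : V × V // T.graph.Adj e.1 e.2 ∧
    T.graph.dist T.root e.2 = T.graph.dist T.root e.1 + 1}

/-- The tail (parent) `u` of the edge `(u, v)`. -/
def Edge.src {T : BinaryTreeModel V} (e : T.Edge) : V := e.1.1

/-- The head (child) `v` of the edge `(u, v)`. -/
def Edge.tgt {T : BinaryTreeModel V} (e : T.Edge) : V := e.1.2

/-- A leaf is a node of degree one; all other nodes are inner nodes. -/
def IsLeaf (v : V) : Prop := (T.graph.neighborSet v).ncard = 1

/-- The leaves of the tree; they index the observed variables. -/
def Leaf : Type _ := {v : V // T.IsLeaf v}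

/-- The original parameters: the root probability `θ.1`, and for every edge `e = (u, v)` and every
`a`, the probability `θ.2 e a` that `Y_v = 1` given `Y_u = a`. -/
abbrev Theta : Type _ := ℝ × (T.Edge → Bool → ℝ)

/-- The space of the coordinates `(μ̄_v)_{v ∈ V}`, `(η_e)_{e ∈ E}`. -/
abbrev Param : Type _ := V ⊕ T.Edge → ℝ

/-- The parameter space `Θ_T = [0,1]^{2|E|+1}`. -/
def thetaSpace : Set T.Theta :=
  {θ | θ.1 ∈ Set.Icc (0 : ℝ) 1 ∧ ∀ e a, θ.2 e a ∈ Set.Icc (0 : ℝ) 1}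

section Finite

variable [Fintype V] [DecidableEq V]

noncomputable instance : Fintype T.Edge := by
  classical
  exact (inferInstance : Fintype {e : V × V // T.graph.Adj e.1 e.2 ∧
    T.graph.dist T.root e.2 = T.graph.dist T.root e.1 + 1})

instance : DecidableEq T.Edge :=
  inferInstanceAs (DecidableEq {e : V × V // T.graph.Adj e.1 e.2 ∧
    T.graph.dist T.root e.2 = T.graph.dist T.root e.1 + 1})

noncomputable instance : Fintype T.Leaf := by
  classical
  exact (inferInstance : Fintype {v : V // T.IsLeaf v})

instance : DecidableEq T.Leaf := inferInstanceAs (DecidableEq {v : V // T.IsLeaf v})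

/-- The probability of the outcome `α ∈ {0,1}^V` of all (hidden and observed) variables in the
Markov process on the rooted tree. -/
noncomputable def jointProb (θ : T.Theta) (α : V → Bool) : ℝ :=
  bernoulliWeight θ.1 (α T.root) *
    ∏ e : T.Edge, bernoulliWeight (θ.2 e (α e.src)) (α e.tgt)

/-- The marginal probability mass function of the variables at the leaves: the map `f_T`. -/
noncomputable def marginal (θ : T.Theta) (β : T.Leaf → Bool) : ℝ :=
  ∑ α : V → Bool with (∀ i : T.Leaf, α i.1 = β i), T.jointProb θ α

/-- The general Markov model `M_T` on the tree. -/
def model : Set ((T.Leaf → Bool) → ℝ) := T.marginal '' T.thetaSpace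

/-- The mean `λ_v = E Y_v`. -/
noncomputable def nodeMean (θ : T.Theta) (v : V) : ℝ :=
  ∑ α : V → Bool, bit (α v) * T.jointProb θ α

/-- The change of parameters `μ̄_v = 1 - 2 λ_v`, `η_{u,v} = θ^{(v)}_{1|1} - θ^{(v)}_{1|0}`. -/
noncomputable def reparam (θ : T.Theta) : T.Param :=
  Sum.elim (fun v => 1 - 2 * T.nodeMean θ v) (fun e => θ.2 e true - θ.2 e false)

/-- The new parameter space `Ω_T`. -/
def omegaSpace : Set T.Param := T.reparam '' T.thetaSpace

/-- The `p`-fiber in the original parameters. -/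
def thetaFiber (p : (T.Leaf → Bool) → ℝ) : Set T.Theta :=
  {θ ∈ T.thetaSpace | T.marginal θ = p}

/-- The `p`-fiber in the new parameters. -/
def omegaFiber (p : (T.Leaf → Bool) → ℝ) : Set T.Param := T.reparam '' T.thetaFiber p

/-- The mean of the observed variable at the leaf `i` with respect to `p`. -/
noncomputable def leafMean (p : (T.Leaf → Bool) → ℝ) (i : T.Leaf) : ℝ :=
  ∑ β : T.Leaf → Bool, p β * bit (β i)

/-- The covariance of the observed variables at the leaves `i`, `j` with respect to `p`. -/
noncomputable def leafCov (p : (T.Leaf → Bool) → ℝ) (i j : T.Leaf) : ℝ :=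
  ∑ β : T.Leaf → Bool, p β * ((bit (β i) - T.leafMean p i) * (bit (β j) - T.leafMean p j))

/-- The undirected edges that are isolated relative to `p`: the covariance of `i`, `j` vanishes
whenever the edge lies on the path between the leaves `i` and `j`. -/
def isolatedEdges (p : (T.Leaf → Bool) → ℝ) : Set (Sym2 V) :=
  {e ∈ T.graph.edgeSet | ∀ (i j : T.Leaf) (w : T.graph.Walk i.1 j.1),
    w.IsPath → e ∈ w.edges → T.leafCov p i j = 0}

/-- The forest obtained from the tree by removing the edges isolated relative to `p`. -/
def forest (p : (T.Leaf → Bool) → ℝ) : SimpleGraph V :=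
  T.graph.deleteEdges (T.isolatedEdges p)

/-- A node is degenerate with respect to `p` if it is an inner node of the tree and its degree in
the `p`-forest is less than two. -/
def degenerateNodes (p : (T.Leaf → Bool) → ℝ) : Set V :=
  {v | ¬ T.IsLeaf v ∧ ((T.forest p).neighborSet v).ncard < 2}

/-- The deepest singularity of the `p`-fiber. -/
def deepestSingularity (p : (T.Leaf → Bool) → ℝ) : Set T.Param :=
  {ω ∈ T.omegaFiber p |
    (∀ e : T.Edge, s(e.src, e.tgt) ∈ T.isolatedEdges p → ω (Sum.inr e) = 0) ∧
    (∀ v ∈ T.degenerateNodes p, ω (Sum.inl v) ^ 2 = 1)}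

end Finite

end BinaryTreeModel

section Geometry

variable {ι : Type*} [Fintype ι]

/-- A smooth local coordinate system of `ℝ^ι`: a diffeomorphism between open subsets. -/
def IsSmoothChart (φ : OpenPartialHomeomorph (ι → ℝ) (ι → ℝ)) : Prop :=
  ContDiffOn ℝ (⊤ : ℕ∞) φ φ.source ∧ ContDiffOn ℝ (⊤ : ℕ∞) φ.symm φ.target

/-- Near the point `x`, the set `S` is a smooth (embedded) submanifold of `ℝ^ι` of dimension `d`:
in suitable smooth local coordinates it is given by the vanishing of `|ι| - d` coordinates. -/
def IsSubmanifoldNear (S : Set (ι → ℝ)) (d : ℕ) (x : ι → ℝ) : Prop :=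
  ∃ φ : OpenPartialHomeomorph (ι → ℝ) (ι → ℝ), IsSmoothChart φ ∧ x ∈ φ.source ∧
    ∃ A : Finset ι, A.card + d = Fintype.card ι ∧
      ∀ y ∈ φ.source, (y ∈ S ↔ ∀ i ∈ A, φ y i = 0)

/-- A smooth (embedded, not necessarily connected) submanifold of `ℝ^ι`. -/
def IsSmoothSubmanifold (S : Set (ι → ℝ)) : Prop :=
  ∃ d : ℕ, ∀ x ∈ S, IsSubmanifoldNear S d x

/-- Near the point `x`, the set `S` is a smooth submanifold with corners of `ℝ^ι`: in suitable
smooth local coordinates it is given by the vanishing of some coordinates and the non-negativity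
of some others. -/
def IsManifoldWithCornersNear (S : Set (ι → ℝ)) (x : ι → ℝ) : Prop :=
  ∃ φ : OpenPartialHomeomorph (ι → ℝ) (ι → ℝ), IsSmoothChart φ ∧ x ∈ φ.source ∧
    ∃ A B : Finset ι, ∀ y ∈ φ.source,
      (y ∈ S ↔ (∀ i ∈ A, φ y i = 0) ∧ ∀ i ∈ B, 0 ≤ φ y i)

/-- A real algebraic variety in `ℝ^ι`: the common zero set of a set of real polynomials. -/
def IsRealVariety (S : Set (ι → ℝ)) : Prop :=
  ∃ P : Set (MvPolynomial ι ℝ), S = {x | ∀ q ∈ P, MvPolynomial.eval x q = 0}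

end Geometry

/-! In the coordinates (μ̄, η) the joint law expands over edge sets: every edge contributes either
its dependence term, with the factor η_e, or its independence term (`jointProb_toTheta`). Once the
hidden variables are summed out, an edge set survives only if all its nodes of degree one are leaves
(`LeafClosed`). In particular the covariance of two leaves is the product of the η_e along their
path times the variance of its top node, and a suitable third central moment carries one more factor
μ̄_v, where v is the node in which the three legs meet.

A vanishing covariance therefore forces some η_e to vanish or some node to be constant. At a point
of the fiber the vanishing degenerate coordinates form a cutset: they meet every leaf-closed edge
set that leaves the forest (`isCutset_zeroSet`). Conversely, once a cutset vanishes, the leaf law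
depends only on the means at leaves and branching nodes of the forest and on suitably scaled
products of the η_e along chains through nodes of degree two (`marginal_eq_of_agree`). The law
determines these data up to sign (`omegaFiber_rigid_sq`, `omegaFiber_chainProd_sq`). So every cutset
gives a `stratum`, on which certain monomial functions take finitely many values; it is smooth
because each function is linear in its own pivot coordinate, with a nonvanishing coefficient free of
pivots. The M_j are the strata of all cutsets; the largest cutset accounts for the intersection.

For the singularity, each coordinate in `contactCoords` is moved by some ray that starts at the
deepest point and stays in the fiber for a short time. The tangent cone of a manifold with corners
is convex, so such a manifold would contain nearby points at which all contact coordinates have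
moved at once (`IsManifoldWithCornersNear.exists_mem_ne`). But every cutset contains a contact
coordinate (`IsCutset.exists_contact`), and this coordinate cannot have moved. The argument covers
both the fiber and the union of the strata. -/

namespace BinaryTreeModel

/-! ### Paths and separation in the rooted tree. -/

section Combinatorics

variable {V : Type*} {T : BinaryTreeModel V}

/-- The node `v` is an endpoint of the edge `e`. -/
def Edge.Inc (e : T.Edge) (v : V) : Prop := e.src = v ∨ e.tgt = v

noncomputable instance (e : T.Edge) : DecidablePred e.Inc := fun _ => Classical.dec _

theorem Edge.adj (e : T.Edge) : T.graph.Adj e.src e.tgt := e.2.1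

theorem Edge.dist_tgt (e : T.Edge) :
    T.graph.dist T.root e.tgt = T.graph.dist T.root e.src + 1 := e.2.2

theorem Edge.src_ne_tgt (e : T.Edge) : e.src ≠ e.tgt := e.adj.ne

theorem Edge.ext_ends {e f : T.Edge} (h : e.src = f.src) (h' : e.tgt = f.tgt) : e = f :=
  Subtype.ext (Prod.ext h h')

theorem Edge.tgt_ne_root (e : T.Edge) : e.tgt ≠ T.root := by
  intro h
  have := e.dist_tgt
  rw [h, SimpleGraph.dist_self] at this
  omega

/-- Appending an edge to a geodesic from the root to its tail gives a path, since distances grow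
along the edge. Paths in a tree are unique, so the head determines the penultimate node. -/
theorem Edge.tgt_injective : Function.Injective (Edge.tgt : T.Edge → V) := by
  have key : ∀ e : T.Edge, ∃ w : T.graph.Walk T.root e.tgt, w.IsPath ∧ w.penultimate = e.src := by
    intro e
    obtain ⟨w, hw, hl⟩ := T.isTree.connected.exists_path_of_dist T.root e.src
    refine ⟨w.concat e.adj, hw.concat (fun hmem => ?_) e.adj, by simp⟩
    classical
    have h1 := SimpleGraph.dist_le (w.takeUntil _ hmem)
    have h2 := w.length_takeUntil_le_length hmem
    have h3 := e.dist_tgt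
    omega
  intro e f h
  obtain ⟨w, hw, hs⟩ := key e
  obtain ⟨w', hw', hs'⟩ := key f
  refine Edge.ext_ends ?_ h
  rw [← hs, ← hs']
  have h' : e.tgt = f.tgt := h
  clear hs hs' h
  generalize e.tgt = x at *
  subst h'
  rw [(T.isTree.existsUnique_path _ _).unique hw hw']

theorem exists_edge_of_adj {x y : V} (h : T.graph.Adj x y) :
    ∃ e : T.Edge, (e.src = x ∧ e.tgt = y) ∨ (e.src = y ∧ e.tgt = x) := by
  rcases T.isTree.dist_eq_dist_add_one_of_adj T.root h with h' | h'
  · exact ⟨⟨(y, x), h.symm, h'⟩, Or.inr ⟨rfl, rfl⟩⟩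
  · exact ⟨⟨(x, y), h, h'⟩, Or.inl ⟨rfl, rfl⟩⟩

theorem exists_edge_tgt {v : V} (hv : v ≠ T.root) : ∃ e : T.Edge, e.tgt = v := by
  obtain ⟨w, hw, hl⟩ := T.isTree.connected.exists_path_of_dist T.root v
  have hn : ¬ w.Nil := fun h => hv h.eq.symm
  have hadj := w.adj_penultimate hn
  obtain ⟨e, he | he⟩ := exists_edge_of_adj (T := T) hadj
  · exact ⟨e, he.2⟩
  · exfalso
    have h1 := e.dist_tgt
    rw [he.1, he.2] at h1
    have h2 := SimpleGraph.dist_le w.dropLast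
    have h3 : w.dropLast.length ≤ w.length := by simp
    omega

theorem edge_eq_of_sym2 {e f : T.Edge} (h : s(e.src, e.tgt) = s(f.src, f.tgt)) : e = f := by
  rcases Sym2.eq_iff.1 h with h | h
  · exact Edge.ext_ends h.1 h.2
  · have h1 := e.dist_tgt
    have h2 := f.dist_tgt
    rw [h.1, h.2] at h1
    omega

/-- Induction along the rooted tree. -/
theorem root_induction {P : V → Prop} (h0 : P T.root) (h1 : ∀ e : T.Edge, P e.src → P e.tgt)
    (v : V) : P v := by
  induction hn : T.graph.dist T.root v generalizing v with
  | zero =>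
    have : T.root = v := T.isTree.connected.dist_eq_zero_iff.1 hn
    exact this ▸ h0
  | succ n ih =>
    have hv : v ≠ T.root := by
      rintro rfl
      simp at hn
    obtain ⟨e, rfl⟩ := exists_edge_tgt hv
    exact h1 e (ih _ (by have := e.dist_tgt; omega))

/-- The node `x` is a descendant of the head of `e`, or equal to it. -/
inductive Edge.Below (e : T.Edge) : V → Prop
  | base : Edge.Below e e.tgt
  | step (f : T.Edge) : Edge.Below e f.src → Edge.Below e f.tgt

theorem Edge.Below.dist_le {e : T.Edge} {x : V} (h : e.Below x) :
    T.graph.dist T.root e.tgt ≤ T.graph.dist T.root x := by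
  induction h with
  | base => rfl
  | step f _ ih => have := f.dist_tgt; omega

theorem Edge.below_tgt_iff {e f : T.Edge} : e.Below f.tgt ↔ e = f ∨ e.Below f.src := by
  constructor
  · intro h
    generalize hx : f.tgt = x at h
    cases h with
    | base => exact Or.inl (Edge.tgt_injective hx).symm
    | step g hg => exact Or.inr (Edge.tgt_injective hx ▸ hg)
  · rintro (rfl | h)
    · exact .base
    · exact .step f h

theorem Edge.not_below_src (e : T.Edge) : ¬ e.Below e.src := fun h => by
  have := h.dist_le
  have := e.dist_tgt
  omega

theorem Edge.Below.trans_src {e f : T.Edge} {x : V} (h : e.Below f.src) (h' : f.Below x) :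
    e.Below x := by
  induction h' with
  | base => exact .step f h
  | step g _ ih => exact .step g ih

theorem Edge.Below.trans {e f : T.Edge} {x : V} (h : e.Below f.tgt) (h' : f.Below x) :
    e.Below x := by
  rcases Edge.below_tgt_iff.1 h with rfl | h
  · exact h'
  · exact h.trans_src h'

/-- Subtrees below two edges are nested or disjoint: climbing from the common node `x`, whichever
head is met first lies below the other edge. -/
theorem Edge.Below.total {e f : T.Edge} {x : V} (h : e.Below x) (h' : f.Below x) :
    e.Below f.tgt ∨ f.Below e.tgt := by
  induction h with
  | base => exact Or.inr h'
  | step g hg ih =>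
    rcases Edge.below_tgt_iff.1 h' with rfl | h'
    · exact Or.inl (.step _ hg)
    · exact ih h'

theorem exists_child_of_below {e : T.Edge} {c : V} (h : e.Below c) (hc : c ≠ e.tgt) :
    ∃ f : T.Edge, f.src = e.tgt ∧ f.Below c := by
  induction h with
  | base => exact absurd rfl hc
  | step g hg ih =>
    by_cases hs : g.src = e.tgt
    · exact ⟨g, hs, .base⟩
    · obtain ⟨f, hf, hb⟩ := ih hs
      exact ⟨f, hf, .step g hb⟩

theorem exists_child_of_root {c : V} (hc : c ≠ T.root) :
    ∃ f : T.Edge, f.src = T.root ∧ f.Below c := by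
  induction c using root_induction (T := T) with
  | h0 => exact absurd rfl hc
  | h1 e ih =>
    by_cases hs : e.src = T.root
    · exact ⟨e, hs, .base⟩
    · obtain ⟨f, hf, hb⟩ := ih hs
      exact ⟨f, hf, .step e hb⟩

/-- The edge `e` lies on the path between `x` and `y`. -/
def Edge.Sep (e : T.Edge) (x y : V) : Prop := ¬ (e.Below x ↔ e.Below y)

noncomputable instance (e : T.Edge) (x y : V) : Decidable (e.Sep x y) := Classical.dec _

theorem Edge.sep_comm {e : T.Edge} {x y : V} : e.Sep x y ↔ e.Sep y x := by
  unfold Edge.Sep; tauto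

theorem Edge.not_sep_self {e : T.Edge} {x : V} : ¬ e.Sep x x := by
  unfold Edge.Sep; tauto

/-- Separation compares the values of one Boolean function at two nodes, hence it is additive modulo
two. This propositional calculus replaces the manipulation of walks. -/
theorem Edge.sep_trans_iff {e : T.Edge} {x y z : V} :
    e.Sep x z ↔ ¬ (e.Sep x y ↔ e.Sep y z) := by
  unfold Edge.Sep; tauto

theorem Edge.sep_ends_iff {e f : T.Edge} : e.Sep f.src f.tgt ↔ e = f := by
  unfold Edge.Sep
  rw [Edge.below_tgt_iff]
  constructor
  · tauto
  · rintro rfl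
    have := e.not_below_src
    tauto

theorem Edge.sep_inc_iff {e f : T.Edge} {x y : V} (hx : f.Inc x) (hy : f.Inc y) (hxy : x ≠ y) :
    e.Sep x y ↔ e = f := by
  rcases hx with rfl | rfl <;> rcases hy with rfl | rfl
  · exact absurd rfl hxy
  · exact Edge.sep_ends_iff
  · rw [Edge.sep_comm]; exact Edge.sep_ends_iff
  · exact absurd rfl hxy

/-- The other endpoint of an edge. -/
theorem Edge.Inc.exists_other {f : T.Edge} {x : V} (hx : f.Inc x) : ∃ y, f.Inc y ∧ x ≠ y := by
  rcases hx with rfl | rfl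
  · exact ⟨f.tgt, Or.inr rfl, f.src_ne_tgt⟩
  · exact ⟨f.src, Or.inl rfl, f.src_ne_tgt.symm⟩

/-- The wanted edge is the one at `z` that points towards `c`: a child edge if `c` lies below `z`,
and the parent edge otherwise. -/
theorem exists_first {c z : V} (h : c ≠ z) : ∃ e : T.Edge, e.Inc z ∧ e.Sep c z := by
  have hchild : (∃ f : T.Edge, f.src = z ∧ f.Below c) → ∃ e : T.Edge, e.Inc z ∧ e.Sep c z := by
    rintro ⟨f, rfl, hb⟩
    refine ⟨f, Or.inl rfl, ?_⟩
    have := f.not_below_src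
    unfold Edge.Sep; tauto
  by_cases hz : z = T.root
  · subst hz
    exact hchild (exists_child_of_root h)
  · obtain ⟨e, rfl⟩ := exists_edge_tgt hz
    by_cases hb : e.Below c
    · exact hchild (exists_child_of_below hb h)
    · refine ⟨e, Or.inr rfl, ?_⟩
      have : e.Below e.tgt := .base
      unfold Edge.Sep; tauto

theorem first_unique {c z : V} {e f : T.Edge} (he : e.Inc z) (hf : f.Inc z) (hes : e.Sep c z)
    (hfs : f.Sep c z) : e = f := by
  have h1 := e.not_below_src
  have h2 := f.not_below_src
  have h3 : e.Below e.tgt := .base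
  have h4 : f.Below f.tgt := .base
  unfold Edge.Sep at hes hfs
  rcases he with rfl | rfl <;> rcases hf with hf | hf
  · rw [hf] at h2
    have he' : e.Below c := by tauto
    have hf' : f.Below c := by tauto
    rcases he'.total hf' with h | h
    · rcases Edge.below_tgt_iff.1 h with h | h
      · exact h
      · rw [hf] at h; tauto
    · rcases Edge.below_tgt_iff.1 h with h | h
      · exact h.symm
      · tauto
  · rw [hf] at h4
    have he' : e.Below c := by tauto
    have := h4.trans_src he'
    tauto
  · rw [hf] at h2
    have hf' : f.Below c := by tauto
    rw [← hf] at h3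
    have := h3.trans_src hf'
    rw [hf] at h3
    tauto
  · exact (Edge.tgt_injective hf).symm

/-- The far endpoint of an edge on a path bounds an initial segment of the path. -/
theorem exists_far_end {e : T.Edge} {x : V} :
    ∃ b, e.Inc b ∧ ∀ i, e.Sep x i → e.Sep x b ∧ ∀ f : T.Edge, f.Sep x b → f.Sep x i := by
  by_cases hx : e.Below x
  · refine ⟨e.src, Or.inl rfl, fun i hi => ?_⟩
    have h1 := e.not_below_src
    have hi' : ¬ e.Below i := by unfold Edge.Sep at hi; tauto
    refine ⟨by unfold Edge.Sep; tauto, fun f hf => ?_⟩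
    unfold Edge.Sep at hf ⊢
    have hfx : f.Below x := by
      by_contra hfx
      have : f.Below e.src := by tauto
      exact hfx (this.trans_src hx)
    have hfs : ¬ f.Below e.src := by tauto
    have : ¬ f.Below i := by
      intro hfi
      rcases hx.total hfx with h | h
      · exact hi' (h.trans hfi)
      · rcases Edge.below_tgt_iff.1 h with rfl | h
        · exact hi' hfi
        · exact hfs h
    tauto
  · refine ⟨e.tgt, Or.inr rfl, fun i hi => ?_⟩
    have h1 : e.Below e.tgt := .base
    have hi' : e.Below i := by unfold Edge.Sep at hi; tauto
    refine ⟨by unfold Edge.Sep; tauto, fun f hf => ?_⟩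
    unfold Edge.Sep at hf ⊢
    by_cases hfx : f.Below x
    · have hft : ¬ f.Below e.tgt := by tauto
      have : ¬ f.Below i := by
        intro hfi
        rcases hi'.total hfi with h | h
        · exact hx (h.trans hfx)
        · exact hft h
      tauto
    · have hft : f.Below e.tgt := by tauto
      have := hft.trans hi'
      tauto

/-- The path from `x` to the far end of the shared edge is an initial segment of both paths, so its
first edge serves for both. -/
theorem first_common {x i j : V} {e : T.Edge} (hi : e.Sep x i) (hj : e.Sep x j) :
    ∃ f : T.Edge, f.Inc x ∧ f.Sep x i ∧ f.Sep x j := by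
  obtain ⟨b, -, hb⟩ := exists_far_end (e := e) (x := x)
  obtain ⟨hxb, h1⟩ := hb i hi
  obtain ⟨-, h2⟩ := hb j hj
  have hne : b ≠ x := by
    rintro rfl
    exact Edge.not_sep_self hxb
  obtain ⟨f, hf, hs⟩ := exists_first (T := T) hne
  rw [Edge.sep_comm] at hs
  exact ⟨f, hf, h1 f hs, h2 f hs⟩

/-- Paths that leave a node through distinct edges are disjoint, and form together a path. -/
theorem sep_of_disjoint_first {x i j : V}
    (h : ∀ f : T.Edge, f.Inc x → f.Sep x i → ¬ f.Sep x j) (e : T.Edge) :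
    ¬ (e.Sep x i ∧ e.Sep x j) ∧ (e.Sep i j ↔ e.Sep x i ∨ e.Sep x j) := by
  have h1 : ¬ (e.Sep x i ∧ e.Sep x j) := by
    rintro ⟨hi, hj⟩
    obtain ⟨f, hf, hfi, hfj⟩ := first_common hi hj
    exact h f hf hfi hfj
  refine ⟨h1, ?_⟩
  rw [Edge.sep_trans_iff (y := x), Edge.sep_comm (x := i)]
  tauto

/-- For a walk in the tree the parity of the number of passages through an edge is determined by
the endpoints. -/
theorem odd_count_edges_iff [DecidableEq V] {x y : V} (w : T.graph.Walk x y) (e : T.Edge) :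
    Odd (w.edges.count s(e.src, e.tgt)) ↔ e.Sep x y := by
  induction w with
  | nil => simp [Edge.not_sep_self]
  | @cons u v z h w ih =>
    obtain ⟨f, hf⟩ := exists_edge_of_adj h
    have hfu : f.Inc u := by unfold Edge.Inc; tauto
    have hfv : f.Inc v := by unfold Edge.Inc; tauto
    have hs : s(u, v) = s(f.src, f.tgt) := by
      rcases hf with ⟨rfl, rfl⟩ | ⟨rfl, rfl⟩
      · rfl
      · exact Sym2.eq_swap
    rw [SimpleGraph.Walk.edges_cons, List.count_cons, Edge.sep_trans_iff (y := v), ← ih,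
      Edge.sep_inc_iff hfu hfv h.ne, hs]
    by_cases hef : e = f
    · subst hef
      simp [Nat.odd_add_one]
    · have : ¬ (s(f.src, f.tgt) = s(e.src, e.tgt)) := fun h => hef (edge_eq_of_sym2 h).symm
      simp [this, hef]

/-- Translates the condition on walks in `isolatedEdges` into `Edge.Sep`: a path uses an edge at
most once, so the parity of the count decides membership. -/
theorem mem_edges_iff_sep [DecidableEq V] {x y : V} {w : T.graph.Walk x y} (hw : w.IsPath)
    (e : T.Edge) : s(e.src, e.tgt) ∈ w.edges ↔ e.Sep x y := by
  rw [← odd_count_edges_iff w e]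
  have h1 := List.nodup_iff_count_le_one.1 hw.isTrail.edges_nodup s(e.src, e.tgt)
  rw [← List.count_pos_iff]
  constructor
  · intro h
    rw [show List.count s(e.src, e.tgt) w.edges = 1 by omega]
    exact odd_one
  · exact fun h => h.pos

/-! ### Degrees in edge sets and prolongation of paths. -/

section Finite

/-- The degree of a node in an edge set. -/
noncomputable def edgeDeg (F : Finset T.Edge) (v : V) : ℕ := (F.filter fun e => e.Inc v).card

theorem exists_inc_of_edgeDeg {F : Finset T.Edge} {v : V} (h : 0 < edgeDeg F v) :
    ∃ e ∈ F, e.Inc v := by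
  obtain ⟨e, he⟩ := Finset.card_pos.1 h
  exact ⟨e, Finset.mem_filter.1 he⟩

theorem edgeDeg_pos {F : Finset T.Edge} {v : V} {e : T.Edge} (he : e ∈ F) (hv : e.Inc v) :
    0 < edgeDeg F v :=
  Finset.card_pos.2 ⟨e, by simp [he, hv]⟩

theorem edgeDeg_mono {F F' : Finset T.Edge} (h : F ⊆ F') (v : V) :
    edgeDeg F v ≤ edgeDeg F' v :=
  Finset.card_le_card (Finset.filter_subset_filter _ h)

theorem exists_second {F : Finset T.Edge} {v : V} (h : 2 ≤ edgeDeg F v) (e : T.Edge) :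
    ∃ f ∈ F, f.Inc v ∧ f ≠ e := by
  classical
  obtain ⟨f, hf, hne⟩ := Finset.exists_mem_ne (lt_of_lt_of_le one_lt_two h) e
  rw [Finset.mem_filter] at hf
  exact ⟨f, hf.1, hf.2, hne⟩

variable [Fintype V]

/-- The set of edges on the path between two nodes. -/
noncomputable def pathEdges (T : BinaryTreeModel V) (x y : V) : Finset T.Edge :=
  Finset.univ.filter fun e => e.Sep x y

@[simp]
theorem mem_pathEdges {x y : V} {e : T.Edge} : e ∈ T.pathEdges x y ↔ e.Sep x y := by
  simp [pathEdges]

theorem pathEdges_comm (x y : V) : T.pathEdges x y = T.pathEdges y x := by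
  ext e; simp [Edge.sep_comm]

/-- A path inside an edge set can be prolonged until it reaches a node of degree one. -/
theorem exists_extension {F : Finset T.Edge} {c z₀ : V} {e : T.Edge} (he : e.Sep c z₀)
    (hF : T.pathEdges c z₀ ⊆ F) :
    ∃ z, e.Sep c z ∧ T.pathEdges c z ⊆ F ∧ edgeDeg F z = 1 := by
  classical
  let A : Finset V := Finset.univ.filter fun z => e.Sep c z ∧ T.pathEdges c z ⊆ F
  -- A longest admissible path is chosen; a second edge of `F` at its end would prolong it.
  obtain ⟨z, hz, hmax⟩ := Finset.exists_max_image A (fun z => (T.pathEdges c z).card)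
    ⟨z₀, by simp [A, he, hF]⟩
  have hz' : e.Sep c z ∧ T.pathEdges c z ⊆ F := by simpa [A] using hz
  refine ⟨z, hz'.1, hz'.2, ?_⟩
  have hne : c ≠ z := by
    rintro rfl
    exact Edge.not_sep_self hz'.1
  obtain ⟨f, hf, hfs⟩ := exists_first (T := T) hne
  have hpos : 0 < edgeDeg F z := edgeDeg_pos (hz'.2 (mem_pathEdges.2 hfs)) hf
  by_contra hdeg
  obtain ⟨g, hgF, hgz, hgf⟩ := exists_second (show 2 ≤ edgeDeg F z by omega) f
  have hgs : ¬ g.Sep c z := fun h => hgf (first_unique hgz hf h hfs)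
  obtain ⟨z', hz'i, hzz'⟩ := hgz.exists_other
  have hstep : ∀ e' : T.Edge, e'.Sep c z' ↔ e'.Sep c z ∨ e' = g := by
    intro e'
    rw [Edge.sep_trans_iff (y := z), Edge.sep_inc_iff hgz hz'i hzz']
    by_cases h : e' = g
    · subst h; tauto
    · tauto
  have hmem : z' ∈ A := by
    simp only [A, Finset.mem_filter, Finset.mem_univ, true_and]
    refine ⟨(hstep e).2 (Or.inl hz'.1), fun e' he' => ?_⟩
    rw [mem_pathEdges, hstep] at he'
    rcases he' with h | rfl
    · exact hz'.2 (mem_pathEdges.2 h)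
    · exact hgF
  have hlt : (T.pathEdges c z).card < (T.pathEdges c z').card := by
    apply Finset.card_lt_card
    rw [Finset.ssubset_iff_of_subset]
    · exact ⟨g, by simp [hstep], by simpa using hgs⟩
    · intro e' he'
      rw [mem_pathEdges] at *
      exact (hstep e').2 (Or.inl he')
  exact absurd (hmax z' hmem) (not_le.2 hlt)

theorem exists_extension_of_inc {F : Finset T.Edge} {e : T.Edge} (he : e ∈ F) {x : V}
    (hx : e.Inc x) : ∃ z, e.Sep x z ∧ T.pathEdges x z ⊆ F ∧ edgeDeg F z = 1 := by
  obtain ⟨y, hy, hxy⟩ := hx.exists_other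
  refine exists_extension (z₀ := y) ((Edge.sep_inc_iff hx hy hxy).2 rfl) fun f hf => ?_
  rw [mem_pathEdges, Edge.sep_inc_iff hx hy hxy] at hf
  exact hf ▸ he

/-- Every edge of an edge set lies on a path between two nodes of degree one. -/
theorem exists_path_through {F : Finset T.Edge} {e : T.Edge} (he : e ∈ F) :
    ∃ i j, e.Sep i j ∧ T.pathEdges i j ⊆ F ∧ edgeDeg F i = 1 ∧ edgeDeg F j = 1 := by
  obtain ⟨i, hi, hiF, hdi⟩ := exists_extension_of_inc he (Or.inl rfl)
  rw [pathEdges_comm] at hiF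
  rw [Edge.sep_comm] at hi
  obtain ⟨j, hj, hjF, hdj⟩ := exists_extension hi hiF
  exact ⟨i, j, hj, hjF, hdi, hdj⟩

theorem edgeDeg_pathEdges_left {x y : V} (h : x ≠ y) : edgeDeg (T.pathEdges x y) x = 1 := by
  classical
  obtain ⟨f, hf, hfs⟩ := exists_first (T := T) h.symm
  refine Finset.card_eq_one.2 ⟨f, ?_⟩
  ext e
  simp only [Finset.mem_filter, mem_pathEdges, Finset.mem_singleton]
  constructor
  · rintro ⟨h1, h2⟩
    exact first_unique h2 hf (Edge.sep_comm.1 h1) hfs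
  · rintro rfl
    exact ⟨Edge.sep_comm.1 hfs, hf⟩

theorem edgeDeg_pathEdges_right {x y : V} (h : x ≠ y) : edgeDeg (T.pathEdges x y) y = 1 := by
  rw [pathEdges_comm]
  exact edgeDeg_pathEdges_left h.symm

/-- Let `f` and `g` be the first edges from `v` towards `x` and `y`. They cancel modulo two if they
coincide; otherwise they are exactly the edges of the path at `v`. -/
theorem edgeDeg_pathEdges_of_ne {x y v : V} (hx : v ≠ x) (hy : v ≠ y) :
    edgeDeg (T.pathEdges x y) v = 0 ∨ edgeDeg (T.pathEdges x y) v = 2 := by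
  classical
  obtain ⟨f, hf, hfs⟩ := exists_first (T := T) hx.symm
  obtain ⟨g, hg, hgs⟩ := exists_first (T := T) hy.symm
  rw [Edge.sep_comm] at hgs
  have hmem : ∀ e : T.Edge, e.Inc v → (e.Sep x y ↔ ¬ (e = f ↔ e = g)) := by
    intro e he
    rw [Edge.sep_trans_iff (y := v)]
    have h1 : e.Sep x v ↔ e = f := ⟨fun h => first_unique he hf h hfs, fun h => h ▸ hfs⟩
    have h2 : e.Sep v y ↔ e = g :=
      ⟨fun h => first_unique he hg (Edge.sep_comm.1 h) (Edge.sep_comm.1 hgs), fun h => h ▸ hgs⟩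
    rw [h1, h2]
  by_cases hfg : f = g
  · left
    refine Finset.card_eq_zero.2 (Finset.filter_eq_empty_iff.2 fun e he hev => ?_)
    rw [mem_pathEdges, hmem e hev] at he
    subst hfg
    tauto
  · right
    refine Finset.card_eq_two.2 ⟨f, g, hfg, ?_⟩
    ext e
    simp only [Finset.mem_filter, mem_pathEdges, Finset.mem_insert, Finset.mem_singleton]
    constructor
    · rintro ⟨h1, h2⟩
      rw [hmem e h2] at h1
      tauto
    · rintro (rfl | rfl)
      · exact ⟨(hmem _ hf).2 (by tauto), hf⟩
      · exact ⟨(hmem _ hg).2 (by tauto), hg⟩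

end Finite

end Combinatorics

end BinaryTreeModel

namespace BinaryTreeModel

/-! ### Expansion of the law over edge sets, and moments. -/

section Expansion

variable {V : Type*} {T : BinaryTreeModel V}

/-- The coordinate `μ̄_v` expressed as a mean. -/
noncomputable def mean (y : T.Param) (v : V) : ℝ := (1 - y (Sum.inl v)) / 2

/-- The variance of the node variable. -/
noncomputable def var (y : T.Param) (v : V) : ℝ := (1 - y (Sum.inl v) ^ 2) / 4

theorem var_eq_mean (y : T.Param) (v : V) : var y v = mean y v * (1 - mean y v) := by
  unfold var mean; ring

/-- The inverse of the change of parameters. -/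
noncomputable def toTheta (y : T.Param) : T.Theta :=
  (mean y T.root, fun e a => mean y e.tgt + y (Sum.inr e) * (bit a - mean y e.src))

/-- The sign `±1` of an outcome. -/
def outcomeSign (b : Bool) : ℝ := if b then 1 else -1

/-- Splits the weight of an edge into a dependence term and an independence term; multiplying out
over the edges gives the expansion. -/
theorem bernoulliWeight_add (m h : ℝ) (b : Bool) :
    bernoulliWeight (m + h) b = h * outcomeSign b + bernoulliWeight m b := by
  cases b <;> simp [bernoulliWeight, outcomeSign] <;> ring

/-- The node `v` is the head of an edge in `F`. -/
def Headed (F : Finset T.Edge) (v : V) : Prop := ∃ e ∈ F, e.tgt = v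

noncomputable instance (F : Finset T.Edge) : DecidablePred (Headed F) := fun _ => Classical.dec _

/-- The number of edges of `F` that leave `v`. -/
noncomputable def childCount [DecidableEq V] (F : Finset T.Edge) (v : V) : ℕ :=
  (F.filter fun e => e.src = v).card

theorem edgeDeg_eq [DecidableEq V] (F : Finset T.Edge) (v : V) :
    edgeDeg F v = childCount F v + if Headed F v then 1 else 0 := by
  have h1 : F.filter (fun e => e.Inc v)
      = F.filter (fun e => e.src = v) ∪ F.filter (fun e => e.tgt = v) := by
    rw [← Finset.filter_or]
    exact Finset.filter_congr fun e _ => Iff.rfl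
  have h2 : Disjoint (F.filter fun e => e.src = v) (F.filter fun e => e.tgt = v) := by
    rw [Finset.disjoint_filter]
    rintro e - h h'
    exact e.src_ne_tgt (h.trans h'.symm)
  rw [edgeDeg, h1, Finset.card_union_of_disjoint h2, childCount]
  congr 1
  split_ifs with h
  · obtain ⟨e, he, rfl⟩ := h
    refine Finset.card_eq_one.2 ⟨e, ?_⟩
    ext f
    simp only [Finset.mem_filter, Finset.mem_singleton]
    exact ⟨fun hf => Edge.tgt_injective hf.2, by rintro rfl; exact ⟨he, rfl⟩⟩
  · refine Finset.card_eq_zero.2 (Finset.filter_eq_empty_iff.2 fun e he hv => h ⟨e, he, hv⟩)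

/-- The paths from `v` to `i` and to `j` have no edge in common. -/
def DisjointPaths (T : BinaryTreeModel V) (v i j : V) : Prop :=
  (∀ e : T.Edge, ¬ (e.Sep v i ∧ e.Sep v j)) ∧
    ∀ e : T.Edge, e.Sep i j ↔ e.Sep v i ∨ e.Sep v j

theorem DisjointPaths.symm {v i j : V} (h : T.DisjointPaths v i j) : T.DisjointPaths v j i :=
  ⟨fun e => by have := h.1 e; tauto, fun e => by
    rw [Edge.sep_comm, h.2 e]; tauto⟩

theorem disjointPaths_of_first {x i j : V} {e f : T.Edge} (he : e.Inc x) (hf : f.Inc x)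
    (hef : e ≠ f) (hi : e.Sep x i) (hj : f.Sep x j) : T.DisjointPaths x i j := by
  have h := sep_of_disjoint_first (T := T) (x := x) (i := i) (j := j) fun g hg hgi hgj => hef <|
    (first_unique he hg (Edge.sep_comm.1 hi) (Edge.sep_comm.1 hgi)).trans
      (first_unique hg hf (Edge.sep_comm.1 hgj) (Edge.sep_comm.1 hj))
  exact ⟨fun e => (h e).1, fun e => (h e).2⟩

variable [DecidableEq V]

/-- The contribution of a node to a term of the expansion over edge sets. -/
noncomputable def nodeFactor (y : T.Param) (F : Finset T.Edge) (v : V) (g : Bool → ℝ) : ℝ :=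
  ∑ a : Bool, g a * ((if Headed F v then outcomeSign a else bernoulliWeight (mean y v) a) *
    (bit a - mean y v) ^ childCount F v)

theorem nodeFactor_one_zero (y : T.Param) {F : Finset T.Edge} {v : V} (h : edgeDeg F v = 0) :
    nodeFactor y F v (fun _ => 1) = 1 := by
  rw [edgeDeg_eq] at h
  have h1 : ¬ Headed F v := fun hh => by simp [hh] at h
  have h2 : childCount F v = 0 := by omega
  simp [nodeFactor, h1, h2, bernoulliWeight]

/-- The signs sum to zero, and a centred variable has mean zero. This is why an edge set with an
unobserved end contributes nothing. -/
theorem nodeFactor_one_one (y : T.Param) {F : Finset T.Edge} {v : V} (h : edgeDeg F v = 1) :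
    nodeFactor y F v (fun _ => 1) = 0 := by
  rw [edgeDeg_eq] at h
  by_cases h1 : Headed F v
  · have h2 : childCount F v = 0 := by simpa [h1] using h
    simp [nodeFactor, h1, h2, outcomeSign]
  · have h2 : childCount F v = 1 := by simpa [h1] using h
    simp [nodeFactor, h1, h2, bernoulliWeight, bit]
    ring

theorem nodeFactor_one_two (y : T.Param) {F : Finset T.Edge} {v : V} (h : edgeDeg F v = 2) :
    nodeFactor y F v (fun _ => 1) = if Headed F v then 1 else var y v := by
  rw [edgeDeg_eq] at h
  by_cases h1 : Headed F v
  · have h2 : childCount F v = 1 := by simpa [h1] using h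
    simp [nodeFactor, h1, h2, outcomeSign, bit]
  · have h2 : childCount F v = 2 := by simpa [h1] using h
    simp [nodeFactor, h1, h2, bernoulliWeight, bit, var_eq_mean]
    ring

theorem nodeFactor_one_three (y : T.Param) {F : Finset T.Edge} {v : V} (h : edgeDeg F v = 3) :
    nodeFactor y F v (fun _ => 1) = y (Sum.inl v) * if Headed F v then 1 else var y v := by
  rw [edgeDeg_eq] at h
  have hy : y (Sum.inl v) = 1 - 2 * mean y v := by unfold mean; ring
  by_cases h1 : Headed F v
  · have h2 : childCount F v = 2 := by simpa [h1] using h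
    simp [nodeFactor, h1, h2, outcomeSign, bit, hy]
    ring
  · have h2 : childCount F v = 3 := by simpa [h1] using h
    simp [nodeFactor, h1, h2, bernoulliWeight, bit, var_eq_mean, hy]
    ring

theorem nodeFactor_centered_zero (y : T.Param) {F : Finset T.Edge} {v : V}
    (h : edgeDeg F v = 0) : nodeFactor y F v (fun a => bit a - mean y v) = 0 := by
  rw [edgeDeg_eq] at h
  have h1 : ¬ Headed F v := fun hh => by simp [hh] at h
  have h2 : childCount F v = 0 := by omega
  simp [nodeFactor, h1, h2, bernoulliWeight, bit]
  ring

theorem nodeFactor_centered_one (y : T.Param) {F : Finset T.Edge} {v : V}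
    (h : edgeDeg F v = 1) :
    nodeFactor y F v (fun a => bit a - mean y v) = if Headed F v then 1 else var y v := by
  rw [edgeDeg_eq] at h
  by_cases h1 : Headed F v
  · have h2 : childCount F v = 0 := by simpa [h1] using h
    simp [nodeFactor, h1, h2, outcomeSign, bit]
  · have h2 : childCount F v = 1 := by simpa [h1] using h
    simp [nodeFactor, h1, h2, bernoulliWeight, bit, var_eq_mean]
    ring

theorem nodeFactor_of_var_eq_zero {y : T.Param} {F : Finset T.Edge} {v : V}
    (hv : var y v = 0) (hh : ¬ Headed F v) (hd : 0 < edgeDeg F v) (g : Bool → ℝ) :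
    nodeFactor y F v g = 0 := by
  rw [edgeDeg_eq, if_neg hh, add_zero] at hd
  obtain ⟨k, hk⟩ := Nat.exists_eq_succ_of_ne_zero hd.ne'
  rw [var_eq_mean] at hv
  simp only [nodeFactor, Fintype.sum_bool, if_neg hh, bernoulliWeight, bit, hk, pow_succ]
  simp only [if_true, Bool.false_eq_true, if_false]
  linear_combination (g true * (1 - mean y v) ^ k - g false * (0 - mean y v) ^ k) * hv

/-- The functions used for central moments. -/
noncomputable def centered (y : T.Param) (I : Finset V) (v : V) (a : Bool) : ℝ :=
  if v ∈ I then bit a - mean y v else 1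

theorem centered_of_mem (y : T.Param) {I : Finset V} {v : V} (h : v ∈ I) :
    centered y I v = fun a => bit a - mean y v := by
  funext a; simp [centered, h]

theorem centered_of_notMem (y : T.Param) {I : Finset V} {v : V} (h : v ∉ I) :
    centered y I v = fun _ => 1 := by
  funext a; simp [centered, h]

theorem edgeDeg_of_disjoint {F A B : Finset T.Edge} (h : ∀ e, e ∈ F ↔ e ∈ A ∨ e ∈ B)
    (hd : ∀ e, ¬ (e ∈ A ∧ e ∈ B)) (v : V) : edgeDeg F v = edgeDeg A v + edgeDeg B v := by
  have h1 : F.filter (fun e => e.Inc v)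
      = A.filter (fun e => e.Inc v) ∪ B.filter (fun e => e.Inc v) := by
    ext e; simp only [Finset.mem_filter, Finset.mem_union, h e]; tauto
  rw [edgeDeg, h1, Finset.card_union_of_disjoint]
  · rfl
  · rw [Finset.disjoint_left]
    intro e ha hb
    exact hd e ⟨(Finset.mem_filter.1 ha).1, (Finset.mem_filter.1 hb).1⟩

variable [Fintype V]

/-- Every node other than the root is the head of exactly one edge. -/
theorem prod_nodes (g : V → ℝ) : ∏ v, g v = g T.root * ∏ e : T.Edge, g e.tgt := by
  have h : (Finset.univ : Finset V)
      = insert T.root ((Finset.univ : Finset T.Edge).image Edge.tgt) := by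
    ext v
    simp only [Finset.mem_univ, Finset.mem_insert, Finset.mem_image, true_and, true_iff]
    by_cases hv : v = T.root
    · exact Or.inl hv
    · exact Or.inr (exists_edge_tgt hv)
  rw [h, Finset.prod_insert, Finset.prod_image fun _ _ _ _ h => Edge.tgt_injective h]
  simp only [Finset.mem_image, Finset.mem_univ, true_and, not_exists]
  exact fun e => e.tgt_ne_root

/-- The expectation of a product of functions of the single variables. -/
noncomputable def expect (θ : T.Theta) (g : V → Bool → ℝ) : ℝ :=
  ∑ α : V → Bool, (∏ v, g v (α v)) * T.jointProb θ α

theorem prod_src (F : Finset T.Edge) (g : V → ℝ) :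
    ∏ e ∈ F, g e.src = ∏ v, g v ^ childCount F v := by
  rw [← Finset.prod_fiberwise' F Edge.src g]
  simp [childCount, Finset.prod_const]

theorem prod_tgt (F : Finset T.Edge) (g : V → ℝ) :
    ∏ e ∈ F, g e.tgt = ∏ v, if Headed F v then g v else 1 := by
  rw [prod_nodes (T := T), if_neg, one_mul, ← Finset.prod_sdiff (Finset.subset_univ F),
    Finset.prod_eq_one (s := Finset.univ \ F), one_mul]
  · exact Finset.prod_congr rfl fun e he => (if_pos ⟨e, he, rfl⟩).symm
  · intro e he
    rw [if_neg]
    rintro ⟨f, hf, h⟩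
    rw [Edge.tgt_injective h] at hf
    simp [hf] at he
  · rintro ⟨e, -, h⟩
    exact e.tgt_ne_root h

/-- `F` records the edges at which the dependence term is chosen. Such an edge puts a centred factor
on its tail and a sign on its head; a Bernoulli weight remains at every node that is not the head of
an edge of `F`. -/
theorem jointProb_toTheta (y : T.Param) (α : V → Bool) :
    T.jointProb (toTheta y) α = ∑ F : Finset T.Edge, (∏ e ∈ F, y (Sum.inr e)) *
      ∏ v, ((if Headed F v then outcomeSign (α v) else bernoulliWeight (mean y v) (α v)) *
        (bit (α v) - mean y v) ^ childCount F v) := by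
  unfold jointProb toTheta
  simp only [bernoulliWeight_add]
  rw [Finset.prod_add, Finset.powerset_univ, Finset.mul_sum]
  refine Finset.sum_congr rfl fun F _ => ?_
  rw [Finset.prod_mul_distrib, Finset.prod_mul_distrib, Finset.prod_mul_distrib,
    prod_src F (fun v => bit (α v) - mean y v)]
  have h1 : ∏ v, (if Headed F v then outcomeSign (α v) else bernoulliWeight (mean y v) (α v))
      = (∏ e ∈ F, outcomeSign (α e.tgt)) * (bernoulliWeight (mean y T.root) (α T.root) *
        ∏ e ∈ Finset.univ \ F, bernoulliWeight (mean y e.tgt) (α e.tgt)) := by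
    rw [prod_nodes (T := T), if_neg]
    · rw [← Finset.prod_sdiff (Finset.subset_univ F),
        Finset.prod_congr (s₁ := F) rfl (g := fun e => outcomeSign (α e.tgt)),
        Finset.prod_congr (s₁ := Finset.univ \ F) rfl
          (g := fun e => bernoulliWeight (mean y e.tgt) (α e.tgt))]
      · ring
      · intro e he
        rw [if_neg]
        rintro ⟨f, hf, h⟩
        rw [Edge.tgt_injective h] at hf
        simp [hf] at he
      · exact fun e he => if_pos ⟨e, he, rfl⟩
    · rintro ⟨e, -, h⟩
      exact e.tgt_ne_root h
  rw [h1]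
  ring

/-- The expansion of an expectation over edge sets. -/
theorem expect_toTheta (y : T.Param) (g : V → Bool → ℝ) :
    expect (toTheta y) g = ∑ F : Finset T.Edge, (∏ e ∈ F, y (Sum.inr e)) *
      ∏ v, nodeFactor y F v (g v) := by
  unfold expect
  simp only [jointProb_toTheta, Finset.mul_sum]
  rw [Finset.sum_comm]
  refine Finset.sum_congr rfl fun F _ => ?_
  unfold nodeFactor
  rw [Finset.prod_univ_sum, Fintype.piFinset_univ, Finset.mul_sum]
  refine Finset.sum_congr rfl fun α _ => ?_
  simp only [Finset.prod_mul_distrib]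
  ring

/-- An edge set contributes to the leaf distribution only if its nodes of degree one are leaves. -/
def LeafClosed (F : Finset T.Edge) : Prop := ∀ v, edgeDeg F v = 1 → T.IsLeaf v

/-- The monomial of an edge set: the product of the `η_e` and of the variances at the nodes of the
edge set that are not the head of one of its edges. -/
noncomputable def edgeMonomial (F : Finset T.Edge) (y : T.Param) : ℝ :=
  (∏ e ∈ F, y (Sum.inr e)) * ∏ v, if 0 < edgeDeg F v ∧ ¬ Headed F v then var y v else 1

/-- A central moment to which only one edge set contributes. -/
theorem expect_centered (y : T.Param) (I : Finset V) (F₀ : Finset T.Edge) (B : Finset V)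
    (hF : ∀ F : Finset T.Edge, (∀ v, edgeDeg F v = 1 → v ∈ I) → (∀ v ∈ I, 0 < edgeDeg F v) →
      F = F₀)
    (hI : ∀ v ∈ I, edgeDeg F₀ v = 1) (hB : ∀ v ∈ B, edgeDeg F₀ v = 3)
    (hBI : ∀ v, v ∉ I → v ∉ B → edgeDeg F₀ v = 0 ∨ edgeDeg F₀ v = 2) :
    expect (toTheta y) (centered y I) = edgeMonomial F₀ y * ∏ v ∈ B, y (Sum.inl v) := by
  rw [expect_toTheta, Finset.sum_eq_single F₀]
  · rw [edgeMonomial, mul_assoc]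
    congr 1
    rw [← Finset.prod_filter_mul_prod_filter_not Finset.univ (· ∈ B), mul_comm,
      ← Finset.prod_filter_mul_prod_filter_not Finset.univ (· ∈ B)
        (fun v => if 0 < edgeDeg F₀ v ∧ ¬ Headed F₀ v then var y v else 1),
      mul_comm (∏ v ∈ Finset.univ.filter (· ∈ B), _), mul_assoc]
    congr 1
    · refine Finset.prod_congr rfl fun v hv => ?_
      simp only [Finset.mem_filter, Finset.mem_univ, true_and] at hv
      by_cases hvI : v ∈ I
      · rw [centered_of_mem y hvI, nodeFactor_centered_one y (hI v hvI)]
        simp [hI v hvI, ite_not]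
      · rw [centered_of_notMem y hvI]
        rcases hBI v hvI hv with h | h
        · rw [nodeFactor_one_zero y h]
          simp [h]
        · rw [nodeFactor_one_two y h]
          simp [h, ite_not]
    · rw [Finset.filter_univ_mem, ← Finset.prod_mul_distrib]
      refine Finset.prod_congr rfl fun v hv => ?_
      have h3 := hB v hv
      have hvI : v ∉ I := fun h => by
        have := hI v h
        omega
      rw [centered_of_notMem y hvI, nodeFactor_one_three y h3]
      simp [h3, ite_not, mul_comm]
  · intro F _ hne
    by_contra h0
    refine hne (hF F (fun v hv => ?_) fun v hv => ?_)
    · by_contra hvI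
      refine h0 (mul_eq_zero_of_right _ (Finset.prod_eq_zero (Finset.mem_univ v) ?_))
      rw [centered_of_notMem y hvI, nodeFactor_one_one y hv]
    · by_contra hd
      refine h0 (mul_eq_zero_of_right _ (Finset.prod_eq_zero (Finset.mem_univ v) ?_))
      rw [centered_of_mem y hv, nodeFactor_centered_zero y (by omega)]
  · simp

theorem expect_one (y : T.Param) : expect (toTheta y) (fun _ _ => 1) = 1 := by
  have h := expect_centered y ∅ ∅ ∅ (fun F hF _ => ?_) (by simp) (by simp)
    (by simp [edgeDeg])
  · have h' : centered y ∅ = fun _ _ => 1 := by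
      funext v a; simp [centered]
    rw [h'] at h
    rw [h]
    simp [edgeMonomial, edgeDeg]
  · by_contra hne
    obtain ⟨e, he⟩ := Finset.nonempty_iff_ne_empty.2 hne
    obtain ⟨i, -, -, -, hi, -⟩ := exists_path_through he
    simpa using hF i hi

/-- A nonzero term would need an edge at `v` and no node of degree one other than `v`, but every
edge lies on a path between two distinct nodes of degree one. -/
theorem expect_singleton (y : T.Param) (v : V) : expect (toTheta y) (centered y {v}) = 0 := by
  rw [expect_toTheta]
  refine Finset.sum_eq_zero fun F _ => ?_
  by_contra h0
  have h1 : ∀ u, edgeDeg F u = 1 → u = v := by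
    intro u hu
    by_contra huv
    refine h0 (mul_eq_zero_of_right _ (Finset.prod_eq_zero (Finset.mem_univ u) ?_))
    rw [centered_of_notMem y (by simpa using huv), nodeFactor_one_one y hu]
  have h2 : 0 < edgeDeg F v := by
    by_contra hd
    refine h0 (mul_eq_zero_of_right _ (Finset.prod_eq_zero (Finset.mem_univ v) ?_))
    rw [centered_of_mem y (by simp), nodeFactor_centered_zero y (by omega)]
  obtain ⟨e, he, -⟩ := exists_inc_of_edgeDeg h2
  obtain ⟨i, j, hs, -, hi, hj⟩ := exists_path_through he
  rw [h1 i hi, h1 j hj] at hs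
  exact Edge.not_sep_self hs

/-- In a contributing edge set only `i` and `j` can have degree one. Each of its edges lies on a
path inside the set between nodes of degree one, so the set is the path from `i` to `j`. -/
theorem expect_pair (y : T.Param) {i j : V} (hij : i ≠ j) :
    expect (toTheta y) (centered y {i, j}) = edgeMonomial (T.pathEdges i j) y := by
  rw [expect_centered y {i, j} (T.pathEdges i j) ∅]
  · simp
  · intro F h1 h2
    have key : ∀ e ∈ F, e.Sep i j ∧ T.pathEdges i j ⊆ F := by
      intro e he
      obtain ⟨a, b, hs, hF, ha, hb⟩ := exists_path_through he
      have ha' := h1 a ha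
      have hb' := h1 b hb
      simp only [Finset.mem_insert, Finset.mem_singleton] at ha' hb'
      rcases ha' with rfl | rfl <;> rcases hb' with rfl | rfl
      · exact absurd hs Edge.not_sep_self
      · exact ⟨hs, hF⟩
      · exact ⟨Edge.sep_comm.1 hs, pathEdges_comm a b ▸ hF⟩
      · exact absurd hs Edge.not_sep_self
    obtain ⟨e, he, -⟩ := exists_inc_of_edgeDeg (h2 i (by simp))
    exact Finset.Subset.antisymm (fun f hf => mem_pathEdges.2 (key f hf).1) (key e he).2
  · intro v hv
    simp only [Finset.mem_insert, Finset.mem_singleton] at hv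
    rcases hv with rfl | rfl
    · exact edgeDeg_pathEdges_left hij
    · exact edgeDeg_pathEdges_right hij
  · simp
  · intro v hv _
    simp only [Finset.mem_insert, Finset.mem_singleton, not_or] at hv
    exact edgeDeg_pathEdges_of_ne hv.1 hv.2

/-- The union of the paths from `v` to three other nodes. -/
noncomputable def tripod (T : BinaryTreeModel V) (v i j k : V) : Finset T.Edge :=
  T.pathEdges v i ∪ T.pathEdges v j ∪ T.pathEdges v k

theorem DisjointPaths.edgeDeg {v i j : V} (h : T.DisjointPaths v i j) (x : V) :
    edgeDeg (T.pathEdges i j) x = edgeDeg (T.pathEdges v i) x + edgeDeg (T.pathEdges v j) x :=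
  edgeDeg_of_disjoint (by simpa using h.2) (by simpa using h.1) x

theorem edgeDeg_tripod {v i j k : V} (hij : T.DisjointPaths v i j) (hik : T.DisjointPaths v i k)
    (hjk : T.DisjointPaths v j k) (x : V) : edgeDeg (T.tripod v i j k) x
      = edgeDeg (T.pathEdges v i) x + edgeDeg (T.pathEdges v j) x
        + edgeDeg (T.pathEdges v k) x := by
  rw [← hij.edgeDeg x]
  refine edgeDeg_of_disjoint (fun e => ?_) (fun e => ?_) x
  · simp [tripod, hij.2 e, or_assoc]
  · have h1 := hik.1 e
    have h2 := hjk.1 e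
    simp only [mem_pathEdges, hij.2 e]
    tauto

theorem edgeDeg_tripod_of_ne {v i j k : V} (hij : T.DisjointPaths v i j)
    (hik : T.DisjointPaths v i k) (hjk : T.DisjointPaths v j k) {a : V} (hav : a ≠ v)
    (hai : a ≠ i) (haj : a ≠ j) (hak : a ≠ k) :
    edgeDeg (T.tripod v i j k) a = 0 ∨ edgeDeg (T.tripod v i j k) a = 2 := by
  rw [edgeDeg_tripod hij hik hjk]
  have h1 := edgeDeg_pathEdges_of_ne (T := T) hav hai
  have h2 := edgeDeg_pathEdges_of_ne (T := T) hav haj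
  have h3 := edgeDeg_pathEdges_of_ne (T := T) hav hak
  have h4 := edgeDeg_pathEdges_of_ne (T := T) hai haj
  have h5 := edgeDeg_pathEdges_of_ne (T := T) hai hak
  have h6 := edgeDeg_pathEdges_of_ne (T := T) haj hak
  rw [hij.edgeDeg] at h4
  rw [hik.edgeDeg] at h5
  rw [hjk.edgeDeg] at h6
  omega

/-- A contributing edge set contains every leg, because prolonging from one of `i`, `j`, `k` ends at
another one and passes through `v`. Conversely each of its edges separates two of the three nodes,
hence lies on a leg. The centre has degree three, whence the skewness factor. -/
theorem expect_triple (y : T.Param) {v i j k : V} (hij : T.DisjointPaths v i j)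
    (hik : T.DisjointPaths v i k) (hjk : T.DisjointPaths v j k) (hvi : v ≠ i) (hvj : v ≠ j)
    (hvk : v ≠ k) (hi : edgeDeg (Finset.univ : Finset T.Edge) i = 1)
    (hj : edgeDeg (Finset.univ : Finset T.Edge) j = 1)
    (hk : edgeDeg (Finset.univ : Finset T.Edge) k = 1) :
    expect (toTheta y) (centered y {i, j, k})
      = edgeMonomial (T.tripod v i j k) y * y (Sum.inl v) := by
  have hdeg := edgeDeg_tripod hij hik hjk
  have hle : ∀ x, edgeDeg (T.tripod v i j k) x ≤ edgeDeg (Finset.univ : Finset T.Edge) x :=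
    edgeDeg_mono (Finset.subset_univ _)
  rw [expect_centered y {i, j, k} (T.tripod v i j k) {v}]
  · simp
  · intro F h1 h2
    have hleg : ∀ a ∈ ({i, j, k} : Finset V), T.pathEdges v a ⊆ F := by
      intro a ha
      obtain ⟨e, he, hea⟩ := exists_inc_of_edgeDeg (h2 a ha)
      obtain ⟨z, hz, hzF, hdz⟩ := exists_extension_of_inc he hea
      have hz' := h1 z hdz
      have hne : a ≠ z := by
        rintro rfl
        exact Edge.not_sep_self hz
      intro f hf
      apply hzF
      rw [mem_pathEdges] at hf ⊢
      simp only [Finset.mem_insert, Finset.mem_singleton] at ha hz'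
      rcases ha with rfl | rfl | rfl <;> rcases hz' with rfl | rfl | rfl
      · exact absurd rfl hne
      · exact (hij.2 f).2 (Or.inl hf)
      · exact (hik.2 f).2 (Or.inl hf)
      · exact (hij.symm.2 f).2 (Or.inl hf)
      · exact absurd rfl hne
      · exact (hjk.2 f).2 (Or.inl hf)
      · exact (hik.symm.2 f).2 (Or.inl hf)
      · exact (hjk.symm.2 f).2 (Or.inl hf)
      · exact absurd rfl hne
    apply Finset.Subset.antisymm
    · intro e he
      obtain ⟨a, b, hs, -, ha, hb⟩ := exists_path_through he
      have hmem : ∀ a ∈ ({i, j, k} : Finset V), e.Sep v a → e ∈ T.tripod v i j k := by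
        intro a ha hs
        simp only [tripod, Finset.mem_union, mem_pathEdges]
        simp only [Finset.mem_insert, Finset.mem_singleton] at ha
        rcases ha with rfl | rfl | rfl
        · exact Or.inl (Or.inl hs)
        · exact Or.inl (Or.inr hs)
        · exact Or.inr hs
      by_cases hva : e.Sep v a
      · exact hmem a (h1 a ha) hva
      · refine hmem b (h1 b hb) ?_
        by_contra hvb
        rw [Edge.sep_trans_iff (y := v), Edge.sep_comm (x := a)] at hs
        exact hs ⟨fun h => absurd h hva, fun h => absurd h hvb⟩
    · intro e he
      simp only [tripod, Finset.mem_union] at he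
      rcases he with (he | he) | he
      · exact hleg i (by simp) he
      · exact hleg j (by simp) he
      · exact hleg k (by simp) he
  · intro a ha
    have h1 := hle a
    have h2 := hdeg a
    simp only [Finset.mem_insert, Finset.mem_singleton] at ha
    rcases ha with rfl | rfl | rfl
    · have := edgeDeg_pathEdges_right (T := T) hvi
      omega
    · have := edgeDeg_pathEdges_right (T := T) hvj
      omega
    · have := edgeDeg_pathEdges_right (T := T) hvk
      omega
  · intro a ha
    rw [Finset.mem_singleton.1 ha, hdeg, edgeDeg_pathEdges_left hvi, edgeDeg_pathEdges_left hvj,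
      edgeDeg_pathEdges_left hvk]
  · intro a ha hav
    simp only [Finset.mem_insert, Finset.mem_singleton, not_or] at ha hav
    exact edgeDeg_tripod_of_ne hij hik hjk hav ha.1 ha.2.1 ha.2.2

theorem sum_jointProb (y : T.Param) : ∑ α : V → Bool, T.jointProb (toTheta y) α = 1 := by
  simpa [expect] using expect_one y

theorem nodeMean_toTheta (y : T.Param) (v : V) : T.nodeMean (toTheta y) v = mean y v := by
  have h := expect_singleton y v
  have h1 : ∀ α : V → Bool, ∏ u, centered y {v} u (α u) = bit (α v) - mean y v := by
    intro α
    rw [Finset.prod_eq_single v]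
    · simp [centered]
    · intro u _ hu
      simp [centered, hu]
    · simp
  simp only [expect, h1, sub_mul, Finset.sum_sub_distrib, ← Finset.mul_sum, sum_jointProb] at h
  unfold nodeMean
  linarith

theorem reparam_toTheta (y : T.Param) : T.reparam (toTheta y) = y := by
  funext c
  rcases c with v | e
  · simp only [reparam, Sum.elim_inl, nodeMean_toTheta]
    unfold mean; ring
  · simp [reparam, toTheta, bit]
    ring

/-- Solving the recursion for the means by depth writes an arbitrary θ in the form `toTheta y`, so
that invertibility in the other direction follows from `reparam_toTheta`. -/
theorem exists_nodeMean (θ : T.Theta) :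
    ∃ l : V → ℝ, l T.root = θ.1 ∧
      ∀ e : T.Edge, l e.tgt = θ.2 e false + (θ.2 e true - θ.2 e false) * l e.src := by
  have key : ∀ n : ℕ, ∃ l : V → ℝ, l T.root = θ.1 ∧ ∀ e : T.Edge,
      T.graph.dist T.root e.tgt ≤ n →
      l e.tgt = θ.2 e false + (θ.2 e true - θ.2 e false) * l e.src := by
    intro n
    induction n with
    | zero => exact ⟨fun _ => θ.1, rfl, fun e he => by have := e.dist_tgt; omega⟩
    | succ n ih =>
      obtain ⟨l, hl0, hl⟩ := ih
      classical
      refine ⟨fun v => if h : ∃ e : T.Edge, e.tgt = v ∧ T.graph.dist T.root v = n + 1 then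
        θ.2 h.choose false + (θ.2 h.choose true - θ.2 h.choose false) * l h.choose.src
        else l v, ?_, ?_⟩
      · have : ¬ ∃ e : T.Edge, e.tgt = T.root ∧ T.graph.dist T.root T.root = n + 1 := by
          rintro ⟨e, he, -⟩
          exact e.tgt_ne_root he
        simp only [dif_neg this, hl0]
      · intro e he
        have hs : ¬ ∃ f : T.Edge, f.tgt = e.src ∧ T.graph.dist T.root e.src = n + 1 := by
          rintro ⟨f, -, h⟩
          have := e.dist_tgt
          omega
        simp only [dif_neg hs]
        by_cases ht : T.graph.dist T.root e.tgt = n + 1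
        · have hex : ∃ f : T.Edge, f.tgt = e.tgt ∧ T.graph.dist T.root e.tgt = n + 1 :=
            ⟨e, rfl, ht⟩
          have heq : hex.choose = e := Edge.tgt_injective hex.choose_spec.1
          rw [dif_pos hex, heq]
        · have hn : ¬ ∃ f : T.Edge, f.tgt = e.tgt ∧ T.graph.dist T.root e.tgt = n + 1 := by
            rintro ⟨f, -, h⟩
            exact ht h
          rw [dif_neg hn]
          exact hl e (by omega)
  obtain ⟨l, hl0, hl⟩ := key ((Finset.univ : Finset V).sup fun v => T.graph.dist T.root v)
  exact ⟨l, hl0, fun e => hl e (Finset.le_sup (f := fun v => T.graph.dist T.root v)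
    (Finset.mem_univ e.tgt))⟩

theorem toTheta_reparam (θ : T.Theta) : toTheta (T.reparam θ) = θ := by
  obtain ⟨l, hl0, hl⟩ := exists_nodeMean θ
  let y : T.Param := Sum.elim (fun v => 1 - 2 * l v) (fun e => θ.2 e true - θ.2 e false)
  have hm : ∀ v, mean y v = l v := fun v => by simp [mean, y]
  have hy : toTheta y = θ := by
    refine Prod.ext ?_ ?_
    · simp [toTheta, hm, hl0]
    · funext e a
      simp only [toTheta, hm, hl e]
      cases a <;> simp [y, bit]
      ring
  rw [← hy, reparam_toTheta]

theorem mem_image_reparam {S : Set T.Theta} {y : T.Param} :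
    y ∈ T.reparam '' S ↔ toTheta y ∈ S := by
  constructor
  · rintro ⟨θ, hθ, rfl⟩
    rwa [toTheta_reparam]
  · exact fun h => ⟨_, h, reparam_toTheta y⟩

theorem mem_omegaSpace {y : T.Param} : y ∈ T.omegaSpace ↔ toTheta y ∈ T.thetaSpace :=
  mem_image_reparam

theorem mem_omegaFiber {p : (T.Leaf → Bool) → ℝ} {y : T.Param} :
    y ∈ T.omegaFiber p ↔ y ∈ T.omegaSpace ∧ T.marginal (toTheta y) = p :=
  mem_image_reparam.trans (and_congr_left fun _ => mem_omegaSpace.symm)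

/-- The mean at a head is a convex combination of two conditional probabilities, weighted by the
mean at the tail. -/
theorem mean_mem_Icc {y : T.Param} (hy : y ∈ T.omegaSpace) (v : V) :
    mean y v ∈ Set.Icc (0 : ℝ) 1 := by
  rw [mem_omegaSpace] at hy
  induction v using root_induction (T := T) with
  | h0 => exact hy.1
  | h1 e ih =>
    have h0 := hy.2 e false
    have h1 := hy.2 e true
    simp only [toTheta, bit, Set.mem_Icc, if_true, Bool.false_eq_true, if_false] at h0 h1 ih ⊢
    constructor <;> nlinarith

theorem var_nonneg {y : T.Param} (hy : y ∈ T.omegaSpace) (v : V) : 0 ≤ var y v := by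
  have h := mean_mem_Icc hy v
  rw [var_eq_mean]
  exact mul_nonneg h.1 (sub_nonneg.2 h.2)

/-- Law of total variance: the difference of the two sides is the expected conditional variance. -/
theorem sq_mul_var_le {y : T.Param} (hy : y ∈ T.omegaSpace) (e : T.Edge) :
    y (Sum.inr e) ^ 2 * var y e.src ≤ var y e.tgt := by
  have hm := mean_mem_Icc hy e.src
  rw [mem_omegaSpace] at hy
  have h0 := hy.2 e false
  have h1 := hy.2 e true
  simp only [toTheta, bit, Set.mem_Icc, if_true, Bool.false_eq_true, if_false] at h0 h1
  rw [var_eq_mean, var_eq_mean]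
  have h2 := mul_nonneg (sub_nonneg.2 hm.2) (mul_nonneg h0.1 (sub_nonneg.2 h0.2))
  have h3 := mul_nonneg hm.1 (mul_nonneg h1.1 (sub_nonneg.2 h1.2))
  nlinarith

/-- A term of the expansion vanishes if one of its edge coordinates or one of the variances at its
nodes vanishes. -/
theorem prod_nodeFactor_eq_zero {y : T.Param} (hy : y ∈ T.omegaSpace) {F : Finset T.Edge}
    {v : V} (hd : 0 < edgeDeg F v) (hv : var y v = 0) (g : V → Bool → ℝ) :
    (∏ e ∈ F, y (Sum.inr e)) * ∏ v, nodeFactor y F v (g v) = 0 := by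
  induction v using root_induction (T := T) with
  | h0 =>
    refine mul_eq_zero_of_right _ (Finset.prod_eq_zero (Finset.mem_univ T.root) ?_)
    refine nodeFactor_of_var_eq_zero hv ?_ hd _
    rintro ⟨e, -, h⟩
    exact e.tgt_ne_root h
  | h1 e ih =>
    by_cases hh : Headed F e.tgt
    · obtain ⟨f, hf, hfe⟩ := hh
      obtain rfl := Edge.tgt_injective hfe
      -- By total variance, a constant head forces η_f = 0 or a constant tail; in the latter case
      -- the argument climbs until it reaches a node without a parent edge in `F`.
      have h1 := sq_mul_var_le hy f
      have h2 := var_nonneg hy f.src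
      rw [hv] at h1
      have h3 : y (Sum.inr f) ^ 2 * var y f.src = 0 :=
        le_antisymm h1 (mul_nonneg (sq_nonneg _) h2)
      rcases mul_eq_zero.1 h3 with h | h
      · exact mul_eq_zero_of_left (Finset.prod_eq_zero hf (pow_eq_zero_iff two_ne_zero |>.1 h)) _
      · exact ih (edgeDeg_pos hf (Or.inl rfl)) h
    · exact mul_eq_zero_of_right _ (Finset.prod_eq_zero (Finset.mem_univ e.tgt)
        (nodeFactor_of_var_eq_zero hv hh hd _))

end Expansion

end BinaryTreeModel

namespace BinaryTreeModel

/-! ### The forest of a leaf distribution and the points of its fiber. -/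

section Fiber

variable {V : Type*} {T : BinaryTreeModel V} [Fintype V]

theorem edgeDeg_univ_pos [Nontrivial V] (v : V) :
    0 < edgeDeg (Finset.univ : Finset T.Edge) v := by
  obtain ⟨z, hz⟩ := exists_ne v
  obtain ⟨e, he, -⟩ := exists_first (T := T) hz
  exact edgeDeg_pos (Finset.mem_univ e) he

variable [DecidableEq V]

theorem ncard_neighborSet_deleteEdges (X : Set (Sym2 V)) [DecidablePred (· ∈ X)] (v : V) :
    ((T.graph.deleteEdges X).neighborSet v).ncard
      = edgeDeg (Finset.univ.filter fun e : T.Edge => s(e.src, e.tgt) ∉ X) v := by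
  set A := (Finset.univ.filter fun e : T.Edge => s(e.src, e.tgt) ∉ X).filter fun e => e.Inc v
  have h : (T.graph.deleteEdges X).neighborSet v
      = ↑(A.image fun e => if e.src = v then e.tgt else e.src) := by
    ext x
    simp only [SimpleGraph.mem_neighborSet, SimpleGraph.deleteEdges_adj, Finset.coe_image,
      Set.mem_image, Finset.mem_coe, A, Finset.mem_filter, Finset.mem_univ, true_and]
    constructor
    · rintro ⟨hadj, hX⟩
      obtain ⟨e, he⟩ := exists_edge_of_adj hadj
      refine ⟨e, ?_⟩
      rcases he with ⟨rfl, rfl⟩ | ⟨rfl, rfl⟩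
      · exact ⟨⟨hX, Or.inl rfl⟩, if_pos rfl⟩
      · exact ⟨⟨by rwa [Sym2.eq_swap], Or.inr rfl⟩, if_neg e.src_ne_tgt⟩
    · rintro ⟨e, ⟨hX, he⟩, rfl⟩
      rcases he with rfl | rfl
      · rw [if_pos rfl]
        exact ⟨e.adj, hX⟩
      · rw [if_neg e.src_ne_tgt, Sym2.eq_swap]
        exact ⟨e.adj.symm, hX⟩
  rw [h, Set.ncard_coe_finset, edgeDeg, Finset.card_image_of_injOn]
  intro e he f hf hef
  have he' : e.Inc v := (Finset.mem_filter.1 he).2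
  have hf' : f.Inc v := (Finset.mem_filter.1 hf).2
  simp only at hef
  rcases he' with he' | he' <;> rcases hf' with hf' | hf'
  · rw [if_pos he', if_pos hf'] at hef
    exact Edge.tgt_injective hef
  · have hfs : f.src ≠ v := hf' ▸ f.src_ne_tgt
    rw [if_pos he', if_neg hfs] at hef
    have h1 := e.dist_tgt
    have h2 := f.dist_tgt
    rw [hef, he'] at h1
    rw [hf'] at h2
    omega
  · have hes : e.src ≠ v := he' ▸ e.src_ne_tgt
    rw [if_pos hf', if_neg hes] at hef
    have h1 := e.dist_tgt
    have h2 := f.dist_tgt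
    rw [he', hef] at h1
    rw [hf'] at h2
    omega
  · exact Edge.tgt_injective (he'.trans hf'.symm)

theorem isLeaf_iff {v : V} : T.IsLeaf v ↔ edgeDeg (Finset.univ : Finset T.Edge) v = 1 := by
  have h := ncard_neighborSet_deleteEdges (T := T) ∅ v
  rw [SimpleGraph.deleteEdges_empty] at h
  rw [IsLeaf, h]
  simp

open Classical in
/-- The edges that are not isolated relative to `p`. -/
noncomputable def linked (T : BinaryTreeModel V) (p : (T.Leaf → Bool) → ℝ) : Finset T.Edge :=
  Finset.univ.filter fun e => s(e.src, e.tgt) ∉ T.isolatedEdges p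

variable {p : (T.Leaf → Bool) → ℝ}

theorem notMem_linked_iff {e : T.Edge} :
    e ∉ T.linked p ↔ s(e.src, e.tgt) ∈ T.isolatedEdges p := by
  simp [linked]

theorem mem_linked_iff {e : T.Edge} :
    e ∈ T.linked p ↔ ∃ i j : T.Leaf, e.Sep i.1 j.1 ∧ T.leafCov p i j ≠ 0 := by
  rw [← not_iff_comm.1 notMem_linked_iff]
  simp only [isolatedEdges, Set.mem_ofPred_eq, not_and, not_forall]
  constructor
  · intro h
    obtain ⟨i, j, w, hw, hew, hc⟩ := h e.adj
    exact ⟨i, j, (mem_edges_iff_sep hw e).1 hew, hc⟩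
  · rintro ⟨i, j, hs, hc⟩ -
    obtain ⟨w, hw, -⟩ := T.isTree.existsUnique_path i.1 j.1
    exact ⟨i, j, w, hw, (mem_edges_iff_sep hw e).2 hs, hc⟩

theorem pathEdges_subset_linked {i j : T.Leaf} (h : T.leafCov p i j ≠ 0) :
    T.pathEdges i.1 j.1 ⊆ T.linked p := fun _ he =>
  mem_linked_iff.2 ⟨i, j, mem_pathEdges.1 he, h⟩

theorem ncard_forest (v : V) : ((T.forest p).neighborSet v).ncard = edgeDeg (T.linked p) v := by
  classical
  rw [forest, ncard_neighborSet_deleteEdges, linked]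

/-- A linked edge lies on a path between leaves with nonzero covariance. All edges of that path are
linked, and an inner node on it has degree two there. -/
theorem two_le_edgeDeg_linked {v : V} (hv : ¬ T.IsLeaf v) (h : 0 < edgeDeg (T.linked p) v) :
    2 ≤ edgeDeg (T.linked p) v := by
  obtain ⟨e, he, hev⟩ := exists_inc_of_edgeDeg h
  obtain ⟨i, j, hs, hc⟩ := mem_linked_iff.1 he
  have h1 := edgeDeg_mono (pathEdges_subset_linked hc) v
  have h2 := edgeDeg_pos (mem_pathEdges.2 hs) hev
  have h3 := edgeDeg_pathEdges_of_ne (T := T) (v := v) (x := i.1) (y := j.1)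
    (fun h => hv (h ▸ i.2)) (fun h => hv (h ▸ j.2))
  omega

theorem leafClosed_linked : LeafClosed (T.linked p) := by
  intro v hv
  by_contra h
  have := two_le_edgeDeg_linked (p := p) h (by omega)
  omega

theorem mem_degenerateNodes_iff {v : V} :
    v ∈ T.degenerateNodes p ↔ ¬ T.IsLeaf v ∧ edgeDeg (T.linked p) v = 0 := by
  simp only [degenerateNodes, Set.mem_ofPred_eq, ncard_forest]
  refine and_congr_right fun hv => ⟨fun h => ?_, fun h => by omega⟩
  by_contra h0
  have := two_le_edgeDeg_linked (p := p) hv (by omega)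
  omega

/-- Inner nodes of degree two in the forest. -/
def IsPassing (T : BinaryTreeModel V) (p : (T.Leaf → Bool) → ℝ) (v : V) : Prop :=
  ¬ T.IsLeaf v ∧ edgeDeg (T.linked p) v = 2

noncomputable instance : DecidablePred (T.IsPassing p) := fun _ => Classical.dec _

/-- Leaves of the tree and branching nodes of the forest. -/
def IsRigid (T : BinaryTreeModel V) (p : (T.Leaf → Bool) → ℝ) (v : V) : Prop :=
  T.IsLeaf v ∨ 3 ≤ edgeDeg (T.linked p) v

theorem node_cases (v : V) : T.IsRigid p v ∨ T.IsPassing p v ∨ v ∈ T.degenerateNodes p := by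
  rw [mem_degenerateNodes_iff, IsRigid, IsPassing]
  by_cases h : T.IsLeaf v
  · exact Or.inl (Or.inl h)
  · by_cases h0 : edgeDeg (T.linked p) v = 0
    · exact Or.inr (Or.inr ⟨h, h0⟩)
    · have := two_le_edgeDeg_linked (p := p) h (by omega)
      by_cases h2 : edgeDeg (T.linked p) v = 2
      · exact Or.inr (Or.inl ⟨h, h2⟩)
      · exact Or.inl (Or.inr (by omega))

theorem IsPassing.not_isRigid {v : V} (h : T.IsPassing p v) : ¬ T.IsRigid p v := by
  rintro (h' | h')
  · exact h.1 h'
  · have := h.2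
    omega

open Classical in
/-- The indicator of an outcome at the leaves, as a product of functions of the single nodes. -/
noncomputable def leafIndicator (β : T.Leaf → Bool) (v : V) (a : Bool) : ℝ :=
  if ∀ i : T.Leaf, i.1 = v → a = β i then 1 else 0

theorem leafIndicator_of_not_isLeaf (β : T.Leaf → Bool) {v : V} (hv : ¬ T.IsLeaf v) :
    leafIndicator β v = fun _ => 1 := by
  funext a
  refine if_pos ?_
  rintro i rfl
  exact absurd i.2 hv

theorem marginal_eq_expect (θ : T.Theta) (β : T.Leaf → Bool) :
    T.marginal θ β = expect θ (leafIndicator β) := by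
  classical
  unfold marginal expect
  rw [Finset.sum_filter]
  refine Finset.sum_congr rfl fun α _ => ?_
  split_ifs with h
  · rw [Finset.prod_eq_one, one_mul]
    intro v _
    refine if_pos ?_
    rintro i rfl
    exact h i
  · push Not at h
    obtain ⟨i, hi⟩ := h
    rw [Finset.prod_eq_zero (Finset.mem_univ i.1), zero_mul]
    exact if_neg fun h => hi (h i rfl)

theorem sum_marginal_mul (θ : T.Theta) (G : (T.Leaf → Bool) → ℝ) :
    ∑ β, T.marginal θ β * G β = ∑ α : V → Bool, T.jointProb θ α * G fun i => α i.1 := by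
  rw [← Finset.sum_fiberwise Finset.univ (fun (α : V → Bool) (i : T.Leaf) => α i.1)]
  refine Finset.sum_congr rfl fun β _ => ?_
  unfold marginal
  rw [Finset.sum_mul]
  refine Finset.sum_congr ?_ fun α hα => ?_
  · ext α
    simp [funext_iff]
  · simp only [Finset.mem_filter, Finset.mem_univ, true_and] at hα
    rw [hα]

theorem leafMean_marginal (y : T.Param) (i : T.Leaf) :
    T.leafMean (T.marginal (toTheta y)) i = mean y i.1 := by
  rw [leafMean, sum_marginal_mul (toTheta y) fun β => bit (β i), ← nodeMean_toTheta, nodeMean]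
  exact Finset.sum_congr rfl fun α _ => mul_comm _ _

theorem leafCov_marginal (y : T.Param) {i j : T.Leaf} (hij : i ≠ j) :
    T.leafCov (T.marginal (toTheta y)) i j = edgeMonomial (T.pathEdges i.1 j.1) y := by
  have hij' : i.1 ≠ j.1 := fun h => hij (Subtype.ext h)
  rw [← expect_pair y hij']
  unfold leafCov
  rw [sum_marginal_mul (toTheta y) fun β => (bit (β i) - _) * (bit (β j) - _), expect]
  refine Finset.sum_congr rfl fun α _ => ?_
  have : ∏ v, centered y {i.1, j.1} v (α v)
      = ∏ v ∈ ({i.1, j.1} : Finset V), (bit (α v) - mean y v) := by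
    simp only [centered]
    rw [Finset.prod_ite_mem, Finset.univ_inter]
  rw [this, Finset.prod_pair hij', leafMean_marginal, leafMean_marginal, mul_comm]

/-- The third central moment of three leaf variables. -/
noncomputable def leafThird (T : BinaryTreeModel V) (p : (T.Leaf → Bool) → ℝ)
    (i j k : T.Leaf) : ℝ :=
  ∑ β : T.Leaf → Bool, p β * ((bit (β i) - T.leafMean p i) * ((bit (β j) - T.leafMean p j) *
    (bit (β k) - T.leafMean p k)))

theorem leafThird_marginal (y : T.Param) {v : V} {i j k : T.Leaf}
    (hij : T.DisjointPaths v i.1 j.1) (hik : T.DisjointPaths v i.1 k.1)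
    (hjk : T.DisjointPaths v j.1 k.1) (hv : ¬ T.IsLeaf v) (hij' : i.1 ≠ j.1) (hik' : i.1 ≠ k.1)
    (hjk' : j.1 ≠ k.1) :
    T.leafThird (T.marginal (toTheta y)) i j k
      = edgeMonomial (T.tripod v i.1 j.1 k.1) y * y (Sum.inl v) := by
  rw [← expect_triple y hij hik hjk (fun h => hv (h ▸ i.2)) (fun h => hv (h ▸ j.2))
    (fun h => hv (h ▸ k.2)) (isLeaf_iff.1 i.2) (isLeaf_iff.1 j.2) (isLeaf_iff.1 k.2)]
  unfold leafThird
  rw [sum_marginal_mul (toTheta y)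
    fun β => (bit (β i) - _) * ((bit (β j) - _) * (bit (β k) - _)), expect]
  refine Finset.sum_congr rfl fun α _ => ?_
  have : ∏ v, centered y {i.1, j.1, k.1} v (α v)
      = ∏ v ∈ ({i.1, j.1, k.1} : Finset V), (bit (α v) - mean y v) := by
    simp only [centered]
    rw [Finset.prod_ite_mem, Finset.univ_inter]
  rw [this, Finset.prod_insert (by simp [hij', hik']), Finset.prod_pair hjk', leafMean_marginal,
    leafMean_marginal, leafMean_marginal, mul_comm]

/-- The monomial controls only the variances at nodes without a parent edge in `F`; positivity is
passed down the edges of `F` by total variance. -/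
theorem ne_zero_of_edgeMonomial {y : T.Param} (hy : y ∈ T.omegaSpace) {F : Finset T.Edge}
    (h : edgeMonomial F y ≠ 0) :
    (∀ e ∈ F, y (Sum.inr e) ≠ 0) ∧ ∀ v, 0 < edgeDeg F v → 0 < var y v := by
  have h1 := left_ne_zero_of_mul h
  have h2 := right_ne_zero_of_mul h
  rw [Finset.prod_ne_zero_iff] at h1 h2
  refine ⟨h1, fun v => ?_⟩
  have key : ∀ v, 0 < edgeDeg F v → ¬ Headed F v → 0 < var y v := by
    intro v hd hh
    have := h2 v (Finset.mem_univ v)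
    rw [if_pos ⟨hd, hh⟩] at this
    exact lt_of_le_of_ne (var_nonneg hy v) this.symm
  induction v using root_induction (T := T) with
  | h0 =>
    intro hd
    refine key _ hd ?_
    rintro ⟨e, -, h⟩
    exact e.tgt_ne_root h
  | h1 e ih =>
    intro hd
    by_cases hh : Headed F e.tgt
    · obtain ⟨f, hf, hfe⟩ := hh
      obtain rfl := Edge.tgt_injective hfe
      have h3 := ih (edgeDeg_pos hf (Or.inl rfl))
      refine lt_of_lt_of_le (mul_pos ?_ h3) (sq_mul_var_le hy f)
      have := h1 f hf
      positivity
    · exact key _ hd hh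

section Vanishing

/-- The coordinates that vary transversally: those of isolated edges and degenerate nodes. -/
def IsDegenerateCoord (T : BinaryTreeModel V) (p : (T.Leaf → Bool) → ℝ) : V ⊕ T.Edge → Prop
  | Sum.inl v => v ∈ T.degenerateNodes p
  | Sum.inr e => e ∉ T.linked p

/-- The edge set `F` meets the set `S` of nodes and edges. -/
def Meets (F : Finset T.Edge) (S : Finset (V ⊕ T.Edge)) : Prop :=
  (∃ e ∈ F, Sum.inr e ∈ S) ∨ ∃ v, 0 < edgeDeg F v ∧ Sum.inl v ∈ S

/-- A set of isolated edges and degenerate nodes meeting all the edge sets that may connect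
distinct components of the forest. -/
def IsCutset (T : BinaryTreeModel V) (p : (T.Leaf → Bool) → ℝ) (S : Finset (V ⊕ T.Edge)) : Prop :=
  (∀ c ∈ S, T.IsDegenerateCoord p c) ∧
    ∀ F : Finset T.Edge, LeafClosed F → ¬ F ⊆ T.linked p → Meets F S

/-- The node variable is constant, respectively the edge carries no dependence. -/
def VanishesAt (y : T.Param) : V ⊕ T.Edge → Prop
  | Sum.inl v => y (Sum.inl v) ^ 2 = 1
  | Sum.inr e => y (Sum.inr e) = 0

/-- All the coordinates in `S` vanish in the sense of `VanishesAt`. -/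
def VanishesOn (y : T.Param) (S : Finset (V ⊕ T.Edge)) : Prop := ∀ c ∈ S, VanishesAt y c

theorem VanishesOn.prod_nodeFactor_eq_zero {y : T.Param} (hy : y ∈ T.omegaSpace)
    {S : Finset (V ⊕ T.Edge)} (h : VanishesOn y S) {F : Finset T.Edge} (hF : Meets F S)
    (g : V → Bool → ℝ) : (∏ e ∈ F, y (Sum.inr e)) * ∏ v, nodeFactor y F v (g v) = 0 := by
  rcases hF with ⟨e, he, heS⟩ | ⟨v, hv, hvS⟩
  · exact mul_eq_zero_of_left (Finset.prod_eq_zero he (show y (Sum.inr e) = 0 from h _ heS)) _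
  · exact BinaryTreeModel.prod_nodeFactor_eq_zero hy hv
      (by have : y (Sum.inl v) ^ 2 = 1 := h _ hvS
          simp [var, this]) g

end Vanishing

section FiberPoint

variable {y : T.Param}

theorem omegaFiber_mean (hy : y ∈ T.omegaFiber p) (i : T.Leaf) :
    mean y i.1 = T.leafMean p i := by
  rw [← (mem_omegaFiber.1 hy).2, leafMean_marginal]

theorem omegaFiber_var_leaf (hleaf : ∀ i : T.Leaf, T.leafMean p i * (1 - T.leafMean p i) ≠ 0)
    (hy : y ∈ T.omegaFiber p) {v : V} (hv : T.IsLeaf v) : 0 < var y v := by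
  refine lt_of_le_of_ne (var_nonneg (mem_omegaFiber.1 hy).1 v) fun h => hleaf ⟨v, hv⟩ ?_
  rw [← omegaFiber_mean hy ⟨v, hv⟩, ← var_eq_mean, ← h]

theorem omegaFiber_cov (hy : y ∈ T.omegaFiber p) {i j : T.Leaf} (hij : i.1 ≠ j.1) :
    T.leafCov p i j = edgeMonomial (T.pathEdges i.1 j.1) y := by
  rw [← (mem_omegaFiber.1 hy).2, leafCov_marginal y (by rintro rfl; exact hij rfl)]

theorem omegaFiber_linked (hy : y ∈ T.omegaFiber p) {e : T.Edge} (he : e ∈ T.linked p) :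
    y (Sum.inr e) ≠ 0 ∧ ∀ v, e.Inc v → 0 < var y v := by
  obtain ⟨i, j, hs, hc⟩ := mem_linked_iff.1 he
  have hij : i.1 ≠ j.1 := fun h => by rw [h] at hs; exact Edge.not_sep_self hs
  rw [omegaFiber_cov hy hij] at hc
  obtain ⟨h1, h2⟩ := ne_zero_of_edgeMonomial (mem_omegaFiber.1 hy).1 hc
  exact ⟨h1 e (mem_pathEdges.2 hs), fun v hv => h2 v (edgeDeg_pos (mem_pathEdges.2 hs) hv)⟩

theorem omegaFiber_var_pos (hleaf : ∀ i : T.Leaf, T.leafMean p i * (1 - T.leafMean p i) ≠ 0)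
    (hy : y ∈ T.omegaFiber p) {v : V} (hv : v ∉ T.degenerateNodes p) : 0 < var y v := by
  by_cases hl : T.IsLeaf v
  · exact omegaFiber_var_leaf hleaf hy hl
  · rw [mem_degenerateNodes_iff, not_and] at hv
    obtain ⟨e, he, hev⟩ := exists_inc_of_edgeDeg (Nat.pos_of_ne_zero (hv hl))
    exact (omegaFiber_linked hy he).2 v hev

open Classical in
/-- The isolated edges and degenerate nodes at which `y` vanishes. -/
noncomputable def zeroSet (p : (T.Leaf → Bool) → ℝ) (y : T.Param) : Finset (V ⊕ T.Edge) :=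
  Finset.univ.filter fun c => T.IsDegenerateCoord p c ∧ VanishesAt y c

theorem mem_zeroSet {c : V ⊕ T.Edge} :
    c ∈ zeroSet p y ↔ T.IsDegenerateCoord p c ∧ VanishesAt y c := by
  simp [zeroSet]

theorem vanishesOn_zeroSet : VanishesOn y (zeroSet p y) := fun _ hc => (mem_zeroSet.1 hc).2

/-- A leaf-closed set leaving the forest contains a path between leaves through an isolated edge.
The covariance of its ends is a vanishing monomial, so one factor vanishes; it cannot belong to a
linked edge or a nondegenerate node. -/
theorem isCutset_zeroSet
    (hleaf : ∀ i : T.Leaf, T.leafMean p i * (1 - T.leafMean p i) ≠ 0)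
    (hy : y ∈ T.omegaFiber p) : T.IsCutset p (zeroSet p y) := by
  refine ⟨fun c hc => (mem_zeroSet.1 hc).1, fun F hF hFl => ?_⟩
  obtain ⟨e, heF, hel⟩ := Finset.not_subset.1 hFl
  obtain ⟨a, b, hs, hab, ha, hb⟩ := exists_path_through heF
  have hne : a ≠ b := by
    rintro rfl
    exact Edge.not_sep_self hs
  have hcov : edgeMonomial (T.pathEdges a b) y = 0 := by
    rw [← omegaFiber_cov hy (i := ⟨a, hF a ha⟩) (j := ⟨b, hF b hb⟩) hne]
    by_contra h
    exact hel (mem_linked_iff.2 ⟨_, _, hs, h⟩)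
  rw [edgeMonomial, mul_eq_zero, Finset.prod_eq_zero_iff, Finset.prod_eq_zero_iff] at hcov
  rcases hcov with ⟨f, hf, hf0⟩ | ⟨v, -, hv⟩
  · refine Or.inl ⟨f, hab hf, ?_⟩
    rw [mem_zeroSet]
    exact ⟨fun h => (omegaFiber_linked hy h).1 hf0, hf0⟩
  · split_ifs at hv with h
    · refine Or.inr ⟨v, h.1.trans_le (edgeDeg_mono hab v), ?_⟩
      rw [mem_zeroSet]
      refine ⟨?_, by unfold var at hv; change y _ ^ 2 = 1; linarith⟩
      by_contra hd
      exact (omegaFiber_var_pos hleaf hy hd).ne' hv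
    · exact absurd hv one_ne_zero

end FiberPoint

/-! ### Chains of linked edges, and the data that determine the leaf law. -/

section Classes

/-- Two linked edges are equivalent if they are joined through nodes of degree two of the
forest. -/
noncomputable def chainSetoid (T : BinaryTreeModel V) (p : (T.Leaf → Bool) → ℝ) :
    Setoid T.Edge :=
  Relation.EqvGen.setoid fun e f =>
    e ∈ T.linked p ∧ f ∈ T.linked p ∧ ∃ v, T.IsPassing p v ∧ e.Inc v ∧ f.Inc v

/-- A representative of the chain of an edge. -/
noncomputable def chainRep (p : (T.Leaf → Bool) → ℝ) (e : T.Edge) : T.Edge :=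
  (Quotient.mk (T.chainSetoid p) e).out

theorem chainRep_eq_iff {e f : T.Edge} :
    chainRep p e = chainRep p f ↔ (T.chainSetoid p).r e f := by
  rw [chainRep, chainRep, Quotient.out_inj]
  exact Quotient.eq (r := T.chainSetoid p)

theorem chainRep_chainRep (e : T.Edge) : chainRep p (chainRep p e) = chainRep p e := by
  rw [chainRep_eq_iff]
  exact Quotient.mk_out (s := T.chainSetoid p) e

/-- The chain represented by `r`. -/
noncomputable def chain (p : (T.Leaf → Bool) → ℝ) (r : T.Edge) : Finset T.Edge :=
  (T.linked p).filter fun e => chainRep p e = r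

/-- A set of linked edges that contains with an edge all edges equivalent to it. -/
def ChainClosed (p : (T.Leaf → Bool) → ℝ) (F : Finset T.Edge) : Prop :=
  F ⊆ T.linked p ∧ ∀ v, T.IsPassing p v → ∀ e ∈ F, e.Inc v → ∀ f ∈ T.linked p, f.Inc v → f ∈ F

theorem chainClosed_chain (r : T.Edge) : ChainClosed p (chain p r) := by
  refine ⟨Finset.filter_subset _ _, fun v hv e he hev f hf hfv => ?_⟩
  simp only [chain, Finset.mem_filter] at he ⊢
  refine ⟨hf, ?_⟩
  rw [← he.2, chainRep_eq_iff]
  exact Relation.EqvGen.rel _ _ ⟨hf, he.1, v, hv, hfv, hev⟩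

/-- At a node of degree two of the forest a leaf-closed subset cannot have degree one, so it
contains both edges or none. -/
theorem LeafClosed.chainClosed {F : Finset T.Edge} (h : LeafClosed F) (hF : F ⊆ T.linked p) :
    ChainClosed p F := by
  refine ⟨hF, fun v hv e he hev f hf hfv => ?_⟩
  have h1 := edgeDeg_pos he hev
  have h2 : edgeDeg F v ≠ 1 := fun h' => hv.1 (h v h')
  have h3 := edgeDeg_mono hF v
  have h4 := hv.2
  have h5 : F.filter (fun e => e.Inc v) = (T.linked p).filter (fun e => e.Inc v) :=
    Finset.eq_of_subset_of_card_le (Finset.filter_subset_filter _ hF)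
      (by change edgeDeg _ v ≤ edgeDeg _ v; omega)
  have h6 : f ∈ F.filter (fun e => e.Inc v) := by
    rw [h5]; exact Finset.mem_filter.2 ⟨hf, hfv⟩
  exact (Finset.mem_filter.1 h6).1

theorem ChainClosed.mem_of_rep_eq {F : Finset T.Edge} (h : ChainClosed p F) {e f : T.Edge}
    (he : e ∈ F) (hef : chainRep p e = chainRep p f) : f ∈ F := by
  rw [chainRep_eq_iff] at hef
  have key : ∀ e f, Relation.EqvGen (fun e f : T.Edge => e ∈ T.linked p ∧ f ∈ T.linked p ∧
      ∃ v, T.IsPassing p v ∧ e.Inc v ∧ f.Inc v) e f → (e ∈ F ↔ f ∈ F) := by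
    intro e f hr
    induction hr with
    | rel x y hxy =>
      obtain ⟨hx, hy, v, hv, hxv, hyv⟩ := hxy
      exact ⟨fun h' => h.2 v hv x h' hxv y hy hyv, fun h' => h.2 v hv y h' hyv x hx hxv⟩
    | refl x => rfl
    | symm x y _ ih => exact ih.symm
    | trans x y z _ _ ih1 ih2 => exact ih1.trans ih2
  exact (key e f hef).1 he

theorem ChainClosed.filter_inc {F : Finset T.Edge} (h : ChainClosed p F) {v : V}
    (hv : T.IsPassing p v) (hd : 0 < edgeDeg F v) :
    F.filter (fun e => e.Inc v) = (T.linked p).filter fun e => e.Inc v := by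
  obtain ⟨e, he, hev⟩ := exists_inc_of_edgeDeg hd
  ext f
  simp only [Finset.mem_filter]
  exact ⟨fun hf => ⟨h.1 hf.1, hf.2⟩, fun hf => ⟨h.2 v hv e he hev f hf.1 hf.2, hf.2⟩⟩

theorem ChainClosed.edgeDeg_passing {F : Finset T.Edge} (h : ChainClosed p F) {v : V}
    (hv : T.IsPassing p v) : edgeDeg F v = 0 ∨ edgeDeg F v = 2 := by
  by_cases hd : 0 < edgeDeg F v
  · right
    rw [edgeDeg, h.filter_inc hv hd]
    exact hv.2
  · omega

theorem edgeDeg_degenerate {F : Finset T.Edge} (h : F ⊆ T.linked p) {v : V}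
    (hv : v ∈ T.degenerateNodes p) : edgeDeg F v = 0 := by
  have h1 := edgeDeg_mono h v
  have h2 := (mem_degenerateNodes_iff.1 hv).2
  omega

open Classical in
/-- A linked edge at `v`. -/
noncomputable def linkedEdgeAt (p : (T.Leaf → Bool) → ℝ) (v : V) : Option T.Edge :=
  if h : ∃ e ∈ T.linked p, e.Inc v then some h.choose else none

theorem linkedEdgeAt_spec {v : V} {e : T.Edge} (h : linkedEdgeAt p v = some e) :
    e ∈ T.linked p ∧ e.Inc v := by
  unfold linkedEdgeAt at h
  split_ifs at h with hex
  exact Option.some_injective _ h ▸ hex.choose_spec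

theorem exists_linkedEdgeAt {v : V} (h : 0 < edgeDeg (T.linked p) v) :
    ∃ e, linkedEdgeAt p v = some e := by
  obtain ⟨e, he⟩ := exists_inc_of_edgeDeg h
  exact ⟨_, dif_pos ⟨e, he⟩⟩

open Classical in
/-- The nodes of degree two at the top of a component of the forest, attached to one of their two
edges. -/
noncomputable def topNodes (p : (T.Leaf → Bool) → ℝ) (e : T.Edge) : Finset V :=
  Finset.univ.filter fun v =>
    T.IsPassing p v ∧ ¬ Headed (T.linked p) v ∧ linkedEdgeAt p v = some e

/-- The coordinate of an edge, scaled by the variance of an adjacent top node. -/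
noncomputable def scaledEdge (p : (T.Leaf → Bool) → ℝ) (e : T.Edge) (y : T.Param) : ℝ :=
  y (Sum.inr e) * ∏ v ∈ topNodes p e, var y v

/-- The product along a chain. -/
noncomputable def chainProd (p : (T.Leaf → Bool) → ℝ) (r : T.Edge) (y : T.Param) : ℝ :=
  ∏ e ∈ chain p r, scaledEdge p e y

theorem ChainClosed.prod_scaledEdge {F : Finset T.Edge} (h : ChainClosed p F) (y : T.Param) :
    ∏ e ∈ F, scaledEdge p e y = ∏ r ∈ F.image (chainRep p), chainProd p r y := by
  rw [← Finset.prod_fiberwise_of_maps_to (t := F.image (chainRep p))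
    (fun e he => Finset.mem_image_of_mem _ he)]
  refine Finset.prod_congr rfl fun r hr => ?_
  obtain ⟨e, he, rfl⟩ := Finset.mem_image.1 hr
  refine Finset.prod_congr ?_ fun _ _ => rfl
  ext f
  simp only [chain, Finset.mem_filter]
  exact ⟨fun hf => ⟨h.1 hf.1, hf.2⟩, fun hf => ⟨h.mem_of_rep_eq he hf.2.symm, hf.2⟩⟩

/-- If a passing node is touched by `F`, both its linked edges belong to `F`. So the edge to which
it is attached occurs, and being headed means the same in `F` as in the forest. -/
theorem ChainClosed.prod_topNodes {F : Finset T.Edge} (h : ChainClosed p F) (y : T.Param) :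
    ∏ e ∈ F, ∏ v ∈ topNodes p e, var y v
      = ∏ v, if T.IsPassing p v then (if 0 < edgeDeg F v ∧ ¬ Headed F v then var y v else 1)
        else 1 := by
  classical
  simp only [topNodes, Finset.prod_filter]
  rw [Finset.prod_comm]
  refine Finset.prod_congr rfl fun v _ => ?_
  by_cases hv : T.IsPassing p v
  · obtain ⟨e, he⟩ := exists_linkedEdgeAt (p := p) (v := v) (by have := hv.2; omega)
    obtain ⟨hel, hev⟩ := linkedEdgeAt_spec he
    rw [if_pos hv]
    by_cases hd : 0 < edgeDeg F v
    · have hflt := h.filter_inc hv hd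
      have hh : Headed F v ↔ Headed (T.linked p) v := by
        constructor
        · rintro ⟨f, hf, hfv⟩
          exact ⟨f, h.1 hf, hfv⟩
        · rintro ⟨f, hf, hfv⟩
          have : f ∈ F.filter (fun e => e.Inc v) := by
            rw [hflt]; exact Finset.mem_filter.2 ⟨hf, Or.inr hfv⟩
          exact ⟨f, (Finset.mem_filter.1 this).1, hfv⟩
      have heF : e ∈ F := by
        have : e ∈ F.filter (fun e => e.Inc v) := by
          rw [hflt]; exact Finset.mem_filter.2 ⟨hel, hev⟩
        exact (Finset.mem_filter.1 this).1
      rw [Finset.prod_eq_single e]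
      · simp [hv, hd, hh, he]
      · intro f _ hfe
        rw [if_neg]
        rintro ⟨-, -, hf⟩
        exact hfe (Option.some_injective _ (hf.symm.trans he))
      · exact fun h' => absurd heF h'
    · rw [if_neg fun h' => hd h'.1]
      refine Finset.prod_eq_one fun f hf => if_neg ?_
      rintro ⟨-, -, hfv⟩
      exact hd (edgeDeg_pos hf (linkedEdgeAt_spec hfv).2)
  · rw [if_neg hv]
    exact Finset.prod_eq_one fun f hf => if_neg fun h' => hv h'.1

/-- The distribution of the leaves is determined by the rigid nodes and the chain products, once
the components of the forest are independent. -/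
theorem marginal_eq_of_agree {y y' : T.Param} (hy : y ∈ T.omegaSpace) (hy' : y' ∈ T.omegaSpace)
    {S S' : Finset (V ⊕ T.Edge)} (hS : T.IsCutset p S) (hS' : T.IsCutset p S')
    (hyS : VanishesOn y S) (hyS' : VanishesOn y' S')
    (hrigid : ∀ v, T.IsRigid p v → y (Sum.inl v) = y' (Sum.inl v))
    (hchain : ∀ r ∈ T.linked p, chainRep p r = r → chainProd p r y = chainProd p r y') :
    T.marginal (toTheta y) = T.marginal (toTheta y') := by
  funext β
  rw [marginal_eq_expect, marginal_eq_expect, expect_toTheta, expect_toTheta]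
  refine Finset.sum_congr rfl fun F _ => ?_
  -- An edge set leaving the forest contributes zero on both sides: through the cutset if it is
  -- leaf-closed, and through an unobserved end otherwise.
  by_cases hFl : F ⊆ T.linked p
  swap
  · by_cases hF : LeafClosed F
    · rw [hyS.prod_nodeFactor_eq_zero hy (hS.2 F hF hFl),
        hyS'.prod_nodeFactor_eq_zero hy' (hS'.2 F hF hFl)]
    · simp only [LeafClosed, not_forall] at hF
      obtain ⟨v, hv, hvl⟩ := hF
      rw [mul_eq_zero_of_right _ (Finset.prod_eq_zero (Finset.mem_univ v) _),
        mul_eq_zero_of_right _ (Finset.prod_eq_zero (Finset.mem_univ v) _)]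
      · rw [leafIndicator_of_not_isLeaf β hvl, nodeFactor_one_one _ hv]
      · rw [leafIndicator_of_not_isLeaf β hvl, nodeFactor_one_one _ hv]
  by_cases hF : LeafClosed F
  swap
  · simp only [LeafClosed, not_forall] at hF
    obtain ⟨v, hv, hvl⟩ := hF
    rw [mul_eq_zero_of_right _ (Finset.prod_eq_zero (Finset.mem_univ v) _),
      mul_eq_zero_of_right _ (Finset.prod_eq_zero (Finset.mem_univ v) _)]
    · rw [leafIndicator_of_not_isLeaf β hvl, nodeFactor_one_one _ hv]
    · rw [leafIndicator_of_not_isLeaf β hvl, nodeFactor_one_one _ hv]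
  have hcl := hF.chainClosed hFl
  -- A passing node contributes one or its variance, and the scaled edges absorb these variances.
  -- What remains are chain products and the factors of the other nodes.
  have key : ∀ (z : T.Param) (g : V → Bool → ℝ), (∀ v, ¬ T.IsLeaf v → g v = fun _ => 1) →
      (∏ e ∈ F, z (Sum.inr e)) * ∏ v, nodeFactor z F v (g v)
      = (∏ r ∈ F.image (chainRep p), chainProd p r z) *
        ∏ v, if T.IsPassing p v then 1 else nodeFactor z F v (g v) := by
    intro z g hg
    rw [← hcl.prod_scaledEdge]
    unfold scaledEdge
    rw [Finset.prod_mul_distrib, hcl.prod_topNodes, mul_assoc, ← Finset.prod_mul_distrib]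
    congr 1
    refine Finset.prod_congr rfl fun v _ => ?_
    by_cases hv : T.IsPassing p v
    · rw [if_pos hv, if_pos hv, mul_one, hg v hv.1]
      rcases hcl.edgeDeg_passing hv with h | h
      · rw [nodeFactor_one_zero z h]
        simp [h]
      · rw [nodeFactor_one_two z h]
        simp [h, ite_not]
    · rw [if_neg hv, if_neg hv, one_mul]
  rw [key y _ fun v hv => leafIndicator_of_not_isLeaf β hv,
    key y' _ fun v hv => leafIndicator_of_not_isLeaf β hv]
  congr 1
  · refine Finset.prod_congr rfl fun r hr => ?_
    obtain ⟨e, he, rfl⟩ := Finset.mem_image.1 hr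
    refine hchain _ (hFl ?_) (chainRep_chainRep e)
    exact hcl.mem_of_rep_eq he (chainRep_chainRep e).symm
  · refine Finset.prod_congr rfl fun v _ => ?_
    rcases node_cases (p := p) v with hv | hv | hv
    · have : mean y v = mean y' v := by unfold mean; rw [hrigid v hv]
      simp only [nodeFactor, this]
    · rw [if_pos hv, if_pos hv]
    · have h0 := edgeDeg_degenerate hFl hv
      have hl := (mem_degenerateNodes_iff.1 hv).1
      rw [leafIndicator_of_not_isLeaf β hl, nodeFactor_one_zero _ h0, nodeFactor_one_zero _ h0]

end Classes

end Fiber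

end BinaryTreeModel

namespace BinaryTreeModel

/-! ### The leaf law determines rigid means and chain products up to sign. -/

section Identification

variable {V : Type*} {T : BinaryTreeModel V} [Fintype V] [DecidableEq V]
  {p : (T.Leaf → Bool) → ℝ} {y y' : T.Param}

theorem exists_leaf_beyond {e : T.Edge} (he : e ∈ T.linked p) {x : V} (hx : e.Inc x) :
    ∃ i : T.Leaf, e.Sep x i.1 ∧ T.pathEdges x i.1 ⊆ T.linked p := by
  obtain ⟨z, hz, hzl, hd⟩ := exists_extension_of_inc he hx
  exact ⟨⟨z, leafClosed_linked z hd⟩, hz, hzl⟩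

/-- The quotient of the variances of a node variable at two points. -/
noncomputable def varRatio (y y' : T.Param) (v : V) : ℝ := var y v / var y' v

/-- The quotient of the squared correlations along an edge at two points. -/
noncomputable def corrRatio (y y' : T.Param) (e : T.Edge) : ℝ :=
  (y (Sum.inr e) / y' (Sum.inr e)) ^ 2 * (varRatio y y' e.src / varRatio y y' e.tgt)

theorem prod_corrRatio (F : Finset T.Edge) : ∏ e ∈ F, corrRatio y y' e
    = (∏ e ∈ F, (y (Sum.inr e) / y' (Sum.inr e)) ^ 2) *
      ∏ v, varRatio y y' v ^ childCount F v / (if Headed F v then varRatio y y' v else 1) := by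
  unfold corrRatio
  rw [Finset.prod_mul_distrib, Finset.prod_div_distrib, Finset.prod_div_distrib, prod_src,
    prod_tgt]

theorem varRatio_pos (hy : y ∈ T.omegaFiber p) (hy' : y' ∈ T.omegaFiber p) {F : Finset T.Edge}
    (hF : F ⊆ T.linked p) {v : V} (hv : 0 < edgeDeg F v) : 0 < varRatio y y' v := by
  obtain ⟨e, he, hev⟩ := exists_inc_of_edgeDeg hv
  exact div_pos ((omegaFiber_linked hy (hF he)).2 v hev)
    ((omegaFiber_linked hy' (hF he)).2 v hev)

theorem corrRatio_pos (hy : y ∈ T.omegaFiber p) (hy' : y' ∈ T.omegaFiber p) {e : T.Edge}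
    (he : e ∈ T.linked p) : 0 < corrRatio y y' e := by
  have h1 := omegaFiber_linked hy he
  have h2 := omegaFiber_linked hy' he
  have h3 := h1.2 _ (Or.inl rfl)
  have h4 := h1.2 _ (Or.inr rfl)
  have h5 := h2.2 _ (Or.inl rfl)
  have h6 := h2.2 _ (Or.inr rfl)
  have h7 : 0 < (y (Sum.inr e) / y' (Sum.inr e)) ^ 2 := by
    have := div_ne_zero h1.1 h2.1
    positivity
  unfold corrRatio varRatio
  positivity

theorem edgeMonomial_ne_zero (hy : y ∈ T.omegaFiber p) {F : Finset T.Edge}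
    (hF : F ⊆ T.linked p) : edgeMonomial F y ≠ 0 := by
  refine mul_ne_zero (Finset.prod_ne_zero_iff.2 fun e he => (omegaFiber_linked hy (hF he)).1)
    (Finset.prod_ne_zero_iff.2 fun v _ => ?_)
  split_ifs with h
  · obtain ⟨e, he, hev⟩ := exists_inc_of_edgeDeg h.1
    exact ((omegaFiber_linked hy (hF he)).2 v hev).ne'
  · exact one_ne_zero

/-- Variances telescope in a product of squared correlations: at a node of degree two the leftover
matches the squared variance factor of `edgeMonomial`, headed or not, while a node of degree three
leaves exactly one extra variance ratio. -/
theorem prod_corrRatio_mul (hy : y ∈ T.omegaFiber p) (hy' : y' ∈ T.omegaFiber p)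
    {F : Finset T.Edge} (hF : F ⊆ T.linked p) {B : Finset V} (hB : ∀ v ∈ B, edgeDeg F v = 3)
    (hBc : ∀ v, v ∉ B → edgeDeg F v = 0 ∨ edgeDeg F v = 2 ∨ varRatio y y' v = 1) :
    (∏ e ∈ F, corrRatio y y' e) * edgeMonomial F y' ^ 2
      = edgeMonomial F y ^ 2 * ∏ v ∈ B, varRatio y y' v := by
  have h1 : (∏ e ∈ F, (y (Sum.inr e) / y' (Sum.inr e)) ^ 2) * (∏ e ∈ F, y' (Sum.inr e)) ^ 2
      = (∏ e ∈ F, y (Sum.inr e)) ^ 2 := by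
    rw [← Finset.prod_pow, ← Finset.prod_pow, ← Finset.prod_mul_distrib]
    refine Finset.prod_congr rfl fun e he => ?_
    have := (omegaFiber_linked hy' (hF he)).1
    field_simp
  have h2 : ∀ v, varRatio y y' v ^ childCount F v / (if Headed F v then varRatio y y' v else 1) *
      (if 0 < edgeDeg F v ∧ ¬ Headed F v then var y' v else 1) ^ 2
      = (if 0 < edgeDeg F v ∧ ¬ Headed F v then var y v else 1) ^ 2 *
        if v ∈ B then varRatio y y' v else 1 := by
    intro v
    have hdeg := edgeDeg_eq F v
    by_cases hd : 0 < edgeDeg F v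
    swap
    · have h0 : edgeDeg F v = 0 := by omega
      have hvB : v ∉ B := fun h => by
        have := hB v h
        omega
      rw [h0] at hdeg
      have hh : ¬ Headed F v := fun hh => by simp [hh] at hdeg
      have hk : childCount F v = 0 := by omega
      simp [hd, hvB, hh, hk]
    have hW := varRatio_pos hy hy' hF hd
    obtain ⟨e, he, hev⟩ := exists_inc_of_edgeDeg hd
    have hv1 := (omegaFiber_linked hy (hF he)).2 v hev
    have hv2 := (omegaFiber_linked hy' (hF he)).2 v hev
    by_cases hvB : v ∈ B
    · rw [hB v hvB] at hdeg
      by_cases hh : Headed F v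
      · have hk : childCount F v = 2 := by simp [hh] at hdeg; omega
        simp only [hh, hk, hvB, not_true, and_false, if_true, if_false]
        field_simp
      · have hk : childCount F v = 3 := by simp [hh] at hdeg; omega
        simp only [hh, hk, hvB, hd, not_false_iff, and_self, if_true, if_false, varRatio]
        field_simp
    · rcases hBc v hvB with h | h | h
      · omega
      · rw [h] at hdeg
        by_cases hh : Headed F v
        · have hk : childCount F v = 1 := by simp [hh] at hdeg; omega
          simp only [hh, hk, hvB, not_true, and_false, if_true, if_false]
          field_simp
        · have hk : childCount F v = 2 := by simp [hh] at hdeg; omega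
          simp only [hh, hk, hvB, hd, not_false_iff, and_self, if_true, if_false, varRatio]
          field_simp
      · have hvv : var y v = var y' v := (div_eq_one_iff_eq hv2.ne').1 h
        simp [h, hvB, hvv]
  rw [prod_corrRatio, edgeMonomial, edgeMonomial, mul_pow, mul_pow]
  have h3 := Finset.prod_congr (rfl : (Finset.univ : Finset V) = _) fun v _ => h2 v
  rw [Finset.prod_mul_distrib, Finset.prod_mul_distrib, Finset.prod_pow, Finset.prod_pow,
    Finset.prod_ite_mem, Finset.univ_inter] at h3
  rw [mul_mul_mul_comm, h1, h3]
  ring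

theorem edgeMonomial_eq_chainProd (z : T.Param) {r : T.Edge} : edgeMonomial (chain p r) z
    = chainProd p r z * ∏ v, if T.IsPassing p v then 1 else
      if 0 < edgeDeg (chain p r) v ∧ ¬ Headed (chain p r) v then var z v else 1 := by
  unfold edgeMonomial chainProd scaledEdge
  rw [Finset.prod_mul_distrib, (chainClosed_chain r).prod_topNodes, mul_assoc,
    ← Finset.prod_mul_distrib]
  congr 1
  refine Finset.prod_congr rfl fun v _ => ?_
  by_cases hv : T.IsPassing p v <;> simp [hv]

theorem chainProd_ne_zero (hy : y ∈ T.omegaFiber p) (r : T.Edge) : chainProd p r y ≠ 0 := by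
  have h0 := edgeMonomial_ne_zero hy (chainClosed_chain (p := p) r).1
  rw [edgeMonomial_eq_chainProd] at h0
  exact left_ne_zero_of_mul h0

variable (hleaf : ∀ i : T.Leaf, T.leafMean p i * (1 - T.leafMean p i) ≠ 0)
  (hy : y ∈ T.omegaFiber p) (hy' : y' ∈ T.omegaFiber p)

include hy hy'

theorem omegaFiber_leaf_eq {v : V} (hv : T.IsLeaf v) : y (Sum.inl v) = y' (Sum.inl v) := by
  have h1 := omegaFiber_mean hy ⟨v, hv⟩
  have h2 := omegaFiber_mean hy' ⟨v, hv⟩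
  have h3 : mean y v = mean y' v := h1.trans h2.symm
  unfold mean at h3
  linarith

include hleaf

theorem varRatio_leaf {v : V} (hv : T.IsLeaf v) : varRatio y y' v = 1 := by
  have h : var y v = var y' v := by unfold var; rw [omegaFiber_leaf_eq hy hy' hv]
  rw [varRatio, h, div_self (omegaFiber_var_leaf hleaf hy' hv).ne']

/-- The covariance of the two leaves is the same at both points, and so are the leaf variances; the
other nodes of the path have degree two. -/
theorem prod_corrRatio_path {i j : T.Leaf} (hij : i.1 ≠ j.1)
    (hl : T.pathEdges i.1 j.1 ⊆ T.linked p) :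
    ∏ e ∈ T.pathEdges i.1 j.1, corrRatio y y' e = 1 := by
  have h := prod_corrRatio_mul hy hy' hl (B := ∅) (by simp) fun v _ => by
    by_cases hv : T.IsLeaf v
    · exact Or.inr (Or.inr (varRatio_leaf hleaf hy hy' hv))
    · have := edgeDeg_pathEdges_of_ne (T := T) (v := v) (x := i.1) (y := j.1)
        (fun h => hv (h ▸ i.2)) (fun h => hv (h ▸ j.2))
      tauto
  rw [← omegaFiber_cov hy hij, ← omegaFiber_cov hy' hij, Finset.prod_empty, mul_one] at h
  refine mul_right_cancel₀ (pow_ne_zero 2 ?_) (h.trans (one_mul _).symm)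
  rw [omegaFiber_cov hy hij]
  exact edgeMonomial_ne_zero hy hl

theorem prod_corrRatio_mul_of_disjointPaths {x : V} {i j : T.Leaf}
    (h : T.DisjointPaths x i.1 j.1) (hij : i.1 ≠ j.1) (hi : T.pathEdges x i.1 ⊆ T.linked p)
    (hj : T.pathEdges x j.1 ⊆ T.linked p) :
    (∏ e ∈ T.pathEdges x i.1, corrRatio y y' e) * ∏ e ∈ T.pathEdges x j.1, corrRatio y y' e
      = 1 := by
  have hu : T.pathEdges i.1 j.1 = T.pathEdges x i.1 ∪ T.pathEdges x j.1 := by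
    ext e
    simp [h.2 e]
  rw [← Finset.prod_union, ← hu]
  · refine prod_corrRatio_path hleaf hy hy' hij ?_
    rw [hu]
    exact Finset.union_subset hi hj
  · rw [Finset.disjoint_left]
    intro e he he'
    exact h.1 e ⟨mem_pathEdges.1 he, mem_pathEdges.1 he'⟩

theorem prod_corrRatio_of_first {x : V} {i j : T.Leaf} {e f : T.Edge} (he : e.Inc x)
    (hf : f.Inc x) (hef : e ≠ f) (hi : e.Sep x i.1) (hj : f.Sep x j.1)
    (hil : T.pathEdges x i.1 ⊆ T.linked p) (hjl : T.pathEdges x j.1 ⊆ T.linked p) :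
    (∏ e ∈ T.pathEdges x i.1, corrRatio y y' e) * ∏ e ∈ T.pathEdges x j.1, corrRatio y y' e
      = 1 := by
  have h := disjointPaths_of_first he hf hef hi hj
  refine prod_corrRatio_mul_of_disjointPaths hleaf hy hy' h (fun hij => ?_) hil hjl
  have := (h.2 e).2 (Or.inl hi)
  rw [hij] at this
  exact Edge.not_sep_self this

/-- Three legs leave `x` through distinct edges, and any two form a path between leaves. Their
products satisfy ab = ac = bc = 1, so a² = 1, and a is positive. -/
theorem prod_corrRatio_branch {x : V} (hx : 3 ≤ edgeDeg (T.linked p) x) {i : T.Leaf}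
    {e : T.Edge} (he : e.Inc x) (hi : e.Sep x i.1) (hil : T.pathEdges x i.1 ⊆ T.linked p) :
    ∏ e ∈ T.pathEdges x i.1, corrRatio y y' e = 1 := by
  have hcard : 1 < (((T.linked p).filter fun e => e.Inc x).erase e).card := by
    have := Finset.pred_card_le_card_erase (s := (T.linked p).filter fun e => e.Inc x) (a := e)
    change 3 ≤ Finset.card _ at hx
    omega
  obtain ⟨f, hf, g, hg, hfg⟩ := Finset.one_lt_card.1 hcard
  simp only [Finset.mem_erase, Finset.mem_filter] at hf hg
  obtain ⟨j, hj, hjl⟩ := exists_leaf_beyond hf.2.1 hf.2.2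
  obtain ⟨k, hk, hkl⟩ := exists_leaf_beyond hg.2.1 hg.2.2
  have h1 := prod_corrRatio_of_first hleaf hy hy' he hf.2.2 hf.1.symm hi hj hil hjl
  have h2 := prod_corrRatio_of_first hleaf hy hy' he hg.2.2 hg.1.symm hi hk hil hkl
  have h3 := prod_corrRatio_of_first hleaf hy hy' hf.2.2 hg.2.2 hfg hj hk hjl hkl
  have hpos : 0 < ∏ e ∈ T.pathEdges x i.1, corrRatio y y' e :=
    Finset.prod_pos fun e he => corrRatio_pos hy hy' (hil he)
  set a := ∏ e ∈ T.pathEdges x i.1, corrRatio y y' e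
  set b := ∏ e ∈ T.pathEdges x j.1, corrRatio y y' e
  set c := ∏ e ∈ T.pathEdges x k.1, corrRatio y y' e
  have h4 : a ^ 2 = 1 := by linear_combination a ^ 2 * (-h3) + a * c * h1 + h2
  nlinarith

/-- The leg from the tail to `i` is `e` followed by the path from the head to `i`. That path and the
leg from the head to `j` form together a path between leaves, whose product is one. -/
theorem corrRatio_eq_mul {e : T.Edge} (he : e ∈ T.linked p) {i j : T.Leaf}
    (hi : e.Sep e.src i.1) (hil : T.pathEdges e.src i.1 ⊆ T.linked p) (hj : e.Sep e.tgt j.1)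
    (hjl : T.pathEdges e.tgt j.1 ⊆ T.linked p) :
    corrRatio y y' e = (∏ e ∈ T.pathEdges e.src i.1, corrRatio y y' e) *
      ∏ e ∈ T.pathEdges e.tgt j.1, corrRatio y y' e := by
  have hends : e.Sep e.src e.tgt := Edge.sep_ends_iff.2 rfl
  have hns : ¬ e.Sep e.tgt i.1 := by
    intro h
    exact Edge.sep_trans_iff.1 hi ⟨fun _ => h, fun _ => hends⟩
  have hins : T.pathEdges e.src i.1 = insert e (T.pathEdges e.tgt i.1) := by
    ext f
    rw [Finset.mem_insert, mem_pathEdges, mem_pathEdges, Edge.sep_trans_iff (y := e.tgt),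
      Edge.sep_ends_iff]
    by_cases hfe : f = e
    · subst hfe; tauto
    · tauto
  have hil' : T.pathEdges e.tgt i.1 ⊆ T.linked p := fun f hf =>
    hil (by rw [hins]; exact Finset.mem_insert_of_mem hf)
  have hd : T.DisjointPaths e.tgt i.1 j.1 := by
    have h := sep_of_disjoint_first (T := T) (x := e.tgt) (i := i.1) (j := j.1)
      fun f hf hfi hfj => hns <| by
        have := first_unique hf (Or.inr rfl) (Edge.sep_comm.1 hfj) (Edge.sep_comm.1 hj)
        exact this ▸ hfi
    exact ⟨fun e => (h e).1, fun e => (h e).2⟩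
  have hij : i.1 ≠ j.1 := fun h => hns (h ▸ hj)
  rw [hins, Finset.prod_insert (by simpa using hns), mul_assoc,
    prod_corrRatio_mul_of_disjointPaths hleaf hy hy' hd hij hil' hjl, mul_one]

theorem prod_corrRatio_chainClosed {F : Finset T.Edge} (hF : ChainClosed p F) :
    ∏ e ∈ F, corrRatio y y' e = 1 := by
  rcases F.eq_empty_or_nonempty with rfl | ⟨e₀, he₀⟩
  · rfl
  have : Nonempty T.Leaf := ⟨(exists_leaf_beyond (hF.1 he₀) (Or.inl rfl)).choose⟩
  have hex : ∀ (x : V) (e : T.Edge), e ∈ T.linked p → e.Inc x →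
      ∃ i : T.Leaf, e.Sep x i.1 ∧ T.pathEdges x i.1 ⊆ T.linked p :=
    fun x e he hx => exists_leaf_beyond he hx
  choose! l hl1 hl2 using hex
  set a : V → T.Edge → ℝ := fun x e => ∏ f ∈ T.pathEdges x (l x e).1, corrRatio y y' f with ha
  have h1 : ∏ e ∈ F, corrRatio y y' e = (∏ e ∈ F, a e.src e) * ∏ e ∈ F, a e.tgt e := by
    rw [← Finset.prod_mul_distrib]
    refine Finset.prod_congr rfl fun e he => ?_
    have hel := hF.1 he
    exact corrRatio_eq_mul hleaf hy hy' hel (hl1 _ e hel (Or.inl rfl)) (hl2 _ e hel (Or.inl rfl))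
      (hl1 _ e hel (Or.inr rfl)) (hl2 _ e hel (Or.inr rfl))
  -- The half-edge factors are regrouped by nodes. At a rigid node each leg has product one, at a
  -- passing node the two legs form a path between leaves, and a degenerate node has no edge of `F`.
  rw [h1, ← Finset.prod_fiberwise F Edge.src, ← Finset.prod_fiberwise F Edge.tgt,
    ← Finset.prod_mul_distrib]
  refine Finset.prod_eq_one fun v _ => ?_
  have h2 : (∏ e ∈ F with e.src = v, a e.src e) * ∏ e ∈ F with e.tgt = v, a e.tgt e
      = ∏ e ∈ F with e.Inc v, a v e := by
    have hu : F.filter (fun e => e.Inc v)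
        = F.filter (fun e => e.src = v) ∪ F.filter (fun e => e.tgt = v) := by
      rw [← Finset.filter_or]
      exact Finset.filter_congr fun e _ => Iff.rfl
    rw [hu, Finset.prod_union]
    · congr 1
      · exact Finset.prod_congr rfl fun e he => by rw [(Finset.mem_filter.1 he).2]
      · exact Finset.prod_congr rfl fun e he => by rw [(Finset.mem_filter.1 he).2]
    · rw [Finset.disjoint_filter]
      rintro e - h h'
      exact e.src_ne_tgt (h.trans h'.symm)
  rw [h2]
  rcases node_cases (p := p) v with (hv | hv) | hv | hv
  · refine Finset.prod_eq_one fun e he => ?_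
    rw [Finset.mem_filter] at he
    have hel := hF.1 he.1
    have hne : v ≠ (l v e).1 := fun h => by
      have := hl1 v e hel he.2
      rw [← h] at this
      exact Edge.not_sep_self this
    exact prod_corrRatio_path hleaf hy hy' (i := ⟨v, hv⟩) hne (hl2 v e hel he.2)
  · refine Finset.prod_eq_one fun e he => ?_
    rw [Finset.mem_filter] at he
    have hel := hF.1 he.1
    exact prod_corrRatio_branch hleaf hy hy' hv he.2 (hl1 v e hel he.2) (hl2 v e hel he.2)
  · rcases hF.edgeDeg_passing hv with h | h
    · rw [Finset.card_eq_zero.1 h, Finset.prod_empty]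
    · obtain ⟨e, f, hef, heq⟩ := Finset.card_eq_two.1 h
      have he : e ∈ F.filter fun e => e.Inc v := by simp [heq]
      have hf : f ∈ F.filter fun e => e.Inc v := by simp [heq]
      rw [Finset.mem_filter] at he hf
      have hel := hF.1 he.1
      have hfl := hF.1 hf.1
      rw [heq, Finset.prod_pair hef]
      exact prod_corrRatio_of_first hleaf hy hy' he.2 hf.2 hef (hl1 v e hel he.2)
        (hl1 v f hfl hf.2) (hl2 v e hel he.2) (hl2 v f hfl hf.2)
  · rw [Finset.card_eq_zero.1 (edgeDeg_degenerate hF.1 hv), Finset.prod_empty]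

/-- The mean of a rigid node is determined up to sign. -/
theorem omegaFiber_rigid_sq {v : V} (hv : T.IsRigid p v) :
    y (Sum.inl v) ^ 2 = y' (Sum.inl v) ^ 2 := by
  by_cases hvl : T.IsLeaf v
  · rw [omegaFiber_leaf_eq hy hy' hvl]
  have hv3 : 3 ≤ edgeDeg (T.linked p) v := hv.resolve_left hvl
  obtain ⟨e, he, f, hf, g, hg, hef, heg, hfg⟩ := Finset.two_lt_card.1 hv3
  rw [Finset.mem_filter] at he hf hg
  obtain ⟨i, hi, hil⟩ := exists_leaf_beyond he.1 he.2
  obtain ⟨j, hj, hjl⟩ := exists_leaf_beyond hf.1 hf.2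
  obtain ⟨k, hk, hkl⟩ := exists_leaf_beyond hg.1 hg.2
  have hij := disjointPaths_of_first he.2 hf.2 hef hi hj
  have hik := disjointPaths_of_first he.2 hg.2 heg hi hk
  have hjk := disjointPaths_of_first hf.2 hg.2 hfg hj hk
  have hij' : i.1 ≠ j.1 := fun h => hij.1 e ⟨hi, h ▸ hi⟩
  have hik' : i.1 ≠ k.1 := fun h => hik.1 e ⟨hi, h ▸ hi⟩
  have hjk' : j.1 ≠ k.1 := fun h => hjk.1 f ⟨hj, h ▸ hj⟩
  have hvi : v ≠ i.1 := fun h => hvl (h ▸ i.2)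
  have hvj : v ≠ j.1 := fun h => hvl (h ▸ j.2)
  have hvk : v ≠ k.1 := fun h => hvl (h ▸ k.2)
  have hsub : T.tripod v i.1 j.1 k.1 ⊆ T.linked p :=
    Finset.union_subset (Finset.union_subset hil hjl) hkl
  have hprod : ∏ e ∈ T.tripod v i.1 j.1 k.1, corrRatio y y' e = 1 := by
    rw [tripod, Finset.prod_union, Finset.prod_union,
      prod_corrRatio_branch hleaf hy hy' hv3 he.2 hi hil,
      prod_corrRatio_branch hleaf hy hy' hv3 hf.2 hj hjl,
      prod_corrRatio_branch hleaf hy hy' hv3 hg.2 hk hkl, one_mul, one_mul]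
    · rw [Finset.disjoint_left]
      intro e h h'
      exact hij.1 e ⟨mem_pathEdges.1 h, mem_pathEdges.1 h'⟩
    · rw [Finset.disjoint_left]
      intro e h h'
      rw [Finset.mem_union, mem_pathEdges, mem_pathEdges] at h
      rw [mem_pathEdges] at h'
      rcases h with h | h
      · exact hik.1 e ⟨h, h'⟩
      · exact hjk.1 e ⟨h, h'⟩
  have h := prod_corrRatio_mul hy hy' hsub (B := {v})
    (fun a ha => by
      rw [Finset.mem_singleton.1 ha, edgeDeg_tripod hij hik hjk, edgeDeg_pathEdges_left hvi,
        edgeDeg_pathEdges_left hvj, edgeDeg_pathEdges_left hvk])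
    (fun a ha => by
      by_cases hal : T.IsLeaf a
      · exact Or.inr (Or.inr (varRatio_leaf hleaf hy hy' hal))
      · have := edgeDeg_tripod_of_ne hij hik hjk (a := a) (by simpa using ha)
          (fun h => hal (h ▸ i.2)) (fun h => hal (h ▸ j.2)) (fun h => hal (h ▸ k.2))
        tauto)
  rw [hprod, one_mul, Finset.prod_singleton] at h
  have ht := leafThird_marginal y hij hik hjk hvl hij' hik' hjk'
  have ht' := leafThird_marginal y' hij hik hjk hvl hij' hik' hjk'
  rw [(mem_omegaFiber.1 hy).2] at ht
  rw [(mem_omegaFiber.1 hy').2, ht] at ht'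
  have hm := edgeMonomial_ne_zero hy hsub
  have hw := ((omegaFiber_linked hy' he.1).2 v he.2).ne'
  -- Equality of the third moments gives mμ̄ = m'μ̄', where m is the tripod monomial and m'² = m²W
  -- with W the variance ratio at `v`. Since the variance is itself a function of μ̄², this pins
  -- down μ̄².
  have h1 : y (Sum.inl v) ^ 2 = y' (Sum.inl v) ^ 2 * varRatio y y' v := by
    refine mul_left_cancel₀ (pow_ne_zero 2 hm) ?_
    linear_combination (edgeMonomial (T.tripod v i.1 j.1 k.1) y * y (Sum.inl v)
      + edgeMonomial (T.tripod v i.1 j.1 k.1) y' * y' (Sum.inl v)) * ht'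
      + y' (Sum.inl v) ^ 2 * h
  have h2 : y (Sum.inl v) ^ 2 * var y' v = y' (Sum.inl v) ^ 2 * var y v := by
    rw [h1, varRatio, mul_assoc, div_mul_cancel₀ _ hw]
  unfold var at h2
  linarith

theorem varRatio_rigid {v : V} (hv : T.IsRigid p v) : varRatio y y' v = 1 := by
  have h : var y v = var y' v := by unfold var; rw [omegaFiber_rigid_sq hleaf hy hy' hv]
  rw [varRatio, h, div_self]
  refine (omegaFiber_var_pos hleaf hy' fun hd => ?_).ne'
  rw [mem_degenerateNodes_iff] at hd
  rcases hv with hv | hv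
  · exact hd.1 hv
  · omega

/-- The chain products are determined up to sign. -/
theorem omegaFiber_chainProd_sq (r : T.Edge) :
    chainProd p r y ^ 2 = chainProd p r y' ^ 2 := by
  have hF := chainClosed_chain (p := p) r
  have h := prod_corrRatio_mul hy hy' hF.1 (B := ∅) (by simp) fun v _ => by
    rcases node_cases (p := p) v with hv | hv | hv
    · exact Or.inr (Or.inr (varRatio_rigid hleaf hy hy' hv))
    · have := hF.edgeDeg_passing hv
      tauto
    · exact Or.inl (edgeDeg_degenerate hF.1 hv)
  rw [prod_corrRatio_chainClosed hleaf hy hy' hF, one_mul, Finset.prod_empty, mul_one] at h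
  have h0 := edgeMonomial_ne_zero hy hF.1
  rw [edgeMonomial_eq_chainProd] at h0
  rw [edgeMonomial_eq_chainProd, edgeMonomial_eq_chainProd,
    Finset.prod_congr rfl (g := fun v => if T.IsPassing p v then 1 else
      if 0 < edgeDeg (chain p r) v ∧ ¬ Headed (chain p r) v then var y v else 1),
    mul_pow, mul_pow] at h
  · exact (mul_right_cancel₀ (pow_ne_zero 2 (right_ne_zero_of_mul h0)) h).symm
  · intro v _
    rcases node_cases (p := p) v with hv | hv | hv
    · have : var y v = var y' v := by
        unfold var; rw [omegaFiber_rigid_sq hleaf hy hy' hv]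
      rw [this]
    · simp [hv]
    · simp [edgeDeg_degenerate hF.1 hv]

end Identification

end BinaryTreeModel

/-! ### Triangular algebraic manifolds, and tangent cones of manifolds with corners. -/

section LocalGeometry

open Filter Topology

variable {ι : Type*}

section Triangular

variable (A : Finset ι) (R : ι → MvPolynomial ι ℝ)

/-- The points whose values `x_a R_a(x)`, `a ∈ A`, are prescribed up to finitely many choices. -/
def triangularSet (Z : Finset (ι → ℝ)) : Set (ι → ℝ) :=
  {x | ∃ z ∈ Z, ∀ a ∈ A, x a * MvPolynomial.eval x (R a) = z a}

theorem isRealVariety_triangularSet (Z : Finset (ι → ℝ)) :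
    IsRealVariety (triangularSet A R Z) := by
  -- One real polynomial suffices: a sum of squares imposes all equations for one value `z`, and the
  -- product over `z` gives the union.
  refine ⟨{∏ z ∈ Z, ∑ a ∈ A, (MvPolynomial.X a * R a - MvPolynomial.C (z a)) ^ 2}, ?_⟩
  ext x
  simp only [triangularSet, Set.mem_ofPred_eq, Set.mem_singleton_iff, forall_eq, map_prod, map_sum,
    map_pow, map_sub, map_mul, MvPolynomial.eval_X, MvPolynomial.eval_C, Finset.prod_eq_zero_iff]
  refine exists_congr fun z => and_congr_right fun _ => ?_
  rw [Finset.sum_eq_zero_iff_of_nonneg fun a _ => sq_nonneg _]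
  refine forall₂_congr fun a _ => ?_
  rw [pow_eq_zero_iff two_ne_zero, sub_eq_zero]

variable [Fintype ι]

theorem contDiff_mvPolynomial_eval (q : MvPolynomial ι ℝ) :
    ContDiff ℝ (⊤ : ℕ∞) fun x : ι → ℝ => MvPolynomial.eval x q := by
  induction q using MvPolynomial.induction_on with
  | C a => simpa using contDiff_const
  | add p q hp hq => simpa using hp.add hq
  | mul_X p i hp => simpa using hp.mul (contDiff_apply ℝ ℝ i)

/-- The points at which the coordinates `x_a R_a(x)`, `a ∈ A`, can be used instead of `x_a`. -/
def regularSet : Set (ι → ℝ) := {x | ∀ a ∈ A, MvPolynomial.eval x (R a) ≠ 0}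

theorem isOpen_regularSet : IsOpen (regularSet A R) := by
  have : regularSet A R = ⋂ a ∈ A, {x | MvPolynomial.eval x (R a) ≠ 0} := by
    ext x; simp [regularSet]
  rw [this]
  exact isOpen_biInter_finset fun a _ =>
    isOpen_ne_fun (contDiff_mvPolynomial_eval (R a)).continuous continuous_const

variable [DecidableEq ι]

/-- The change of coordinates that replaces `x_a` by `x_a R_a(x) - c_a` for `a ∈ A`, where `R_a`
only depends on the other coordinates. -/
noncomputable def triangularChart
    (hR : ∀ a ∈ A, ∀ x y : ι → ℝ, (∀ i, i ∉ A → x i = y i) →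
      MvPolynomial.eval x (R a) = MvPolynomial.eval y (R a)) (c : ι → ℝ) :
    OpenPartialHomeomorph (ι → ℝ) (ι → ℝ) where
  toFun x i := if i ∈ A then x i * MvPolynomial.eval x (R i) - c i else x i
  invFun z i := if i ∈ A then (z i + c i) / MvPolynomial.eval z (R i) else z i
  source := regularSet A R
  target := regularSet A R
  map_source' x hx a ha := by
    rw [hR a ha _ x fun i hi => if_neg hi]
    exact hx a ha
  map_target' z hz a ha := by
    rw [hR a ha _ z fun i hi => if_neg hi]
    exact hz a ha
  left_inv' x hx := by
    funext i
    by_cases hi : i ∈ A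
    · simp only [if_pos hi]
      rw [hR i hi _ x fun j hj => if_neg hj, sub_add_cancel, mul_div_cancel_right₀ _ (hx i hi)]
    · simp only [if_neg hi]
  right_inv' z hz := by
    funext i
    by_cases hi : i ∈ A
    · simp only [if_pos hi]
      rw [hR i hi _ z fun j hj => if_neg hj, div_mul_cancel₀ _ (hz i hi), add_sub_cancel_right]
    · simp only [if_neg hi]
  open_source := isOpen_regularSet A R
  open_target := isOpen_regularSet A R
  continuousOn_toFun := by
    refine continuousOn_pi.2 fun i => ?_
    split_ifs
    · exact (((continuous_apply i).mul
        (contDiff_mvPolynomial_eval (R i)).continuous).sub continuous_const).continuousOn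
    · exact (continuous_apply i).continuousOn
  continuousOn_invFun := by
    refine continuousOn_pi.2 fun i => ?_
    split_ifs with hi
    · exact ((continuous_apply i).add continuous_const).continuousOn.div
        (contDiff_mvPolynomial_eval (R i)).continuous.continuousOn fun x hx => hx i hi
    · exact (continuous_apply i).continuousOn

theorem isSmoothChart_triangularChart
    (hR : ∀ a ∈ A, ∀ x y : ι → ℝ, (∀ i, i ∉ A → x i = y i) →
      MvPolynomial.eval x (R a) = MvPolynomial.eval y (R a)) (c : ι → ℝ) :
    IsSmoothChart (triangularChart A R hR c) := by
  constructor
  · refine contDiffOn_pi.2 fun i => ?_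
    simp only [triangularChart]
    change ContDiffOn ℝ _ (fun x : ι → ℝ =>
      if i ∈ A then x i * MvPolynomial.eval x (R i) - c i else x i) _
    split_ifs
    · exact (((contDiff_apply ℝ ℝ i).mul (contDiff_mvPolynomial_eval (R i))).sub
        contDiff_const).contDiffOn
    · exact (contDiff_apply ℝ ℝ i).contDiffOn
  · refine contDiffOn_pi.2 fun i => ?_
    change ContDiffOn ℝ _ (fun z : ι → ℝ =>
      if i ∈ A then (z i + c i) / MvPolynomial.eval z (R i) else z i) (regularSet A R)
    split_ifs with hi
    · exact ((contDiff_apply ℝ ℝ i).add contDiff_const).contDiffOn.div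
        (contDiff_mvPolynomial_eval (R i)).contDiffOn fun x hx => hx i hi
    · exact (contDiff_apply ℝ ℝ i).contDiffOn

theorem isSmoothSubmanifold_triangularSet (Z : Finset (ι → ℝ))
    (hR : ∀ a ∈ A, ∀ x y : ι → ℝ, (∀ i, i ∉ A → x i = y i) →
      MvPolynomial.eval x (R a) = MvPolynomial.eval y (R a))
    (hreg : triangularSet A R Z ⊆ regularSet A R) :
    IsSmoothSubmanifold (triangularSet A R Z) := by
  refine ⟨Fintype.card ι - A.card, fun x hx => ?_⟩
  let Φ : (ι → ℝ) → ι → ℝ := fun y a => y a * MvPolynomial.eval y (R a)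
  have hΦ : ∀ a, Continuous fun y => Φ y a := fun a =>
    (continuous_apply a).mul (contDiff_mvPolynomial_eval (R a)).continuous
  -- On this neighbourhood of `x` the prescribed values other than those of `x` are not attained, so
  -- the set coincides locally with a single level set.
  let O : Set (ι → ℝ) :=
    ⋂ z ∈ Z.filter fun z => ∃ a ∈ A, Φ x a ≠ z a, ⋃ a ∈ A, {y | Φ y a ≠ z a}
  have hO : IsOpen O := isOpen_biInter_finset fun z _ => isOpen_biUnion fun a _ =>
    isOpen_ne_fun (hΦ a) continuous_const
  have hmem : ∀ y, y ∈ O ↔ ∀ z ∈ Z, (∃ a ∈ A, Φ x a ≠ z a) → ∃ a ∈ A, Φ y a ≠ z a := by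
    intro y
    simp [O]
  let φ := (triangularChart A R hR (Φ x)).restrOpen O hO
  have hφ := isSmoothChart_triangularChart A R hR (Φ x)
  refine ⟨φ, ⟨hφ.1.mono Set.inter_subset_left, hφ.2.mono Set.inter_subset_left⟩,
    ⟨hreg hx, (hmem x).2 fun z _ h => h⟩, A, ?_, ?_⟩
  · have := Finset.card_le_univ A
    omega
  · rintro y ⟨-, hyO⟩
    rw [hmem] at hyO
    have hval : ∀ i ∈ A, φ y i = Φ y i - Φ x i := fun i hi => if_pos hi
    constructor
    · rintro ⟨z, hz, hyz⟩ i hi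
      rw [hval i hi, hyz i hi |> (show Φ y i = z i from ·), sub_eq_zero]
      by_contra hne
      obtain ⟨a, ha, h⟩ := hyO z hz ⟨i, hi, Ne.symm hne⟩
      exact h (hyz a ha)
    · intro h
      obtain ⟨z, hz, hxz⟩ := hx
      refine ⟨z, hz, fun a ha => ?_⟩
      have := h a ha
      rw [hval a ha, sub_eq_zero] at this
      exact this.trans (hxz a ha)

end Triangular

variable [Fintype ι]

theorem IsSubmanifoldNear.isManifoldWithCornersNear {S : Set (ι → ℝ)} {d : ℕ} {x : ι → ℝ}
    (h : IsSubmanifoldNear S d x) : IsManifoldWithCornersNear S x := by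
  obtain ⟨φ, hφ, hx, A, -, hS⟩ := h
  exact ⟨φ, hφ, hx, A, ∅, fun y hy => by simpa using hS y hy⟩

theorem tendsto_slope_of_hasFDerivAt {f : (ι → ℝ) → ι → ℝ} {L : (ι → ℝ) →L[ℝ] ι → ℝ}
    {x : ι → ℝ} (hf : HasFDerivAt f L x) (d : ι → ℝ) (i : ι) :
    Tendsto (fun s : ℝ => s⁻¹ * (f (x + s • d) i - f x i)) (𝓝[>] 0) (𝓝 (L d i)) := by
  have h := (hf.hasLineDerivAt d).tendsto_slope_zero_right
  have h' := (continuous_apply i).continuousAt.tendsto.comp h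
  refine h'.congr fun s => ?_
  simp

/-- The one-sided tangent directions of a manifold with corners form a convex cone, so that the
sum of finitely many of them is tangent to a curve in the manifold. -/
theorem IsManifoldWithCornersNear.exists_mem_ne {S : Set (ι → ℝ)} {x : ι → ℝ}
    (h : IsManifoldWithCornersNear S x) (hxS : x ∈ S) {κ : Type*} (K : Finset κ)
    (d : κ → ι → ℝ) (hd : ∀ c ∈ K, ∀ᶠ s : ℝ in 𝓝[>] 0, x + s • d c ∈ S)
    {N : Set (ι → ℝ)} (hN : N ∈ 𝓝 x) :
    ∃ y ∈ S ∩ N, ∀ i, (∑ c ∈ K, d c) i ≠ 0 → y i ≠ x i := by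
  obtain ⟨φ, ⟨hφ, hφ'⟩, hx, A, B, hS⟩ := h
  have htop : ((⊤ : ℕ∞) : WithTop ℕ∞) ≠ 0 := by simp
  have hL : HasFDerivAt φ (fderiv ℝ φ x) x :=
    ((hφ.contDiffAt (φ.open_source.mem_nhds hx)).differentiableAt htop).hasFDerivAt
  have hφx := φ.map_source hx
  have hL' : HasFDerivAt φ.symm (fderiv ℝ φ.symm (φ x)) (φ x) :=
    ((hφ'.contDiffAt (φ.open_target.mem_nhds hφx)).differentiableAt htop).hasFDerivAt
  set L := fderiv ℝ φ x
  set L' := fderiv ℝ φ.symm (φ x)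
  have hLL : ∀ w, L' (L w) = w := by
    intro w
    have h1 := hL'.comp x hL
    have h2 : HasFDerivAt (φ.symm ∘ φ) (ContinuousLinearMap.id ℝ (ι → ℝ)) x :=
      (hasFDerivAt_id x).congr_of_eventuallyEq (φ.eventually_left_inverse hx)
    exact DFunLike.congr_fun (h1.unique h2) w
  have hline : ∀ w : ι → ℝ, Tendsto (fun s : ℝ => x + s • w) (𝓝[>] 0) (𝓝 x) := by
    intro w
    have : Continuous fun s : ℝ => x + s • w := by fun_prop
    have h1 := this.tendsto 0
    simp only [zero_smul, add_zero] at h1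
    exact h1.mono_left nhdsWithin_le_nhds
  have hxS' := (hS x hx).1 hxS
  have hev : ∀ c ∈ K, ∀ᶠ s : ℝ in 𝓝[>] 0, (∀ i ∈ A, φ (x + s • d c) i = 0) ∧
      ∀ i ∈ B, 0 ≤ φ (x + s • d c) i := by
    intro c hc
    filter_upwards [hd c hc, hline (d c) (φ.open_source.mem_nhds hx)] with s hs hs'
    exact (hS _ hs').1 hs
  -- The conditions on the image of a tangent direction in the chart are linear equations, and
  -- inequalities only at active constraints. Both are stable under sums.
  have hA : ∀ i ∈ A, L (∑ c ∈ K, d c) i = 0 := by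
    intro i hi
    rw [map_sum, Finset.sum_apply]
    refine Finset.sum_eq_zero fun c hc => ?_
    refine tendsto_nhds_unique (tendsto_slope_of_hasFDerivAt hL (d c) i) ?_
    refine tendsto_const_nhds.congr' ?_
    filter_upwards [hev c hc] with s hs
    rw [hs.1 i hi, hxS'.1 i hi]
    simp
  have hB : ∀ i ∈ B, φ x i = 0 → 0 ≤ L (∑ c ∈ K, d c) i := by
    intro i hi h0
    rw [map_sum, Finset.sum_apply]
    refine Finset.sum_nonneg fun c hc => ?_
    refine ge_of_tendsto (tendsto_slope_of_hasFDerivAt hL (d c) i) ?_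
    filter_upwards [hev c hc, self_mem_nhdsWithin] with s hs hs0
    rw [h0, sub_zero]
    exact mul_nonneg (inv_nonneg.2 (le_of_lt hs0)) (hs.2 i hi)
  -- The straight ray in the direction `w` stays in the model corner for small parameters. Its
  -- preimage is a curve in `S` with initial velocity the sum of the `d c`, hence moves every
  -- coordinate in which this sum is nonzero.
  set w := L (∑ c ∈ K, d c) with hw
  have hcurve : Tendsto (fun s : ℝ => φ x + s • w) (𝓝[>] 0) (𝓝 (φ x)) := by
    have : Continuous fun s : ℝ => φ x + s • w := by fun_prop
    have h1 := this.tendsto 0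
    simp only [zero_smul, add_zero] at h1
    exact h1.mono_left nhdsWithin_le_nhds
  have hmemS : ∀ᶠ s : ℝ in 𝓝[>] 0, φ.symm (φ x + s • w) ∈ S := by
    have hBpos : ∀ᶠ s : ℝ in 𝓝[>] 0, ∀ i ∈ B, 0 ≤ (φ x + s • w) i := by
      rw [Filter.eventually_all_finset]
      intro i hi
      rcases (hxS'.2 i hi).eq_or_lt with h0 | h0
      · filter_upwards [self_mem_nhdsWithin] with s hs
        simp only [Pi.add_apply, Pi.smul_apply, smul_eq_mul, ← h0, zero_add]
        exact mul_nonneg (le_of_lt hs) (hB i hi h0.symm)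
      · have := ((continuous_apply i).tendsto (φ x)).comp hcurve
        filter_upwards [this.eventually (lt_mem_nhds h0)] with s hs using le_of_lt hs
    filter_upwards [hBpos, hcurve (φ.open_target.mem_nhds hφx)] with s hs hst
    rw [hS _ (φ.map_target hst), φ.right_inv hst]
    refine ⟨fun i hi => ?_, hs⟩
    simp [hxS'.1 i hi, hA i hi]
  have hmemN : ∀ᶠ s : ℝ in 𝓝[>] 0, φ.symm (φ x + s • w) ∈ N := by
    have h1 := hL'.continuousAt.tendsto.comp hcurve
    rw [φ.left_inv hx] at h1
    exact h1 hN
  have hne : ∀ᶠ s : ℝ in 𝓝[>] 0, ∀ i, (∑ c ∈ K, d c) i ≠ 0 →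
      φ.symm (φ x + s • w) i ≠ x i := by
    rw [Filter.eventually_all]
    intro i
    by_cases hi : (∑ c ∈ K, d c) i = 0
    · exact Eventually.of_forall fun s h => absurd hi h
    · have h1 := tendsto_slope_of_hasFDerivAt hL' w i
      rw [hw, hLL, φ.left_inv hx] at h1
      filter_upwards [h1.eventually_ne hi] with s hs _ h
      rw [← hw] at hs
      rw [h] at hs
      simp at hs
  obtain ⟨s, ⟨hs1, hs2⟩, hs3⟩ := ((hmemS.and hmemN).and hne).exists
  exact ⟨_, ⟨hs1, hs2⟩, hs3⟩

end LocalGeometry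

namespace BinaryTreeModel

/-! ### The strata of the fiber. -/

section Main

variable {V : Type*} {T : BinaryTreeModel V} [Fintype V] [DecidableEq V]
  {p : (T.Leaf → Bool) → ℝ}

open Classical in
/-- The coordinates that are prescribed up to finitely many choices on a component. -/
noncomputable def pivots (p : (T.Leaf → Bool) → ℝ) (S : Finset (V ⊕ T.Edge)) :
    Finset (V ⊕ T.Edge) :=
  S ∪ Finset.univ.filter (Sum.elim (T.IsRigid p) fun e => e ∈ T.linked p ∧ chainRep p e = e)

theorem inl_mem_pivots {S : Finset (V ⊕ T.Edge)} {v : V} :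
    Sum.inl v ∈ pivots p S ↔ Sum.inl v ∈ S ∨ T.IsRigid p v := by
  simp [pivots]

theorem inr_mem_pivots {S : Finset (V ⊕ T.Edge)} {e : T.Edge} :
    Sum.inr e ∈ pivots p S ↔ Sum.inr e ∈ S ∨ (e ∈ T.linked p ∧ chainRep p e = e) := by
  simp [pivots]

/-- The product of the variances of the top nodes attached to an edge, as a polynomial. -/
noncomputable def topPoly (p : (T.Leaf → Bool) → ℝ) (e : T.Edge) : MvPolynomial (V ⊕ T.Edge) ℝ :=
  ∏ v ∈ topNodes p e, MvPolynomial.C (1 / 4) * (1 - MvPolynomial.X (Sum.inl v) ^ 2)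

theorem eval_topPoly (e : T.Edge) (y : T.Param) :
    MvPolynomial.eval y (topPoly p e) = ∏ v ∈ topNodes p e, var y v := by
  simp only [topPoly, map_prod, map_mul, map_sub, map_pow, map_one, MvPolynomial.eval_C,
    MvPolynomial.eval_X]
  refine Finset.prod_congr rfl fun v _ => ?_
  unfold var
  ring

open Classical in
/-- The cofactor of a pivot coordinate: for the representative of a chain, the remaining factors of
the chain product. -/
noncomputable def cofactor (p : (T.Leaf → Bool) → ℝ) :
    V ⊕ T.Edge → MvPolynomial (V ⊕ T.Edge) ℝ
  | Sum.inl _ => 1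
  | Sum.inr e => if e ∈ T.linked p ∧ chainRep p e = e then
      topPoly p e * ∏ f ∈ (chain p e).erase e, MvPolynomial.X (Sum.inr f) * topPoly p f
    else 1

theorem mul_eval_cofactor {e : T.Edge} (he : e ∈ T.linked p) (hr : chainRep p e = e)
    (y : T.Param) :
    y (Sum.inr e) * MvPolynomial.eval y (cofactor p (Sum.inr e)) = chainProd p e y := by
  have hmem : e ∈ chain p e := Finset.mem_filter.2 ⟨he, hr⟩
  rw [cofactor, if_pos ⟨he, hr⟩, chainProd, ← Finset.mul_prod_erase _ _ hmem]
  simp only [map_mul, map_prod, eval_topPoly, MvPolynomial.eval_X, scaledEdge]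
  ring

theorem mul_eval_cofactor_of_not {e : T.Edge} (he : e ∉ T.linked p) (y : T.Param) :
    y (Sum.inr e) * MvPolynomial.eval y (cofactor p (Sum.inr e)) = y (Sum.inr e) := by
  rw [cofactor, if_neg fun h => he h.1]
  simp

theorem mul_eval_cofactor_inl (v : V) (y : T.Param) :
    y (Sum.inl v) * MvPolynomial.eval y (cofactor p (Sum.inl v)) = y (Sum.inl v) := by
  simp [cofactor]

theorem isPassing_of_mem_topNodes {v : V} {e : T.Edge} (h : v ∈ topNodes p e) :
    T.IsPassing p v := (Finset.mem_filter.1 h).2.1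

theorem IsPassing.notMem_degenerateNodes {v : V} (h : T.IsPassing p v) :
    v ∉ T.degenerateNodes p := fun hd => by
  have h1 := (mem_degenerateNodes_iff.1 hd).2
  have h2 := h.2
  omega

/-- Cofactors involve only passing nodes and linked edges that do not represent their chain. Neither
kind is a pivot, as `S` consists of degenerate nodes and isolated edges. -/
theorem eval_cofactor_congr {S : Finset (V ⊕ T.Edge)} (hS : ∀ c ∈ S, T.IsDegenerateCoord p c)
    {a : V ⊕ T.Edge} {x y : T.Param} (hxy : ∀ i, i ∉ pivots p S → x i = y i) :
    MvPolynomial.eval x (cofactor p a) = MvPolynomial.eval y (cofactor p a) := by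
  have htop : ∀ e : T.Edge,
      MvPolynomial.eval x (topPoly p e) = MvPolynomial.eval y (topPoly p e) := by
    intro e
    rw [eval_topPoly, eval_topPoly]
    refine Finset.prod_congr rfl fun v hv => ?_
    have hp := isPassing_of_mem_topNodes hv
    unfold var
    rw [hxy (Sum.inl v)]
    rw [inl_mem_pivots]
    rintro (h | h)
    · exact hp.notMem_degenerateNodes (hS _ h)
    · exact hp.not_isRigid h
  cases a with
  | inl v => simp [cofactor]
  | inr e =>
    simp only [cofactor]
    split_ifs with he
    · simp only [map_mul, map_prod, MvPolynomial.eval_X, htop]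
      congr 1
      refine Finset.prod_congr rfl fun f hf => ?_
      rw [hxy (Sum.inr f)]
      rw [Finset.mem_erase, chain, Finset.mem_filter] at hf
      rw [inr_mem_pivots]
      rintro (h | h)
      · exact hS _ h hf.2.1
      · exact hf.1 (h.2.symm.trans hf.2.2)
    · simp

/-- The part of the fiber that vanishes on `S`. -/
def fiberPart (p : (T.Leaf → Bool) → ℝ) (S : Finset (V ⊕ T.Edge)) : Set T.Param :=
  {y ∈ T.omegaFiber p | VanishesOn y S}

/-- The values of the pivot functions. -/
noncomputable def pivotValue (p : (T.Leaf → Bool) → ℝ) (S : Finset (V ⊕ T.Edge)) (y : T.Param) :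
    T.Param :=
  fun a => if a ∈ pivots p S then y a * MvPolynomial.eval y (cofactor p a) else 0

theorem finite_pivotValue
    (hleaf : ∀ i : T.Leaf, T.leafMean p i * (1 - T.leafMean p i) ≠ 0)
    {S : Finset (V ⊕ T.Edge)} (hS : ∀ c ∈ S, T.IsDegenerateCoord p c) :
    (pivotValue p S '' fiberPart p S).Finite := by
  rcases (fiberPart p S).eq_empty_or_nonempty with h | ⟨y₀, hy₀⟩
  · simp [h]
  refine (Set.Finite.pi' fun a => Set.toFinite {pivotValue p S y₀ a, -pivotValue p S y₀ a}).subset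
    ?_
  rintro _ ⟨y, hy, rfl⟩ a
  rw [Set.mem_insert_iff, Set.mem_singleton_iff, ← sq_eq_sq_iff_eq_or_eq_neg]
  unfold pivotValue
  split_ifs with ha
  · cases a with
    | inl v =>
      rw [mul_eval_cofactor_inl, mul_eval_cofactor_inl]
      rcases inl_mem_pivots.1 ha with h | h
      · exact (hy.2 _ h).trans (hy₀.2 _ h).symm
      · exact omegaFiber_rigid_sq hleaf hy.1 hy₀.1 h
    | inr e =>
      rcases inr_mem_pivots.1 ha with h | h
      · rw [mul_eval_cofactor_of_not (hS _ h), mul_eval_cofactor_of_not (hS _ h),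
          show y (Sum.inr e) = 0 from hy.2 _ h, show y₀ (Sum.inr e) = 0 from hy₀.2 _ h]
      · rw [mul_eval_cofactor h.1 h.2, mul_eval_cofactor h.1 h.2]
        exact omegaFiber_chainProd_sq hleaf hy.1 hy₀.1 e
  · rfl

/-- The algebraic manifold belonging to a cutset. -/
noncomputable def stratum (hleaf : ∀ i : T.Leaf, T.leafMean p i * (1 - T.leafMean p i) ≠ 0)
    (S : Finset (V ⊕ T.Edge)) (hS : T.IsCutset p S) : Set T.Param :=
  triangularSet (pivots p S) (cofactor p) (finite_pivotValue hleaf hS.1).toFinset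

variable {hleaf : ∀ i : T.Leaf, T.leafMean p i * (1 - T.leafMean p i) ≠ 0}
  {S : Finset (V ⊕ T.Edge)} {hS : T.IsCutset p S}

theorem mem_stratum {y : T.Param} : y ∈ stratum hleaf S hS ↔
    ∃ ω ∈ T.omegaFiber p, VanishesOn ω S ∧ ∀ a ∈ pivots p S,
      y a * MvPolynomial.eval y (cofactor p a) = ω a * MvPolynomial.eval ω (cofactor p a) := by
  simp only [stratum, triangularSet, Set.mem_ofPred_eq, Set.Finite.mem_toFinset, Set.mem_image]
  constructor
  · rintro ⟨_, ⟨ω, hω, rfl⟩, h⟩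
    refine ⟨ω, hω.1, hω.2, fun a ha => ?_⟩
    rw [h a ha, pivotValue, if_pos ha]
  · rintro ⟨ω, hω, hωS, h⟩
    refine ⟨_, ⟨ω, ⟨hω, hωS⟩, rfl⟩, fun a ha => ?_⟩
    rw [h a ha, pivotValue, if_pos ha]

theorem mem_stratum_of_mem {y : T.Param} (hy : y ∈ T.omegaFiber p) (hyS : VanishesOn y S) :
    y ∈ stratum hleaf S hS :=
  mem_stratum.2 ⟨y, hy, hyS, fun _ _ => rfl⟩

theorem vanishesOn_of_mem_stratum {y : T.Param} (hy : y ∈ stratum hleaf S hS) :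
    VanishesOn y S := by
  obtain ⟨ω, -, hωS, h⟩ := mem_stratum.1 hy
  intro c hc
  have h1 := h c (Finset.mem_union_left _ hc)
  have h2 := hωS c hc
  cases c with
  | inl v =>
    rw [mul_eval_cofactor_inl, mul_eval_cofactor_inl] at h1
    change y (Sum.inl v) ^ 2 = 1
    rw [h1]
    exact h2
  | inr e =>
    rw [mul_eval_cofactor_of_not (hS.1 _ hc), mul_eval_cofactor_of_not (hS.1 _ hc)] at h1
    exact h1.trans h2

/-- The pivot functions agree with those of a point of the fiber vanishing on the same cutset, so
the leaf laws agree by `marginal_eq_of_agree`. -/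
theorem mem_omegaFiber_of_mem_stratum {y : T.Param} (hy : y ∈ stratum hleaf S hS)
    (hyΩ : y ∈ T.omegaSpace) : y ∈ T.omegaFiber p := by
  have hyS := vanishesOn_of_mem_stratum hy
  obtain ⟨ω, hω, hωS, h⟩ := mem_stratum.1 hy
  rw [mem_omegaFiber] at hω ⊢
  refine ⟨hyΩ, (marginal_eq_of_agree hyΩ hω.1 hS hS hyS hωS (fun v hv => ?_)
    fun r hr hrr => ?_).trans hω.2⟩
  · have := h _ (inl_mem_pivots.2 (Or.inr hv))
    rwa [mul_eval_cofactor_inl, mul_eval_cofactor_inl] at this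
  · have := h _ (inr_mem_pivots.2 (Or.inr ⟨hr, hrr⟩))
    rwa [mul_eval_cofactor hr hrr, mul_eval_cofactor hr hrr] at this

theorem isRealVariety_stratum : IsRealVariety (stratum hleaf S hS) :=
  isRealVariety_triangularSet _ _ _

/-- A chain product on the stratum equals one taken at a point of the fiber, where it is nonzero;
hence the cofactor is nonzero as well. -/
theorem isSmoothSubmanifold_stratum : IsSmoothSubmanifold (stratum hleaf S hS) := by
  refine isSmoothSubmanifold_triangularSet _ _ _
    (fun a _ x y hxy => eval_cofactor_congr hS.1 hxy) fun y hy a ha => ?_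
  obtain ⟨ω, hω, hωS, h⟩ := (mem_stratum (hleaf := hleaf) (hS := hS)).1 hy
  cases a with
  | inl v => simp [cofactor]
  | inr e =>
    by_cases he : e ∈ T.linked p ∧ chainRep p e = e
    · have h1 := h _ ha
      rw [mul_eval_cofactor he.1 he.2 ω] at h1
      have h2 := chainProd_ne_zero hω e
      rw [← h1] at h2
      exact right_ne_zero_of_mul h2
    · rw [cofactor, if_neg he]
      simp

open Classical in
/-- All the isolated edges and degenerate nodes. -/
noncomputable def fullCutset (T : BinaryTreeModel V) (p : (T.Leaf → Bool) → ℝ) :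
    Finset (V ⊕ T.Edge) :=
  Finset.univ.filter (T.IsDegenerateCoord p)

theorem mem_fullCutset {c : V ⊕ T.Edge} : c ∈ T.fullCutset p ↔ T.IsDegenerateCoord p c := by
  simp [fullCutset]

theorem isCutset_fullCutset : T.IsCutset p (T.fullCutset p) := by
  refine ⟨fun c hc => mem_fullCutset.1 hc, fun F _ hF => ?_⟩
  obtain ⟨e, he, hel⟩ := Finset.not_subset.1 hF
  exact Or.inl ⟨e, he, mem_fullCutset.2 hel⟩

theorem mem_deepestSingularity {y : T.Param} :
    y ∈ T.deepestSingularity p ↔ y ∈ T.omegaFiber p ∧ VanishesOn y (T.fullCutset p) := by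
  refine and_congr_right fun _ => ⟨fun h c hc => ?_, fun h => ⟨fun e he => ?_, fun v hv => ?_⟩⟩
  · rw [mem_fullCutset] at hc
    cases c with
    | inl v => exact h.2 v hc
    | inr e => exact h.1 e (notMem_linked_iff.1 hc)
  · exact h (Sum.inr e) (mem_fullCutset.2 (notMem_linked_iff.2 he))
  · exact h (Sum.inl v) (mem_fullCutset.2 hv)

theorem Edge.Inc.notMem_degenerateNodes {e : T.Edge} {v : V} (hv : e.Inc v)
    (he : e ∈ T.linked p) : v ∉ T.degenerateNodes p := fun hd => by
  have h1 := edgeDeg_pos he hv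
  have h2 := (mem_degenerateNodes_iff.1 hd).2
  omega

/-- A point of the parameter space that differs from a point of the fiber only at isolated edges
and degenerate nodes lies in the fiber if it vanishes on a cutset. -/
theorem mem_omegaFiber_of_agree
    (hleaf : ∀ i : T.Leaf, T.leafMean p i * (1 - T.leafMean p i) ≠ 0) {ω z : T.Param}
    (hω : ω ∈ T.omegaFiber p) (hz : z ∈ T.omegaSpace) (hS : T.IsCutset p S)
    (hzS : VanishesOn z S) (h : ∀ c, ¬ T.IsDegenerateCoord p c → z c = ω c) :
    z ∈ T.omegaFiber p := by
  have hω' := mem_omegaFiber.1 hω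
  refine mem_omegaFiber.2 ⟨hz, (marginal_eq_of_agree hz hω'.1 hS (isCutset_zeroSet hleaf hω) hzS
    vanishesOn_zeroSet (fun v hv => h _ fun hd => ?_) fun r _ _ => ?_).trans hω'.2⟩
  · rw [IsDegenerateCoord, mem_degenerateNodes_iff] at hd
    rcases hv with hv | hv
    · exact hd.1 hv
    · omega
  · refine Finset.prod_congr rfl fun e he => ?_
    have hel : e ∈ T.linked p := (Finset.mem_filter.1 he).1
    unfold scaledEdge
    rw [h (Sum.inr e) fun hd => hd hel]
    congr 1
    refine Finset.prod_congr rfl fun v hv => ?_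
    unfold var
    rw [h (Sum.inl v) (isPassing_of_mem_topNodes hv).notMem_degenerateNodes]

theorem mem_omegaSpace_iff {z : T.Param} : z ∈ T.omegaSpace ↔ mean z T.root ∈ Set.Icc (0 : ℝ) 1 ∧
    ∀ (e : T.Edge) (a : Bool),
      mean z e.tgt + z (Sum.inr e) * (bit a - mean z e.src) ∈ Set.Icc (0 : ℝ) 1 :=
  mem_omegaSpace

/-- Linked edges have nondegenerate ends, so their constraints are unchanged; an isolated edge with
η = 0 only asks for a mean in the unit interval. -/
theorem mem_omegaSpace_of_agree {ω z : T.Param} (hω : ω ∈ T.omegaSpace)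
    (h : ∀ c, ¬ T.IsDegenerateCoord p c → z c = ω c) (hm : ∀ v, mean z v ∈ Set.Icc (0 : ℝ) 1)
    (hz : ∀ e, e ∉ T.linked p → z (Sum.inr e) = 0 ∨ ∀ a : Bool,
      mean z e.tgt + z (Sum.inr e) * (bit a - mean z e.src) ∈ Set.Icc (0 : ℝ) 1) :
    z ∈ T.omegaSpace := by
  refine mem_omegaSpace_iff.2 ⟨hm _, fun e a => ?_⟩
  by_cases he : e ∈ T.linked p
  · have h1 : mean z e.tgt = mean ω e.tgt := by
      unfold mean
      rw [h (Sum.inl e.tgt) (Edge.Inc.notMem_degenerateNodes (Or.inr rfl) he)]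
    have h2 : mean z e.src = mean ω e.src := by
      unfold mean
      rw [h (Sum.inl e.src) (Edge.Inc.notMem_degenerateNodes (Or.inl rfl) he)]
    rw [h1, h2, h (Sum.inr e) fun hd => hd he]
    exact (mem_omegaSpace_iff.1 hω).2 e a
  · rcases hz e he with h0 | h0
    · rw [h0, zero_mul, add_zero]
      exact hm _
    · exact h0 a

theorem deepestSingularity_nonempty
    (hleaf : ∀ i : T.Leaf, T.leafMean p i * (1 - T.leafMean p i) ≠ 0)
    (hp : (T.omegaFiber p).Nonempty) : (T.deepestSingularity p).Nonempty := by
  classical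
  obtain ⟨ω, hω⟩ := hp
  have hωΩ := (mem_omegaFiber.1 hω).1
  -- The dependence along isolated edges is switched off, and the degenerate nodes are made
  -- constant.
  let z : T.Param := fun c => if T.IsDegenerateCoord p c then Sum.elim 1 0 c else ω c
  have hz : ∀ c, ¬ T.IsDegenerateCoord p c → z c = ω c := fun c hc => if_neg hc
  have hzS : VanishesOn z (T.fullCutset p) := by
    intro c hc
    rw [mem_fullCutset] at hc
    cases c with
    | inl v =>
      change z (Sum.inl v) ^ 2 = 1
      simp [z, hc]
    | inr e =>
      change z (Sum.inr e) = 0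
      simp [z, hc]
  have hzΩ : z ∈ T.omegaSpace := by
    refine mem_omegaSpace_of_agree hωΩ hz (fun v => ?_) fun e he =>
      Or.inl (hzS (Sum.inr e) (mem_fullCutset.2 he))
    by_cases hv : T.IsDegenerateCoord p (Sum.inl v)
    · simp [mean, z, hv]
    · have : mean z v = mean ω v := by unfold mean; rw [hz _ hv]
      rw [this]
      exact mean_mem_Icc hωΩ v
  exact ⟨z, mem_deepestSingularity.2
    ⟨mem_omegaFiber_of_agree hleaf hω hzΩ isCutset_fullCutset hzS hz, hzS⟩⟩

/-! ### Singularity at the deepest points. -/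

section Singular

open Filter Topology

variable {ω : T.Param}

open Classical in
/-- The degenerate nodes and the isolated edges that touch a degenerate node. -/
noncomputable def contactCoords (T : BinaryTreeModel V) (p : (T.Leaf → Bool) → ℝ) :
    Finset (V ⊕ T.Edge) :=
  Finset.univ.filter (Sum.elim (· ∈ T.degenerateNodes p)
    fun e => ∃ v ∈ T.degenerateNodes p, e.Inc v)

theorem inl_mem_contactCoords {v : V} :
    Sum.inl v ∈ T.contactCoords p ↔ v ∈ T.degenerateNodes p := by
  simp [contactCoords]

theorem inr_mem_contactCoords {e : T.Edge} :
    Sum.inr e ∈ T.contactCoords p ↔ ∃ v ∈ T.degenerateNodes p, e.Inc v := by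
  simp [contactCoords]

/-- Every cutset contains one of the coordinates in `contactCoords`. -/
theorem IsCutset.exists_contact [Nontrivial V] (hS : T.IsCutset p S)
    (hdeg : (T.degenerateNodes p).Nonempty) : ∃ c ∈ S, c ∈ T.contactCoords p := by
  classical
  -- The forest together with all edges at degenerate nodes is leaf-closed: a degenerate node has
  -- its full degree, and the other inner nodes already have degree at least two in the forest.
  -- Where a cutset meets this set, the coordinate is a contact coordinate.
  let F : Finset T.Edge :=
    Finset.univ.filter fun e => e ∈ T.linked p ∨ ∃ v ∈ T.degenerateNodes p, e.Inc v
  have hlF : T.linked p ⊆ F := fun e he => by simp [F, he]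
  have hFc : LeafClosed F := by
    intro v hv
    by_contra hl
    by_cases hd : v ∈ T.degenerateNodes p
    · have h1 : edgeDeg F v = edgeDeg (Finset.univ : Finset T.Edge) v := by
        unfold edgeDeg
        congr 1
        ext e
        simp only [Finset.mem_filter, Finset.mem_univ, true_and, F]
        exact ⟨fun h => h.2, fun h => ⟨Or.inr ⟨v, hd, h⟩, h⟩⟩
      exact hl (isLeaf_iff.2 (h1 ▸ hv))
    · rw [mem_degenerateNodes_iff, not_and] at hd
      have h1 := two_le_edgeDeg_linked (p := p) hl (Nat.pos_of_ne_zero (hd hl))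
      have h2 := edgeDeg_mono hlF v
      omega
  have hFl : ¬ F ⊆ T.linked p := by
    obtain ⟨v, hv⟩ := hdeg
    obtain ⟨e, -, he⟩ := exists_inc_of_edgeDeg (edgeDeg_univ_pos (T := T) v)
    intro h
    refine he.notMem_degenerateNodes (h ?_) hv
    simp only [F, Finset.mem_filter, Finset.mem_univ, true_and]
    exact Or.inr ⟨v, hv, he⟩
  rcases hS.2 F hFc hFl with ⟨e, he, heS⟩ | ⟨v, -, hvS⟩
  · refine ⟨_, heS, inr_mem_contactCoords.2 ?_⟩
    simp only [F, Finset.mem_filter, Finset.mem_univ, true_and] at he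
    exact he.resolve_left (hS.1 _ heS)
  · exact ⟨_, hvS, inl_mem_contactCoords.2 (hS.1 _ hvS)⟩

open Classical in
/-- Directions that point from a deepest singularity into the fiber. -/
noncomputable def fiberDirection (p : (T.Leaf → Bool) → ℝ) (ω : T.Param) :
    V ⊕ T.Edge → T.Param
  | Sum.inl v => Pi.single (Sum.inl v) (-ω (Sum.inl v))
  -- A constant head admits no dependence, so its mean must move along with η_e. With the factor 1/2
  -- the shift of the mean is as large as η_e and keeps the conditional probabilities in the unit
  -- interval.
  | Sum.inr e => if e.tgt ∈ T.degenerateNodes p then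
      Pi.single (Sum.inr e) (1 / 2) + Pi.single (Sum.inl e.tgt) (-ω (Sum.inl e.tgt))
    else Pi.single (Sum.inr e) 1

theorem deepest_sq (hω : ω ∈ T.deepestSingularity p) {v : V} (hv : v ∈ T.degenerateNodes p) :
    ω (Sum.inl v) ^ 2 = 1 :=
  hω.2.2 v hv

theorem mean_shrink (hω : ω ∈ T.deepestSingularity p) {v : V} (hv : v ∈ T.degenerateNodes p)
    {z : T.Param} {s : ℝ} (hz : z (Sum.inl v) = ω (Sum.inl v) + s * -ω (Sum.inl v)) :
    mean z v = s / 2 ∨ mean z v = 1 - s / 2 := by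
  have h1 : ω (Sum.inl v) ^ 2 = 1 ^ 2 := by rw [deepest_sq hω hv, one_pow]
  unfold mean
  rw [hz]
  rcases sq_eq_sq_iff_eq_or_eq_neg.1 h1 with h | h <;> rw [h]
  · left; ring
  · right; ring

theorem mean_shrink_mem_Icc (hω : ω ∈ T.deepestSingularity p) {v : V}
    (hv : v ∈ T.degenerateNodes p) {z : T.Param} {s : ℝ} (hs0 : 0 < s) (hs1 : s < 1)
    (hz : z (Sum.inl v) = ω (Sum.inl v) + s * -ω (Sum.inl v))
    (hzo : ∀ u, u ≠ v → z (Sum.inl u) = ω (Sum.inl u)) (u : V) :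
    mean z u ∈ Set.Icc (0 : ℝ) 1 := by
  by_cases hu : u = v
  · subst hu
    rcases mean_shrink hω hv hz with h | h <;> rw [h] <;> constructor <;> linarith
  · have : mean z u = mean ω u := by unfold mean; rw [hzo u hu]
    rw [this]
    exact mean_mem_Icc (mem_omegaFiber.1 hω.1).1 u

theorem vanishesOn_of_agree (hω : ω ∈ T.deepestSingularity p) {z : T.Param}
    (hS : ∀ c ∈ S, T.IsDegenerateCoord p c ∧ z c = ω c) : VanishesOn z S := by
  intro c hc
  obtain ⟨h1, h2⟩ := hS c hc
  have h3 := (mem_deepestSingularity.1 hω).2 c (mem_fullCutset.2 h1)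
  cases c with
  | inl v =>
    change z (Sum.inl v) ^ 2 = 1
    rw [h2]
    exact h3
  | inr e =>
    change z (Sum.inr e) = 0
    rw [h2]
    exact h3

theorem deepest_edge (hω : ω ∈ T.deepestSingularity p) {e : T.Edge} (he : e ∉ T.linked p) :
    ω (Sum.inr e) = 0 :=
  (mem_deepestSingularity.1 hω).2 (Sum.inr e) (mem_fullCutset.2 he)

theorem isCutset_erase_node (v : V) : T.IsCutset p ((T.fullCutset p).erase (Sum.inl v)) := by
  refine ⟨fun c hc => mem_fullCutset.1 (Finset.mem_of_mem_erase hc), fun F _ hF => ?_⟩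
  obtain ⟨e, he, hel⟩ := Finset.not_subset.1 hF
  exact Or.inl ⟨e, he, Finset.mem_erase.2 ⟨by simp, mem_fullCutset.2 hel⟩⟩

/-- The degenerate end of `e` takes over the role of `e`. -/
theorem isCutset_erase_edge {e : T.Edge} {v : V} (hv : v ∈ T.degenerateNodes p) (he : e.Inc v) :
    T.IsCutset p ((T.fullCutset p).erase (Sum.inr e)) := by
  refine ⟨fun c hc => mem_fullCutset.1 (Finset.mem_of_mem_erase hc), fun F _ hF => ?_⟩
  obtain ⟨f, hf, hfl⟩ := Finset.not_subset.1 hF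
  by_cases hfe : f = e
  · subst hfe
    exact Or.inr ⟨v, edgeDeg_pos hf he, Finset.mem_erase.2 ⟨by simp, mem_fullCutset.2 hv⟩⟩
  · exact Or.inl ⟨f, hf, Finset.mem_erase.2 ⟨by simpa using hfe, mem_fullCutset.2 hfl⟩⟩

/-- A leaf-closed set containing `e` has a second edge at the inner node `v`, and this edge is
isolated too because `v` is degenerate. -/
theorem isCutset_erase_edge_node {e : T.Edge} {v : V} (hv : v ∈ T.degenerateNodes p)
    (he : e.Inc v) :
    T.IsCutset p (((T.fullCutset p).erase (Sum.inr e)).erase (Sum.inl v)) := by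
  refine ⟨fun c hc => mem_fullCutset.1 (Finset.mem_of_mem_erase (Finset.mem_of_mem_erase hc)),
    fun F hFc hF => ?_⟩
  suffices h : ∃ f ∈ F, f ∉ T.linked p ∧ f ≠ e by
    obtain ⟨f, hf, hfl, hfe⟩ := h
    exact Or.inl ⟨f, hf, Finset.mem_erase.2 ⟨by simp, Finset.mem_erase.2
      ⟨by simpa using hfe, mem_fullCutset.2 hfl⟩⟩⟩
  obtain ⟨f, hf, hfl⟩ := Finset.not_subset.1 hF
  by_cases hfe : f = e
  · subst hfe
    have h1 := edgeDeg_pos hf he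
    have h2 : edgeDeg F v ≠ 1 := fun h => (mem_degenerateNodes_iff.1 hv).1 (hFc v h)
    obtain ⟨g, hg, hgv, hgf⟩ := exists_second (show 2 ≤ edgeDeg F v by omega) f
    exact ⟨g, hg, fun h => hgv.notMem_degenerateNodes h hv, hgf⟩
  · exact ⟨f, hf, hfl, hfe⟩

theorem bit_sub_mean {y : T.Param} (hy : y ∈ T.omegaSpace) (a : Bool) (v : V) :
    -1 ≤ bit a - mean y v ∧ bit a - mean y v ≤ 1 := by
  have h := mean_mem_Icc hy v
  rw [Set.mem_Icc] at h
  cases a <;> simp only [bit, if_true, Bool.false_eq_true, if_false] <;> constructor <;> linarith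

/-- Only the coordinates erased from the full cutset move, and what is left is still a cutset. It
remains to check the inequalities defining `omegaSpace` for small parameters. -/
theorem eventually_mem_omegaFiber
    (hleaf : ∀ i : T.Leaf, T.leafMean p i * (1 - T.leafMean p i) ≠ 0)
    (hω : ω ∈ T.deepestSingularity p) {c : V ⊕ T.Edge} (hc : c ∈ T.contactCoords p) :
    ∀ᶠ s : ℝ in 𝓝[>] 0, ω + s • fiberDirection p ω c ∈ T.omegaFiber p := by
  have hωf := hω.1
  have hωΩ := (mem_omegaFiber.1 hωf).1
  cases c with
  | inl v =>
    have hv := inl_mem_contactCoords.1 hc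
    filter_upwards [Ioo_mem_nhdsGT (zero_lt_one' ℝ)] with s hs
    set z : T.Param := ω + s • fiberDirection p ω (Sum.inl v) with hz
    have hzv : z (Sum.inl v) = ω (Sum.inl v) + s * -ω (Sum.inl v) := by
      simp [hz, fiberDirection]
    have hzo : ∀ c, c ≠ Sum.inl v → z c = ω c := by
      intro c hc
      simp [hz, fiberDirection, Pi.single_eq_of_ne hc]
    have hag : ∀ c, ¬ T.IsDegenerateCoord p c → z c = ω c := fun c hc =>
      hzo c (by rintro rfl; exact hc hv)
    have hm := mean_shrink_mem_Icc hω hv hs.1 hs.2 hzv fun u hu => hzo _ (by simpa using hu)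
    have hzΩ : z ∈ T.omegaSpace := mem_omegaSpace_of_agree hωΩ hag hm fun e he =>
      Or.inl (by rw [hzo _ (by simp), deepest_edge hω he])
    refine mem_omegaFiber_of_agree hleaf hωf hzΩ (isCutset_erase_node v)
      (vanishesOn_of_agree hω fun c hc => ?_) hag
    rw [Finset.mem_erase, mem_fullCutset] at hc
    exact ⟨hc.2, hzo c hc.1⟩
  | inr e =>
    obtain ⟨v, hv, hev⟩ := inr_mem_contactCoords.1 hc
    have hel : e ∉ T.linked p := fun h => hev.notMem_degenerateNodes h hv
    have he0 := deepest_edge hω hel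
    by_cases ht : e.tgt ∈ T.degenerateNodes p
    · filter_upwards [Ioo_mem_nhdsGT (zero_lt_one' ℝ)] with s hs
      set z : T.Param := ω + s • fiberDirection p ω (Sum.inr e) with hz
      have hzv : z (Sum.inl e.tgt) = ω (Sum.inl e.tgt) + s * -ω (Sum.inl e.tgt) := by
        simp [hz, fiberDirection, ht]
      have hze : z (Sum.inr e) = s / 2 := by
        simp [hz, fiberDirection, ht, he0]
        ring
      have hzo : ∀ c, c ≠ Sum.inr e → c ≠ Sum.inl e.tgt → z c = ω c := by
        intro c hc hc'
        simp [hz, fiberDirection, ht, Pi.single_eq_of_ne hc, Pi.single_eq_of_ne hc']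
      have hag : ∀ c, ¬ T.IsDegenerateCoord p c → z c = ω c := fun c hc =>
        hzo c (by rintro rfl; exact hc hel) (by rintro rfl; exact hc ht)
      have hm := mean_shrink_mem_Icc hω ht hs.1 hs.2 hzv fun u hu =>
        hzo _ (by simp) (by simpa using hu)
      have hzΩ : z ∈ T.omegaSpace := by
        refine mem_omegaSpace_of_agree hωΩ hag hm fun f hf => ?_
        by_cases hfe : f = e
        · subst hfe
          refine Or.inr fun a => ?_
          have hsrc : mean z f.src = mean ω f.src := by
            unfold mean
            rw [hzo _ (by simp) (by simpa using f.src_ne_tgt)]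
          have hb := bit_sub_mean hωΩ a f.src
          have h1 := hs.1
          have h2 := hs.2
          rw [hsrc, hze]
          rcases mean_shrink hω ht hzv with h | h <;> rw [h] <;> constructor <;> nlinarith
        · exact Or.inl (by rw [hzo _ (by simpa using hfe) (by simp), deepest_edge hω hf])
      refine mem_omegaFiber_of_agree hleaf hωf hzΩ (isCutset_erase_edge_node ht (Or.inr rfl))
        (vanishesOn_of_agree hω fun c hc => ?_) hag
      rw [Finset.mem_erase, Finset.mem_erase, mem_fullCutset] at hc
      exact ⟨hc.2.2, hzo c hc.2.1 hc.1⟩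
    · have hvar := omegaFiber_var_pos hleaf hωf ht
      rw [var_eq_mean] at hvar
      have hmt := mean_mem_Icc hωΩ e.tgt
      have hm0 : 0 < mean ω e.tgt := lt_of_le_of_ne hmt.1 fun h => by simp [← h] at hvar
      have hm1 : mean ω e.tgt < 1 := lt_of_le_of_ne hmt.2 fun h => by simp [h] at hvar
      filter_upwards [Ioo_mem_nhdsGT (lt_min hm0 (sub_pos.2 hm1))] with s hs
      set z : T.Param := ω + s • fiberDirection p ω (Sum.inr e) with hz
      have hze : z (Sum.inr e) = s := by
        simp [hz, fiberDirection, ht, he0]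
      have hzo : ∀ c, c ≠ Sum.inr e → z c = ω c := by
        intro c hc
        simp [hz, fiberDirection, ht, Pi.single_eq_of_ne hc]
      have hag : ∀ c, ¬ T.IsDegenerateCoord p c → z c = ω c := fun c hc =>
        hzo c (by rintro rfl; exact hc hel)
      have hmz : ∀ u, mean z u = mean ω u := fun u => by
        unfold mean
        rw [hzo _ (by simp)]
      have hzΩ : z ∈ T.omegaSpace := by
        refine mem_omegaSpace_of_agree hωΩ hag (fun u => hmz u ▸ mean_mem_Icc hωΩ u) fun f hf => ?_
        by_cases hfe : f = e
        · subst hfe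
          refine Or.inr fun a => ?_
          have hb := bit_sub_mean hωΩ a f.src
          have h1 := hs.1
          have h2 := hs.2.trans_le (min_le_left _ _)
          have h3 := hs.2.trans_le (min_le_right _ _)
          rw [hmz, hmz, hze]
          constructor <;> nlinarith
        · exact Or.inl (by rw [hzo _ (by simpa using hfe), deepest_edge hω hf])
      refine mem_omegaFiber_of_agree hleaf hωf hzΩ (isCutset_erase_edge hv hev)
        (vanishesOn_of_agree hω fun c hc => ?_) hag
      rw [Finset.mem_erase, mem_fullCutset] at hc
      exact ⟨hc.2, hzo c hc.1⟩

theorem sum_fiberDirection_ne_zero (hω : ω ∈ T.deepestSingularity p) {c : V ⊕ T.Edge}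
    (hc : c ∈ T.contactCoords p) : (∑ c ∈ T.contactCoords p, fiberDirection p ω c) c ≠ 0 := by
  rw [Finset.sum_apply]
  cases c with
  | inl v =>
    have hv := deepest_sq hω (inl_mem_contactCoords.1 hc)
    -- Each direction either keeps μ̄_v or moves it from ±1 towards zero, so no cancellation occurs.
    suffices h : 0 < (∑ c ∈ T.contactCoords p, fiberDirection p ω c (Sum.inl v)) *
        -ω (Sum.inl v) from left_ne_zero_of_mul h.ne'
    rw [Finset.sum_mul]
    refine Finset.sum_pos' (fun c _ => ?_) ⟨_, hc, ?_⟩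
    · cases c with
      | inl u =>
        by_cases hu : v = u
        · subst hu
          simp [fiberDirection, ← sq, hv]
        · simp [fiberDirection, hu]
      | inr e =>
        by_cases ht : e.tgt ∈ T.degenerateNodes p
        · by_cases hu : v = e.tgt
          · subst hu
            simp [fiberDirection, ht, ← sq, hv]
          · simp [fiberDirection, ht, hu]
        · simp [fiberDirection, ht]
    · simp [fiberDirection, ← sq, hv]
  | inr e =>
    rw [Finset.sum_eq_single_of_mem _ hc]
    · by_cases ht : e.tgt ∈ T.degenerateNodes p <;> simp [fiberDirection, ht]
    · intro c _ hce
      cases c with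
      | inl u => simp [fiberDirection]
      | inr f =>
        have hfe : e ≠ f := fun h => hce (h ▸ rfl)
        by_cases ht : f.tgt ∈ T.degenerateNodes p <;> simp [fiberDirection, ht, hfe]

/-- A set between the fiber and the union of the strata is singular at the deepest
singularities. -/
theorem not_isManifoldWithCornersNear [Nontrivial V]
    (hleaf : ∀ i : T.Leaf, T.leafMean p i * (1 - T.leafMean p i) ≠ 0)
    (hdeg : (T.degenerateNodes p).Nonempty) (hω : ω ∈ T.deepestSingularity p)
    {X : Set T.Param} (hX : T.omegaFiber p ⊆ X)
    (hX' : ∀ y ∈ X, ∃ S, T.IsCutset p S ∧ VanishesOn y S) :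
    ¬ IsManifoldWithCornersNear X ω := by
  intro h
  -- Close to the deepest point the sign of μ̄_v cannot flip, so that μ̄_v² = 1 means an unchanged
  -- coordinate.
  have hN : {y : T.Param | ∀ v, v ∈ T.degenerateNodes p → y (Sum.inl v) ≠ -ω (Sum.inl v)}
      ∈ 𝓝 ω := by
    change ∀ᶠ y in 𝓝 ω, _
    rw [Filter.eventually_all]
    intro v
    by_cases hv : v ∈ T.degenerateNodes p
    · have h1 := deepest_sq hω hv
      have hne : ω (Sum.inl v) ≠ -ω (Sum.inl v) := fun h2 => by
        have : ω (Sum.inl v) = 0 := by linarith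
        simp [this] at h1
      filter_upwards [(continuous_apply (Sum.inl v)).continuousAt.eventually_ne hne] with y hy _
        using hy
    · exact Filter.Eventually.of_forall fun y h => absurd h hv
  obtain ⟨y, ⟨hyX, hyN⟩, hy⟩ := h.exists_mem_ne (hX hω.1) (T.contactCoords p)
    (fiberDirection p ω)
    (fun c hc => (eventually_mem_omegaFiber hleaf hω hc).mono fun s hs => hX hs) hN
  obtain ⟨S, hS, hyS⟩ := hX' y hyX
  obtain ⟨c, hcS, hc⟩ := hS.exists_contact hdeg
  refine hy c (sum_fiberDirection_ne_zero hω hc) ?_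
  have h1 := hyS c hcS
  cases c with
  | inl v =>
    have hv := inl_mem_contactCoords.1 hc
    have h2 : y (Sum.inl v) ^ 2 = ω (Sum.inl v) ^ 2 := by
      rw [deepest_sq hω hv]
      exact h1
    exact (sq_eq_sq_iff_eq_or_eq_neg.1 h2).resolve_right (hyN v hv)
  | inr e => exact Eq.trans h1 (deepest_edge hω (hS.1 _ hcS)).symm

theorem deepestSingularity_subset_frontier (hdeg : (T.degenerateNodes p).Nonempty) :
    T.deepestSingularity p ⊆ frontier T.omegaSpace := by
  intro ω hω
  have hωΩ := (mem_omegaFiber.1 hω.1).1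
  refine ⟨subset_closure hωΩ, fun hint => ?_⟩
  obtain ⟨v, hv⟩ := hdeg
  have h1 := deepest_sq hω hv
  -- Pushing μ̄_v outward beyond ±1 makes the variance at `v` negative.
  let δ : T.Param := Pi.single (Sum.inl v) (ω (Sum.inl v))
  have hcont : Continuous fun s : ℝ => ω + s • δ := by
    fun_prop
  have h2 := hcont.tendsto 0
  simp only [zero_smul, add_zero] at h2
  have h3 : ∀ᶠ s : ℝ in 𝓝[>] 0, ω + s • δ ∈ T.omegaSpace :=
    (h2.mono_left nhdsWithin_le_nhds) (mem_interior_iff_mem_nhds.1 hint)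
  obtain ⟨s, hs, hs0⟩ := (h3.and self_mem_nhdsWithin).exists
  have h4 := var_nonneg hs v
  have hs0' : 0 < s := hs0
  simp only [var, δ, Pi.add_apply, Pi.smul_apply, Pi.single_eq_same, smul_eq_mul] at h4
  have h5 : (ω (Sum.inl v) + s * ω (Sum.inl v)) ^ 2 = (1 + s) ^ 2 := by
    rw [show ω (Sum.inl v) + s * ω (Sum.inl v) = (1 + s) * ω (Sum.inl v) by ring, mul_pow, h1,
      mul_one]
  rw [h5] at h4
  nlinarith

end Singular

end Main

end BinaryTreeModel

open BinaryTreeModel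

theorem theorem5p8 {V : Type*} [Fintype V] [DecidableEq V] [Nontrivial V] (T : BinaryTreeModel V)
    (p : (T.Leaf → Bool) → ℝ) (hp : p ∈ T.model)
    (hleaf : ∀ i : T.Leaf, T.leafMean p i * (1 - T.leafMean p i) ≠ 0)
    (hdeg : (T.degenerateNodes p).Nonempty) :
    (∃ (k : ℕ) (M : Fin k → Set T.Param),
      (∀ j, IsSmoothSubmanifold (M j) ∧ IsRealVariety (M j)) ∧
      T.omegaFiber p = (⋃ j, M j) ∩ T.omegaSpace ∧
      (⋂ j, M j) ∩ T.omegaSpace = T.deepestSingularity p ∧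
      ∀ ω ∈ T.deepestSingularity p, ∀ d : ℕ, ¬ IsSubmanifoldNear (⋃ j, M j) d ω) ∧
    (T.deepestSingularity p).Nonempty ∧
    T.deepestSingularity p ⊆ frontier T.omegaSpace ∧
    (∀ ω ∈ T.deepestSingularity p, ¬ IsManifoldWithCornersNear (T.omegaFiber p) ω) := by
  classical
  have hfiber : (T.omegaFiber p).Nonempty := by
    obtain ⟨θ, hθ, hθp⟩ := hp
    exact ⟨_, θ, ⟨hθ, hθp⟩, rfl⟩
  -- One stratum is taken for every cutset, of which there are finitely many.
  let e := Fintype.equivFin {S : Finset (V ⊕ T.Edge) // T.IsCutset p S}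
  let M : Fin _ → Set T.Param := fun j => stratum hleaf (e.symm j).1 (e.symm j).2
  have hM : ∀ (S : Finset (V ⊕ T.Edge)) (hS : T.IsCutset p S),
      M (e ⟨S, hS⟩) = stratum hleaf S hS := by
    intro S hS
    simp only [M]
    rw [e.symm_apply_apply]
  have hsub : T.omegaFiber p ⊆ ⋃ j, M j := by
    intro y hy
    refine Set.mem_iUnion.2 ⟨e ⟨zeroSet p y, isCutset_zeroSet hleaf hy⟩, ?_⟩
    rw [hM]
    exact mem_stratum_of_mem hy vanishesOn_zeroSet
  refine ⟨⟨_, M, fun j => ⟨isSmoothSubmanifold_stratum, isRealVariety_stratum⟩, ?_, ?_, ?_⟩,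
    deepestSingularity_nonempty hleaf hfiber, deepestSingularity_subset_frontier hdeg, ?_⟩
  · ext y
    refine ⟨fun hy => ⟨hsub hy, (mem_omegaFiber.1 hy).1⟩, ?_⟩
    rintro ⟨hy, hyΩ⟩
    obtain ⟨j, hj⟩ := Set.mem_iUnion.1 hy
    exact mem_omegaFiber_of_mem_stratum hj hyΩ
  · ext y
    rw [mem_deepestSingularity]
    constructor
    · rintro ⟨hy, hyΩ⟩
      -- The stratum of the full cutset alone gives this inclusion. For the converse, every cutset
      -- is contained in the full one.
      have h := Set.mem_iInter.1 hy (e ⟨T.fullCutset p, isCutset_fullCutset⟩)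
      rw [hM] at h
      exact ⟨mem_omegaFiber_of_mem_stratum h hyΩ, vanishesOn_of_mem_stratum h⟩
    · rintro ⟨hy, hyS⟩
      refine ⟨Set.mem_iInter.2 fun j => mem_stratum_of_mem hy fun c hc => hyS c ?_,
        (mem_omegaFiber.1 hy).1⟩
      exact mem_fullCutset.2 ((e.symm j).2.1 c hc)
  · intro ω hω d h
    refine not_isManifoldWithCornersNear hleaf hdeg hω hsub (fun y hy => ?_)
      h.isManifoldWithCornersNear
    obtain ⟨j, hj⟩ := Set.mem_iUnion.1 hy
    exact ⟨_, (e.symm j).2, vanishesOn_of_mem_stratum hj⟩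
  · intro ω hω
    exact not_isManifoldWithCornersNear hleaf hdeg hω subset_rfl fun y hy =>
      ⟨_, isCutset_zeroSet hleaf hy, vanishesOn_zeroSet⟩
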